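/- Let $R\subset\mathfrak h_{\mathbb R}^*$ be a reduced crystallographic root system (not necessarily irreducible) with Weyl group $W$, positive system $R_+$, coroot lattice $Q^\vee$ and weight lattice $P$, and let $\mathfrak h_{\mathbb R}$ carry a $W$-invariant inner product; $|\alpha|$ is the induced dual norm of a root $\alpha$. Let $T=\mathfrak h_{\mathbb R}/2\pi Q^\vee$ with normalized Haar measure $\mu$, and let $k_\alpha\in\mathbb R$ satisfy $k_{w\alpha}=k_\alpha$ for $w\in W$. Put $$V_\alpha=|\alpha|^2\Bigl(\frac1{4\sin^2(\langle\alpha,h\rangle/2)}-\frac1{12}\Bigr),\qquad V=\sum_{\alpha\in R_+}k_\alpha(k_\alpha-1)V_\alpha,\qquad \Delta_k=\prod_{\alpha\in R_+}|\sin(\langle\alpha,h\rangle/2)|^{k_\alpha}.$$ Let $\mathbb C[P]$ be the span of the functions $e^\lambda(h)=e^{\sqrt{-1}\langle\lambda,h\rangle}$, $\lambda\in P$, on $T$, and $\mathcal P=\mathbb C[P]^W\Delta_k\subset L^2(T,d\mu)^W$. Let $\mathcal H_T u=-\nabla^2u+Vu$, where $\nabla^2$ is the Laplacian, be the operator in the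 Hilbert space $L^2(T,d\mu)^W$ with domain $C^2(T)^W\cap\mathsf D(V)$, where $\mathsf D(V)$ is the common domain of the multiplication operators by the functions $V_\alpha$, $\alpha\in R_+$, that is, the set of all $u\in L^2(T,d\mu)$ with $V_\alpha u\in L^2(T,d\mu)$ for every $\alpha\in R_+$. **Theorem.** Assume $k_\alpha\ge 0$ for all $\alpha$. Then $\mathcal H_T$ is densely defined in $L^2(T,d\mu)^W$, the domain of its adjoint $\mathcal H_T^*$ contains $\mathcal P$, and the restriction $\mathcal H_T^*|_{\mathcal P}$ is essentially self-adjoint, i.e. densely defined and closable with self-adjoint closure. If moreover $k_\alpha\ne1$ for all $\alpha$, the same holds when $\mathsf D(V)$ is taken to be the domain of multiplication by the total potential $V$, i.e. the set of all $u\in L^2(T,d\mu)$ with $Vu\in L^2(T,d\mu)$. -/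

import Mathlib

open MeasureTheory InnerProductSpace

namespace TrigCMS

noncomputable section

set_option linter.unusedSectionVars false

variable {ι M V : Type*} [Fintype ι] [AddCommGroup M] [Module ℝ M]
  [NormedAddCommGroup V] [InnerProductSpace ℝ V] [FiniteDimensional ℝ V]
  (P : RootPairing ι ℝ M V)

/-! ### The torus `T = V / 2πQ^∨` -/

/-- The lattice `2πQ^∨`, generated by the vectors `2π α^∨`. -/
def torusLattice : AddSubgroup V :=
  AddSubgroup.closure (Set.range fun i => (2 * Real.pi) • P.coroot i)

/-- The torus `T = V / 2πQ^∨`, with the quotient topology and its Borel σ-algebra. -/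
def Torus : Type _ := V ⧸ torusLattice P

instance : AddCommGroup (Torus P) := inferInstanceAs (AddCommGroup (V ⧸ torusLattice P))
instance : TopologicalSpace (Torus P) := inferInstanceAs (TopologicalSpace (V ⧸ torusLattice P))
instance : IsTopologicalAddGroup (Torus P) :=
  inferInstanceAs (IsTopologicalAddGroup (V ⧸ torusLattice P))
instance : MeasurableSpace (Torus P) := borel _
instance : BorelSpace (Torus P) := ⟨rfl⟩

/-- The projection `h ↦ ḣ` from `V` to `T`. -/
def proj : V →+ Torus P := QuotientAddGroup.mk' (torusLattice P)

lemma proj_surjective : Function.Surjective (proj P) := QuotientAddGroup.mk'_surjective _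

lemma continuous_proj : Continuous (proj P) := continuous_quotient_mk'

lemma proj_eq_iff (x y : V) : proj P x = proj P y ↔ y - x ∈ torusLattice P := by
  have : proj P x = proj P y ↔ -x + y ∈ torusLattice P := QuotientAddGroup.eq
  rw [this, neg_add_eq_sub]

instance [P.IsRootSystem] : CompactSpace (Torus P) := by
  let Φ : (ι → ℝ) → Torus P := fun c => proj P (∑ i, c i • ((2 * Real.pi) • P.coroot i))
  have hΦ : Continuous Φ := (continuous_proj P).comp (by fun_prop)
  have hK : IsCompact (Φ '' Set.Icc 0 1) := isCompact_Icc.image hΦ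
  refine ⟨?_⟩
  convert hK
  symm
  rw [Set.eq_univ_iff_forall]
  intro t
  obtain ⟨h, rfl⟩ := proj_surjective P t
  have hs : h ∈ Submodule.span ℝ (Set.range P.coroot) := by
    rw [RootPairing.IsRootSystem.span_coroot_eq_top]; trivial
  obtain ⟨c, rfl⟩ := (Submodule.mem_span_range_iff_exists_fun ℝ).1 hs
  have hpi : (2 * Real.pi) ≠ 0 := by positivity
  refine ⟨fun i => Int.fract (c i / (2 * Real.pi)), ⟨fun i => Int.fract_nonneg _,
    fun i => (Int.fract_lt_one _).le⟩, ?_⟩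
  rw [proj_eq_iff, ← Finset.sum_sub_distrib]
  refine AddSubgroup.sum_mem _ fun i _ => ?_
  have : c i • P.coroot i - Int.fract (c i / (2 * Real.pi)) • ((2 * Real.pi) • P.coroot i)
      = ⌊c i / (2 * Real.pi)⌋ • ((2 * Real.pi) • P.coroot i) := by
    rw [← Int.cast_smul_eq_zsmul ℝ, smul_smul, smul_smul, ← sub_smul, ← Int.self_sub_floor]
    congr 1
    field_simp
    ring
  rw [this]
  exact AddSubgroup.zsmul_mem _ (AddSubgroup.subset_closure (Set.mem_range_self i)) _

/-- The normalized Haar measure on `T`. -/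
def haarT [P.IsRootSystem] : Measure (Torus P) :=
  Measure.addHaarMeasure (⊤ : TopologicalSpace.PositiveCompacts (Torus P))

instance [P.IsRootSystem] : (haarT P).IsAddHaarMeasure := by unfold haarT; infer_instance
instance [P.IsRootSystem] : (haarT P).Regular := by unfold haarT; infer_instance
instance [P.IsRootSystem] : IsProbabilityMeasure (haarT P) :=
  ⟨Measure.addHaarMeasure_self (K₀ := (⊤ : TopologicalSpace.PositiveCompacts (Torus P)))⟩

/-- The function on `T` induced by a function on `V` that is periodic under `2πQ^∨`. -/
def descend {E : Type*} (f : V → E) (t : Torus P) : E := f (Function.surjInv (proj_surjective P) t)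

lemma descend_proj {E : Type*} {f : V → E} (hf : ∀ l ∈ torusLattice P, ∀ x, f (x + l) = f x)
    (h : V) : descend P f (proj P h) = f h := by
  have := (proj_eq_iff P _ _).1 (Function.surjInv_eq (proj_surjective P) (proj P h))
  rw [descend, ← hf _ this]
  congr 1
  abel

/-! ### The Weyl group -/

/-- The Weyl group `W`, acting on `V`. -/
def weyl : Subgroup (V ≃ₗ[ℝ] V) := Subgroup.closure (Set.range P.coreflection)

lemma weyl_map_lattice (w : weyl P) :
    torusLattice P ≤ (torusLattice P).comap (w : V ≃ₗ[ℝ] V).toLinearMap.toAddMonoidHom := by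
  have gen : ∀ i : ι, ∀ z ∈ torusLattice P, P.coreflection i z ∈ torusLattice P := by
    intro i
    suffices torusLattice P ≤
        (torusLattice P).comap (P.coreflection i).toLinearMap.toAddMonoidHom from this
    refine (AddSubgroup.closure_le _).2 ?_
    rintro _ ⟨j, rfl⟩
    refine AddSubgroup.subset_closure ⟨P.reflectionPerm i j, ?_⟩
    simp [RootPairing.coroot_reflectionPerm]
  have key : ∀ w ∈ weyl P, ∀ z ∈ torusLattice P,
      w z ∈ torusLattice P ∧ w⁻¹ z ∈ torusLattice P := by
    intro w hw
    induction hw using Subgroup.closure_induction with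
    | mem x hx =>
      obtain ⟨i, rfl⟩ := hx
      rw [P.coreflection_inv]
      exact fun z hz => ⟨gen i z hz, gen i z hz⟩
    | one => exact fun z hz => ⟨hz, by simpa using hz⟩
    | mul x y _ _ hx hy =>
      intro z hz
      rw [mul_inv_rev]
      exact ⟨(hx _ (hy z hz).1).1, (hy _ (hx z hz).2).2⟩
    | inv x _ hx =>
      rw [inv_inv]
      exact fun z hz => (hx z hz).symm
  exact fun l hl => (key w w.2 l hl).1

/-- The action of the Weyl group on `T`. -/
def weylT (w : weyl P) : Torus P →+ Torus P :=
  QuotientAddGroup.map _ _ (w : V ≃ₗ[ℝ] V).toLinearMap.toAddMonoidHom (weyl_map_lattice P w)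

lemma weylT_proj (w : weyl P) (h : V) : weylT P w (proj P h) = proj P ((w : V ≃ₗ[ℝ] V) h) := rfl

lemma continuous_weylT (w : weyl P) : Continuous (weylT P w) :=
  continuous_quot_lift _ ((continuous_proj P).comp
    (w : V ≃ₗ[ℝ] V).toLinearMap.continuous_of_finiteDimensional)

lemma weylT_surjective (w : weyl P) : Function.Surjective (weylT P w) := by
  intro t
  obtain ⟨h, rfl⟩ := proj_surjective P t
  exact ⟨proj P ((w : V ≃ₗ[ℝ] V).symm h), by simp [weylT_proj]⟩

lemma weylT_measurePreserving [P.IsRootSystem] (w : weyl P) :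
    MeasurePreserving (weylT P w) (haarT P) (haarT P) :=
  (weylT P w).measurePreserving (continuous_weylT P w) (weylT_surjective P w) rfl

/-- The Weyl group invariant functions on `T`. -/
def invariants : Submodule ℂ (Torus P → ℂ) where
  carrier := {u | ∀ w t, u (weylT P w t) = u t}
  zero_mem' := by simp
  add_mem' hu hv w t := by simp [hu w t, hv w t]
  smul_mem' c u hu w t := by simp [hu w t]

/-- The Hilbert space `L²(T, dμ)^W`. -/
def L2W [P.IsRootSystem] : Submodule ℂ (Lp ℂ 2 (haarT P)) where
  carrier := {f | ∀ w, (fun t => f (weylT P w t)) =ᵐ[haarT P] f}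
  zero_mem' w := by
    have h := Lp.coeFn_zero ℂ 2 (haarT P)
    filter_upwards [h, (weylT_measurePreserving P w).quasiMeasurePreserving.ae h] with t h1 h2
    exact h2.trans h1.symm
  add_mem' {f g} hf hg w := by
    have h := Lp.coeFn_add f g
    filter_upwards [h, (weylT_measurePreserving P w).quasiMeasurePreserving.ae h, hf w, hg w]
      with t h1 h2 h3 h4
    change (f + g : Lp ℂ 2 (haarT P)) _ = (f + g : Lp ℂ 2 (haarT P)) _
    rw [h1, h2, Pi.add_apply, Pi.add_apply, h3, h4]
  smul_mem' c f hf w := by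
    have h := Lp.coeFn_smul c f
    filter_upwards [h, (weylT_measurePreserving P w).quasiMeasurePreserving.ae h, hf w]
      with t h1 h2 h3
    change (c • f : Lp ℂ 2 (haarT P)) _ = (c • f : Lp ℂ 2 (haarT P)) _
    rw [h1, h2, Pi.smul_apply, Pi.smul_apply, h3]

lemma isClosed_L2W [P.IsRootSystem] : IsClosed (L2W P : Set (Lp ℂ 2 (haarT P))) := by
  have : (L2W P : Set (Lp ℂ 2 (haarT P))) =
      ⋂ w, {f | Lp.compMeasurePreserving _ (weylT_measurePreserving P w) f = f} := by
    ext f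
    simp only [SetLike.mem_coe, Set.mem_iInter, Set.mem_ofPred_eq]
    refine forall_congr' fun w => ?_
    have h := Lp.coeFn_compMeasurePreserving f (weylT_measurePreserving P w)
    rw [Lp.ext_iff]
    exact ⟨fun hf => h.trans hf, fun hf => h.symm.trans hf⟩
  rw [this]
  exact isClosed_iInter fun w => isClosed_eq
    (Lp.isometry_compMeasurePreserving (weylT_measurePreserving P w)).continuous continuous_id

instance [P.IsRootSystem] : CompleteSpace (L2W P) := (isClosed_L2W P).completeSpace_coe

/-! ### Weights and `ℂ[P]^W` -/

/-- The weight lattice. -/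
def weights : Set M := {l | ∀ i, ∃ n : ℤ, P.toLinearMap l (P.coroot i) = n}

lemma weight_lattice {l : M} (hl : l ∈ weights P) {x : V} (hx : x ∈ torusLattice P) :
    ∃ n : ℤ, P.toLinearMap l x = n * (2 * Real.pi) := by
  induction hx using AddSubgroup.closure_induction with
  | mem x hx =>
    obtain ⟨i, rfl⟩ := hx
    obtain ⟨n, hn⟩ := hl i
    exact ⟨n, by simp [hn, mul_comm]⟩
  | zero => exact ⟨0, by simp⟩
  | add x y _ _ hx hy =>
    obtain ⟨m, hm⟩ := hx
    obtain ⟨n, hn⟩ := hy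
    exact ⟨m + n, by simp [hm, hn, add_mul]⟩
  | neg x _ hx =>
    obtain ⟨m, hm⟩ := hx
    exact ⟨-m, by simp [hm]⟩

/-- The function `e^λ` on `T`, `ḣ ↦ exp (i⟨λ, h⟩)`. -/
def expWeight (l : M) : Torus P → ℂ :=
  descend P fun h => Complex.exp (Complex.I * (P.toLinearMap l h : ℝ))

lemma expWeight_proj {l : M} (hl : l ∈ weights P) (h : V) :
    expWeight P l (proj P h) = Complex.exp (Complex.I * (P.toLinearMap l h : ℝ)) := by
  refine descend_proj P (fun x hx y => ?_) h
  obtain ⟨n, hn⟩ := weight_lattice P hl hx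
  rw [map_add, hn, Complex.exp_eq_exp_iff_exists_int]
  exact ⟨n, by push_cast; ring⟩

/-- `ℂ[P]`, as a space of functions on `T`. -/
def expPoly : Submodule ℂ (Torus P → ℂ) := Submodule.span ℂ (expWeight P '' weights P)

/-- `ℂ[P]^W`, as a space of functions on `T`. -/
def expPolyW : Submodule ℂ (Torus P → ℂ) := expPoly P ⊓ invariants P

/-! ### The potential and the function `Δ` -/

/-- `|sin (⟨α, h⟩ / 2)|` as a function on `T`. -/
def absSin (i : ι) : Torus P → ℝ := descend P fun h => |Real.sin (P.root' i h / 2)|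

lemma absSin_proj [P.IsCrystallographic] (i : ι) (h : V) :
    absSin P i (proj P h) = |Real.sin (P.root' i h / 2)| := by
  refine descend_proj P (fun x hx y => ?_) h
  have hi : P.root i ∈ weights P := fun j => by
    obtain ⟨n, hn⟩ := P.exists_value (S := ℤ) i j
    exact ⟨n, by simpa using hn.symm⟩
  obtain ⟨n, hn⟩ := weight_lattice P hi hx
  have : P.root' i (y + x) / 2 = P.root' i y / 2 + n * Real.pi := by
    rw [map_add]
    change (_ + P.toLinearMap (P.root i) x) / 2 = _
    rw [hn]; ring
  rw [this, Real.sin_add_int_mul_pi]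
  rcases Int.even_or_odd n with h | h <;> simp [h.neg_one_zpow]

/-- `|α|²`, for the norm on the dual of `V` that is induced by the inner product of `V`. -/
def rootNormSq (i : ι) : ℝ := ‖LinearMap.toContinuousLinearMap (P.root' i)‖ ^ 2

/-- The function `|α|² (1 / (4 sin² (⟨α, h⟩ / 2)) - 1 / 12)` on `T`. -/
def potentialTerm (i : ι) (t : Torus P) : ℝ :=
  rootNormSq P i * (1 / (4 * absSin P i t ^ 2) - 1 / 12)

open scoped Classical in
/-- The potential `∑_{α > 0} k_α (k_α - 1) |α|² (1 / (4 sin² (⟨α, h⟩ / 2)) - 1 / 12)`. -/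
def potential [P.IsCrystallographic] (b : P.Base) (k : ι → ℝ) (t : Torus P) : ℝ :=
  ∑ i with b.IsPos i, k i * (k i - 1) * potentialTerm P i t

open scoped Classical in
/-- The function `Δ = ∏_{α > 0} |sin (⟨α, h⟩ / 2)| ^ k_α` on `T`. -/
def groundState [P.IsCrystallographic] (b : P.Base) (k : ι → ℝ) (t : Torus P) : ℝ :=
  ∏ i with b.IsPos i, absSin P i t ^ k i

/-! ### The Hamiltonian -/

/-- `C²(T)`. -/
def C2 : Submodule ℂ (Torus P → ℂ) where
  carrier := {u | ContDiff ℝ 2 fun h => u (proj P h)}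
  zero_mem' := show ContDiff ℝ 2 fun _ : V => (0 : ℂ) from contDiff_const
  add_mem' {u v} hu hv := by
    have hu : ContDiff ℝ 2 fun h => u (proj P h) := hu
    have hv : ContDiff ℝ 2 fun h => v (proj P h) := hv
    exact hu.add hv
  smul_mem' c u hu := by
    have hu : ContDiff ℝ 2 fun h => u (proj P h) := hu
    exact contDiff_const.smul hu

lemma mem_C2 {u : Torus P → ℂ} : u ∈ C2 P ↔ ContDiff ℝ 2 fun h => u (proj P h) := Iff.rfl

/-- The Laplacian on `T`. -/
def laplacianT (u : Torus P → ℂ) : Torus P → ℂ :=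
  descend P (Laplacian.laplacian fun h => u (proj P h))

lemma laplacianT_proj (u : Torus P → ℂ) (h : V) :
    laplacianT P u (proj P h) = Laplacian.laplacian (fun h => u (proj P h)) h := by
  refine descend_proj P (fun l hl x => ?_) h
  have hper : (fun h => u (proj P (h + l))) = fun h => u (proj P h) := by
    funext y
    congr 1
    rw [proj_eq_iff]
    simpa using hl
  rw [laplacian_eq_iteratedFDeriv_stdOrthonormalBasis]
  dsimp only
  rw [← iteratedFDeriv_comp_add_right (f := fun h => u (proj P h)) 2 l x, hper]

/-- The expression `-Δu + Vu`, where `V` is the potential. -/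
def hamiltonianFun [P.IsCrystallographic] (b : P.Base) (k : ι → ℝ) (u : Torus P → ℂ)
    (t : Torus P) : ℂ :=
  -laplacianT P u t + potential P b k t * u t

/-- The functions that lie in the domain of each of the multiplication operators on `L²(T, dμ)`
by the functions `|α|² (1 / (4 sin² (⟨α, h⟩ / 2)) - 1 / 12)`, `α > 0`. -/
def termsDomain [P.IsRootSystem] [P.IsCrystallographic] (b : P.Base) :
    Submodule ℂ (Torus P → ℂ) where
  carrier := {u | MemLp u 2 (haarT P) ∧
    ∀ i, b.IsPos i → MemLp (fun t => (potentialTerm P i t : ℂ) * u t) 2 (haarT P)}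
  zero_mem' := ⟨MemLp.zero, fun _ _ => by simp⟩
  add_mem' hu hv := ⟨hu.1.add hv.1, fun i hi => by
    simpa only [Pi.add_apply, mul_add] using! (hu.2 i hi).add (hv.2 i hi)⟩
  smul_mem' c u hu := ⟨hu.1.const_smul c, fun i hi => by
    simpa only [Pi.smul_apply, smul_eq_mul, mul_left_comm] using! (hu.2 i hi).const_smul c⟩

/-- The functions that lie in the domain of the multiplication operator on `L²(T, dμ)`
by the potential. -/
def potentialDomain [P.IsRootSystem] [P.IsCrystallographic] (b : P.Base) (k : ι → ℝ) :
    Submodule ℂ (Torus P → ℂ) where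
  carrier := {u | MemLp u 2 (haarT P) ∧
    MemLp (fun t => (potential P b k t : ℂ) * u t) 2 (haarT P)}
  zero_mem' := ⟨MemLp.zero, by simp⟩
  add_mem' hu hv := ⟨hu.1.add hv.1, by
    simpa only [Pi.add_apply, mul_add] using! hu.2.add hv.2⟩
  smul_mem' c u hu := ⟨hu.1.const_smul c, by
    simpa only [Pi.smul_apply, smul_eq_mul, mul_left_comm] using! hu.2.const_smul c⟩

/-- The graph of the Hamiltonian on `C²(T)^W ∩ D`. -/
def hamiltonianGraph [P.IsRootSystem] [P.IsCrystallographic] (b : P.Base) (k : ι → ℝ)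
    (D : Submodule ℂ (Torus P → ℂ)) : Submodule ℂ (L2W P × L2W P) where
  carrier := {x | ∃ u ∈ C2 P ⊓ invariants P ⊓ D,
    (x.1 : Lp ℂ 2 (haarT P)) =ᵐ[haarT P] u ∧
    (x.2 : Lp ℂ 2 (haarT P)) =ᵐ[haarT P] hamiltonianFun P b k u}
  zero_mem' := by
    refine ⟨0, zero_mem _, Lp.coeFn_zero _ _ _, (Lp.coeFn_zero _ _ _).trans ?_⟩
    refine .of_eq (funext fun t => ?_)
    obtain ⟨h, rfl⟩ := proj_surjective P t
    simp [hamiltonianFun, laplacianT_proj]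
  add_mem' := by
    rintro x y ⟨u, hu, hu1, hu2⟩ ⟨v, hv, hv1, hv2⟩
    refine ⟨u + v, add_mem hu hv, ?_, ?_⟩
    · exact (Lp.coeFn_add _ _).trans (hu1.add hv1)
    · refine (Lp.coeFn_add _ _).trans ((hu2.add hv2).trans (.of_eq (funext fun t => ?_)))
      obtain ⟨h, rfl⟩ := proj_surjective P t
      have := ContDiffAt.laplacian_add (x := h) ((mem_C2 P).1 hu.1.1).contDiffAt
        ((mem_C2 P).1 hv.1.1).contDiffAt
      have h2 : laplacianT P (u + v) (proj P h) = _ := (laplacianT_proj P _ _).trans this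
      simp only [hamiltonianFun, Pi.add_apply, h2, laplacianT_proj]
      ring
  smul_mem' := by
    rintro c x ⟨u, hu, hu1, hu2⟩
    refine ⟨c • u, Submodule.smul_mem _ c hu, ?_, ?_⟩
    · exact (Lp.coeFn_smul _ _).trans (hu1.const_smul c)
    · refine (Lp.coeFn_smul _ _).trans ((hu2.const_smul c).trans (.of_eq (funext fun t => ?_)))
      obtain ⟨h, rfl⟩ := proj_surjective P t
      have := laplacian_smul (x := h) c ((mem_C2 P).1 hu.1.1).contDiffAt
      have h2 : laplacianT P (c • u) (proj P h) = _ := (laplacianT_proj P _ _).trans this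
      simp only [hamiltonianFun, Pi.smul_apply, h2, laplacianT_proj, smul_eq_mul]
      ring

lemma hamiltonianGraph_snd [P.IsRootSystem] [P.IsCrystallographic] (b : P.Base) (k : ι → ℝ)
    (D : Submodule ℂ (Torus P → ℂ)) (x : L2W P × L2W P) (hx : x ∈ hamiltonianGraph P b k D)
    (hx1 : x.1 = 0) : x.2 = 0 := by
  obtain ⟨u, hu, hu1, hu2⟩ := hx
  have hcont : Continuous u :=
    (isQuotientMap_quotient_mk' (s := QuotientAddGroup.leftRel (torusLattice P))).continuous_iff.2
      ((mem_C2 P).1 hu.1.1).continuous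
  have h0 : u = 0 := by
    refine (Continuous.ae_eq_iff_eq (haarT P) hcont continuous_const).1 (hu1.symm.trans ?_)
    rw [hx1]
    exact Lp.coeFn_zero _ _ _
  have h1 : hamiltonianFun P b k u = 0 := by
    funext t
    obtain ⟨h, rfl⟩ := proj_surjective P t
    simp [hamiltonianFun, laplacianT_proj, h0]
  rw [h1] at hu2
  exact Subtype.ext (Lp.ext (hu2.trans (Lp.coeFn_zero _ _ _).symm))

/-- The Hamiltonian, as an unbounded operator on `L²(T, dμ)^W` with domain `C²(T)^W ∩ D`. -/
def hamiltonian [P.IsRootSystem] [P.IsCrystallographic] (b : P.Base) (k : ι → ℝ)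
    (D : Submodule ℂ (Torus P → ℂ)) : L2W P →ₗ.[ℂ] L2W P :=
  (hamiltonianGraph P b k D).toLinearPMap

lemma hamiltonian_graph [P.IsRootSystem] [P.IsCrystallographic] (b : P.Base) (k : ι → ℝ)
    (D : Submodule ℂ (Torus P → ℂ)) :
    (hamiltonian P b k D).graph = hamiltonianGraph P b k D :=
  Submodule.toLinearPMap_graph_eq _ (hamiltonianGraph_snd P b k D)

/-- The subspace `ℂ[P]^W Δ` of `L²(T, dμ)^W`. -/
def jacobiDomain [P.IsRootSystem] [P.IsCrystallographic] (b : P.Base) (k : ι → ℝ) :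
    Submodule ℂ (L2W P) where
  carrier := {f | ∃ p ∈ expPolyW P,
    (f : Lp ℂ 2 (haarT P)) =ᵐ[haarT P] fun t => p t * groundState P b k t}
  zero_mem' := ⟨0, zero_mem _, (Lp.coeFn_zero _ _ _).trans (.of_eq (by funext; simp))⟩
  add_mem' := by
    rintro f g ⟨p, hp, hp'⟩ ⟨q, hq, hq'⟩
    refine ⟨p + q, add_mem hp hq, (Lp.coeFn_add _ _).trans ((hp'.add hq').trans
      (.of_eq (funext fun t => ?_)))⟩
    simp [add_mul]
  smul_mem' := by
    rintro c f ⟨p, hp, hp'⟩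
    refine ⟨c • p, Submodule.smul_mem _ c hp, (Lp.coeFn_smul _ _).trans ((hp'.const_smul c).trans
      (.of_eq (funext fun t => ?_)))⟩
    simp [mul_assoc]

/-- Essential self-adjointness of an unbounded operator: it is densely defined and closable, and
its closure is self-adjoint. -/
def IsEssentiallySelfAdjoint {H : Type*} [NormedAddCommGroup H] [InnerProductSpace ℂ H]
    [CompleteSpace H] (A : H →ₗ.[ℂ] H) : Prop :=
  Dense (A.domain : Set H) ∧ A.IsClosable ∧ IsSelfAdjoint A.closure

end

end TrigCMS

namespace TrigCMS

noncomputable section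

set_option linter.unusedSectionVars false

variable {ι M V : Type*} [Fintype ι] [AddCommGroup M] [Module ℝ M]
  [NormedAddCommGroup V] [InnerProductSpace ℝ V] [FiniteDimensional ℝ V]
  (P : RootPairing ι ℝ M V)

/-! ### Root data -/

/-! Write H for the Hamiltonian, Δ for `groundState` and c for `jacobiShift`. Conjugation by Δ turns
H into the Jacobi operator L p = -∇²p - Σ k_α cot(α/2) ∂_α p - c p (`jacobiOp`), where ∂_α is the
derivative along the vector dual to α. The theorem follows from H*(pΔ) = (Lp)Δ for p in ℂ[P]^W, the
symmetry of L for the weight Δ², and the fact that L preserves finite-dimensional spaces exhausting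
ℂ[P]^W.

Two algebraic facts carry this. First, ∇²Δ = (V + c)Δ off the walls. This requires the sum of k_α
k_β ⟨α,β⟩ cot(α/2) cot(β/2) over pairs of distinct positive roots to be constant
(`sum_cotHalf_mul_cotHalf`): on a wall the residues cancel because the reflection in it changes the
sign of the Gram coefficients and keeps the cotangents. Second, cot(α/2) ∂_α maps e^λ + e^{sλ} to a
combination of exponentials on the α-string from λ to sλ, and these are no longer than λ. So L
preserves the invariant exponential polynomials with |λ| ≤ R (`exists_jacobiOp_eq`), a
finite-dimensional space.

The analytic difficulty is that Δ need not be C². It is replaced by the smooth Δ_ε = ∏ (sin²(α/2) +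
ε)^{k_α/2} (`regState`), for which Green's identity on the torus has no boundary terms, and ε tends
to 0 by dominated convergence. For H*(pΔ) = (Lp)Δ (`integral_hamiltonianFun_mul`) the majorant comes
from the domain: square integrability of a singular potential times u forces u = 0 on the wall
(`eq_zero_on_wall_of_integrable`), invariance then kills the normal derivative, and a double zero of
u absorbs the double pole of ∇²(pΔ_ε)/Δ_ε. For the symmetry of L (`integral_jacobiOp_symm`) no
vanishing is available; instead p p' Δ_ε ∇²Δ_ε, which is symmetric in p and p', is subtracted, and
what remains involves only cot(α/2) ∂_α p, bounded for invariant p.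

A symmetric operator A whose dense domain is a union of finite-dimensional invariant subspaces is
essentially self-adjoint, since A ± i is bijective on each of them
(`isEssentiallySelfAdjoint_of_invariant_finiteDimensional`). Density of ℂ[P]^W Δ comes from
Stone–Weierstrass, averaging over W, and Δ ≠ 0 almost everywhere; the same statement with every
exponent equal to 2 makes H densely defined. -/

/-- The vector of `V` that represents a linear form under the inner product. -/
def dualVec (l : M) : V :=
  (InnerProductSpace.toDual ℝ V).symm (LinearMap.toContinuousLinearMap (P.toLinearMap l))

lemma inner_dualVec (l : M) (x : V) : inner ℝ (dualVec P l) x = P.toLinearMap l x := by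
  simp [dualVec]

lemma dualVec_add (l m : M) : dualVec P (l + m) = dualVec P l + dualVec P m := by
  simp [dualVec]

lemma dualVec_smul (c : ℝ) (l : M) : dualVec P (c • l) = c • dualVec P l := by
  simp [dualVec]

/-- The Gram matrix of the roots. -/
def gram (i j : ι) : ℝ := inner ℝ (dualVec P (P.root i)) (dualVec P (P.root j))

lemma gram_comm (i j : ι) : gram P i j = gram P j i := real_inner_comm _ _

lemma rootNormSq_eq_gram (i : ι) : rootNormSq P i = gram P i i := by
  rw [rootNormSq, gram, real_inner_self_eq_norm_sq, dualVec, LinearIsometryEquiv.norm_map]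

lemma toLinearMap_reflection (i : ι) (l : M) (x : V) :
    P.toLinearMap (P.reflection i l) x = P.toLinearMap l (P.coreflection i x) := by
  simp only [P.reflection_apply, P.coreflection_apply, map_sub, LinearMap.sub_apply, map_smul,
    LinearMap.smul_apply, LinearMap.flip_apply, smul_eq_mul]
  ring

lemma root'_reflectionPerm (i j : ι) (x : V) :
    P.root' (P.reflectionPerm i j) x = P.root' j (P.coreflection i x) := by
  rw [RootPairing.root', P.root_reflectionPerm, toLinearMap_reflection]

lemma root'_neg (i : ι) (x : V) : P.root' (P.reflectionPerm i i) x = -P.root' i x := by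
  rw [RootPairing.root', P.root_reflectionPerm, P.reflection_apply_self]
  simp

lemma dualVec_neg_root (i : ι) :
    dualVec P (P.root (P.reflectionPerm i i)) = -dualVec P (P.root i) := by
  rw [P.root_reflectionPerm, P.reflection_apply_self, ← neg_one_smul ℝ, dualVec_smul, neg_one_smul]

lemma gram_neg_right (i j : ι) : gram P i (P.reflectionPerm j j) = -gram P i j := by
  simp only [gram, dualVec_neg_root, inner_neg_right]

/-! ### Consequences of the invariance of the inner product. -/

section Invariant

variable {P} (hinv : ∀ i x y, inner ℝ (P.coreflection i x) (P.coreflection i y) = inner ℝ x y)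
include hinv

lemma inner_coreflection_left (i : ι) (x y : V) :
    inner ℝ (P.coreflection i x) y = inner ℝ x (P.coreflection i y) := by
  conv_lhs => rw [← P.coreflection_same i y]
  exact hinv i _ _

lemma dualVec_reflection (i : ι) (l : M) :
    dualVec P (P.reflection i l) = P.coreflection i (dualVec P l) := by
  refine ext_inner_right ℝ fun x => ?_
  rw [inner_dualVec, inner_coreflection_left hinv, inner_dualVec, toLinearMap_reflection]

lemma norm_dualVec_reflection (i : ι) (l : M) :
    ‖dualVec P (P.reflection i l)‖ = ‖dualVec P l‖ := by
  rw [dualVec_reflection hinv, @norm_eq_sqrt_real_inner V, hinv, ← norm_eq_sqrt_real_inner]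

lemma gram_reflection (i j l : ι) :
    gram P (P.reflectionPerm i j) (P.reflectionPerm i l) = gram P j l := by
  simp only [gram, P.root_reflectionPerm, dualVec_reflection hinv, hinv]

/-- The reflection s_i preserves Gram entries and sends α_i to its negative. This sign is what makes
the residues of the cotangent sum cancel. -/
lemma gram_reflection_right (i j : ι) : gram P i (P.reflectionPerm i j) = -gram P i j := by
  have h := gram_reflection hinv i (P.reflectionPerm i i) j
  rw [P.reflectionPerm_self] at h
  rw [h, gram_comm, gram_neg_right, gram_comm]

lemma toLinearMap_reflection_dualVec (i : ι) (l : M) :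
    P.toLinearMap (P.reflection i l) (dualVec P (P.root i)) =
      -P.toLinearMap l (dualVec P (P.root i)) := by
  rw [toLinearMap_reflection, ← dualVec_reflection hinv, P.reflection_apply_self,
    ← neg_one_smul ℝ, dualVec_smul]
  simp

end Invariant

/-! ### Positive roots, heights and non-proportionality. -/

section Positive

open scoped Classical

variable {P} [P.IsCrystallographic] (b : P.Base)

lemma isPos_neg_iff (i : ι) : b.IsPos (P.reflectionPerm i i) ↔ ¬ b.IsPos i := by
  have := RootPairing.Base.IsPos.neg_iff_not (b := b) i
  exact this

/-- Negation exchanges positive and negative roots, so an even function contributes the same product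
over both halves. -/
lemma prod_eq_sq_prod_pos {R : Type*} [CommMonoid R] {f : ι → R}
    (hf : ∀ i, f (P.reflectionPerm i i) = f i) :
    ∏ i, f i = (∏ i with b.IsPos i, f i) * ∏ i with b.IsPos i, f i := by
  have hneg : ∀ i, P.reflectionPerm (P.reflectionPerm i i) (P.reflectionPerm i i) = i :=
    P.indexNeg.neg_neg
  rw [← Finset.prod_filter_mul_prod_filter_not Finset.univ b.IsPos]
  congr 1
  refine Finset.prod_nbij' (fun i => P.reflectionPerm i i) (fun i => P.reflectionPerm i i)
    ?_ ?_ ?_ ?_ ?_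
  · intro i hi
    simpa [isPos_neg_iff] using hi
  · intro i hi
    simpa [isPos_neg_iff] using hi
  · exact fun i _ => hneg i
  · exact fun i _ => hneg i
  · exact fun i _ => (hf i).symm

lemma sum_eq_two_mul_sum_pos {f : ι → ℝ} (hf : ∀ i, f (P.reflectionPerm i i) = f i) :
    ∑ i, f i = 2 * ∑ i with b.IsPos i, f i := by
  -- The sum is the product in `Multiplicative ℝ`.
  have h := prod_eq_sq_prod_pos b (f := fun i => Multiplicative.ofAdd (f i))
    fun i => by simp [hf i]
  rw [two_mul]
  exact h

lemma ne_neg_of_isPos {i j : ι} (hi : b.IsPos i) (hj : b.IsPos j) :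
    P.root i ≠ -P.root j := by
  intro h
  rw [P.root_eq_neg_iff] at h
  exact (isPos_neg_iff b j).1 (h ▸ hi) hj

/-- The form equal to 1 on every simple root is given by a vector, because the pairing is perfect.
Along this vector every root has integral slope, so all e^{iα} become monomials in one variable. -/
lemma exists_height_vector [P.IsRootSystem] :
    ∃ v : V, ∀ i, P.root' i v = b.height i := by
  let φ : Module.Dual ℝ M := b.toWeightBasis.constr ℝ fun _ => (1 : ℝ)
  obtain ⟨v, hv⟩ := P.toLinearMap.flip.toPerfPair.surjective φ
  have hv' : ∀ l, P.toLinearMap l v = φ l := fun l => by rw [← hv]; rfl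
  refine ⟨v, fun i => ?_⟩
  obtain ⟨f, -, -, hf⟩ := b.exists_root_eq_sum_int i
  rw [RootPairing.Base.height_eq_sum hf, hv', hf, map_sum]
  push_cast
  refine Finset.sum_congr rfl fun j hj => ?_
  have : φ (P.root j) = 1 := by
    rw [← b.toWeightBasis_apply ⟨j, hj⟩, Module.Basis.constr_basis]
  rw [map_zsmul, this]
  simp

/-- Nonzero linear combinations of two non-proportional roots do not vanish identically. -/
lemma exists_combination_ne_zero [P.IsRootSystem] [P.IsReduced] {i j : ι} (hij : i ≠ j)
    (h' : P.root i ≠ -P.root j) {s t : ℝ} (hs : s ≠ 0) :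
    ∃ x : V, (s • P.root' i + t • P.root' j) x ≠ 0 := by
  by_contra! h
  have h0 : s • P.root i + t • P.root j = 0 := by
    apply P.toLinearMap.toPerfPair.injective
    ext x
    simpa using! h x
  exact hs ((LinearIndependent.pair_iff.1 (RootPairing.IsReduced.linearIndependent P hij h') _ _
    h0).1)

end Positive

/-! ### The cotangent identity -/

/-- Euler's formula for i cot(y/2) = -(e^{iy} + 1)/(e^{iy} - 1), kept free of division by e^{iy} - 1
so that it can be inserted into products of polynomials. -/
lemma exp_add_one_eq {y : ℝ} (hy : Real.sin (y / 2) ≠ 0) :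
    Complex.exp (y * Complex.I) + 1 = (Complex.exp (y * Complex.I) - 1) *
      (-Complex.I * (Real.cos (y / 2) / Real.sin (y / 2) : ℝ)) := by
  have h1 : Complex.exp (y * Complex.I) = Complex.exp ((y / 2 : ℝ) * Complex.I) ^ 2 := by
    rw [← Complex.exp_nat_mul]
    congr 1
    push_cast
    ring
  have hs : (Complex.sin (y / 2 : ℝ)) ≠ 0 := by exact_mod_cast hy
  have hcs : Complex.sin (y / 2 : ℝ) ^ 2 + Complex.cos (y / 2 : ℝ) ^ 2 = 1 :=
    Complex.sin_sq_add_cos_sq _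
  rw [h1, Complex.exp_mul_I]
  push_cast at hs hcs ⊢
  field_simp
  set s := Complex.sin (y / 2)
  set c := Complex.cos (y / 2)
  linear_combination (2 * s * c ^ 2 + s ^ 2 * c * Complex.I + s ^ 3) * Complex.I_sq
    + (Complex.I * c - s) * hcs

lemma exp_eq_one_iff_sin_half {y : ℝ} :
    Complex.exp (y * Complex.I) = 1 ↔ Real.sin (y / 2) = 0 := by
  rw [Complex.exp_eq_one_iff, Real.sin_eq_zero_iff]
  refine exists_congr fun n => ⟨fun h => ?_, fun h => ?_⟩
  · have h' : (y : ℂ) = n * (2 * Real.pi) :=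
      mul_right_cancel₀ Complex.I_ne_zero (h.trans (by ring))
    have : y = n * (2 * Real.pi) := by exact_mod_cast h'
    rw [this]; ring
  · have : y = n * (2 * Real.pi) := by linarith
    rw [this]; push_cast; ring

lemma prod_ite_pair {κ : Type*} [Fintype κ] [DecidableEq κ] {i j : κ} (hij : i ≠ j) (f : κ → ℂ) :
    ∏ l, (if l = i ∨ l = j then f l else 1) = f i * f j := by
  rw [Finset.prod_ite, Finset.prod_const_one, mul_one]
  have : Finset.univ.filter (fun l => l = i ∨ l = j) = {i, j} := by ext; simp
  rw [this, Finset.prod_pair hij]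

/-- If the residues of `∑ cᵢⱼ cot ((xᵢ + nᵢ θ) / 2) cot ((xⱼ + nⱼ θ) / 2)` as a function of `θ`
vanish, then this function is constant. -/
lemma sum_cot_mul_cot_eq_of_generic {κ : Type*} [Fintype κ] [DecidableEq κ] (n : κ → ℕ)
    (hn : ∀ i, 0 < n i) (x : κ → ℝ) (c : κ → κ → ℝ) (hc : ∀ i, c i i = 0)
    (hsymm : ∀ i j, c i j = c j i)
    (hgen : ∀ i j, i ≠ j → ∀ m : ℤ, n j * x i - n i * x j ≠ m * (2 * Real.pi))
    (hres : ∀ i θ, Real.sin ((x i + n i * θ) / 2) = 0 →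
      ∑ j, c i j * (Real.cos ((x j + n j * θ) / 2) / Real.sin ((x j + n j * θ) / 2)) = 0)
    (hx : ∀ i, Real.sin (x i / 2) ≠ 0) :
    ∑ i, ∑ j, c i j * ((Real.cos (x i / 2) / Real.sin (x i / 2)) *
      (Real.cos (x j / 2) / Real.sin (x j / 2))) = -∑ i, ∑ j, c i j := by
  -- With z = e^{iθ}, `E l` is e^{i(x_l + n_l θ)} and (E_l + 1)/(E_l - 1) is -i cot. Hence N/D is
  -- minus the sum in question, with D the common denominator. The claim becomes N = aD for a
  -- constant a.
  let E : κ → Polynomial ℂ := fun l =>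
    Polynomial.C (Complex.exp (x l * Complex.I)) * Polynomial.X ^ n l
  let N : Polynomial ℂ := ∑ i, ∑ j, Polynomial.C (c i j : ℂ) *
    ∏ l, (E l + Polynomial.C (if l = i ∨ l = j then 1 else -1))
  let D : Polynomial ℂ := ∏ l, (E l + Polynomial.C (-1))
  have hfac : ∀ l (s : ℂ), (E l + Polynomial.C s).natDegree ≤ n l := fun l s => by
    refine (Polynomial.natDegree_add_C).le.trans ?_
    exact Polynomial.natDegree_C_mul_X_pow_le _ _
  have hprod : ∀ s : κ → ℂ, (∏ l, (E l + Polynomial.C (s l))).natDegree ≤ ∑ l, n l := fun s =>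
    (Polynomial.natDegree_prod_le _ _).trans (Finset.sum_le_sum fun l _ => hfac l _)
  have hN : N.natDegree ≤ ∑ l, n l :=
    Polynomial.natDegree_sum_le_of_forall_le _ _ fun i _ =>
      Polynomial.natDegree_sum_le_of_forall_le _ _ fun j _ =>
        (Polynomial.natDegree_C_mul_le _ _).trans (hprod _)
  have hE : ∀ l (θ : ℝ), (E l).eval (Complex.exp (θ * Complex.I)) =
      Complex.exp ((x l + n l * θ : ℝ) * Complex.I) := fun l θ => by
    simp only [E, Polynomial.eval_mul, Polynomial.eval_C, Polynomial.eval_pow, Polynomial.eval_X]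
    rw [← Complex.exp_nat_mul, ← Complex.exp_add]
    congr 1
    push_cast
    ring
  have hNe : ∀ z, N.eval z = ∑ i, ∑ j, (c i j : ℂ) *
      ∏ l, ((E l).eval z + (if l = i ∨ l = j then 1 else -1)) := fun z => by
    simp only [N, Polynomial.eval_finsetSum, Polynomial.eval_mul, Polynomial.eval_C,
      Polynomial.eval_prod, Polynomial.eval_add]
  have hDe : ∀ z, D.eval z = ∏ l, ((E l).eval z + -1) := fun z => by
    simp only [D, Polynomial.eval_C, Polynomial.eval_prod, Polynomial.eval_add]
  -- the relation between two factors at a point of the unit circle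
  have hgen' : ∀ i j, i ≠ j → ∀ θ : ℝ, Real.sin ((x i + n i * θ) / 2) = 0 →
      Real.sin ((x j + n j * θ) / 2) ≠ 0 := by
    intro i j hij θ h1 h2
    obtain ⟨a, ha⟩ := Real.sin_eq_zero_iff.1 h1
    obtain ⟨d, hd⟩ := Real.sin_eq_zero_iff.1 h2
    refine hgen i j hij (n j * a - n i * d) ?_
    push_cast
    linear_combination (-2 * (n j : ℝ)) * ha + (2 * (n i : ℝ)) * hd
  -- The constant is read off at z = 0, where every E_l vanishes and each pair of factors (E_l +
  -- 1)/(E_l - 1) equals (-1)(-1) = 1.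
  let a : ℂ := ∑ i, ∑ j, (c i j : ℂ)
  have hzero : N.eval 0 = a * D.eval 0 := by
    have hE0 : ∀ l, (E l).eval 0 = 0 := fun l => by
      simp [E, (hn l).ne']
    rw [hNe, hDe]
    simp only [hE0, a, Finset.sum_mul, zero_add]
    refine Finset.sum_congr rfl fun i _ => Finset.sum_congr rfl fun j _ => ?_
    by_cases hij : i = j
    · subst hij; simp [hc]
    · have : ∀ l, (if l = i ∨ l = j then (1 : ℂ) else -1) =
          -1 * (if l = i ∨ l = j then (-1 : ℂ) else 1) := fun l => by split_ifs <;> simp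
      simp_rw [this, Finset.prod_mul_distrib, prod_ite_pair hij (fun _ => (-1 : ℂ))]
      simp
  -- At a zero of E_i - 1 the polynomial D vanishes, and only the terms of N with index i survive.
  -- They add up to a multiple of the residue, which is 0 by `hres`.
  have hcirc : ∀ i (θ : ℝ), Real.sin ((x i + n i * θ) / 2) = 0 →
      N.eval (Complex.exp (θ * Complex.I)) = a * D.eval (Complex.exp (θ * Complex.I)) := by
    intro i θ hi
    have hE1 : (E i).eval (Complex.exp (θ * Complex.I)) = 1 := by
      rw [hE, exp_eq_one_iff_sin_half]; exact hi
    have hD0 : D.eval (Complex.exp (θ * Complex.I)) = 0 := by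
      rw [hDe]
      exact Finset.prod_eq_zero (Finset.mem_univ i) (by rw [hE1]; ring)
    let q : κ → ℂ := fun j =>
      -Complex.I * (Real.cos ((x j + n j * θ) / 2) / Real.sin ((x j + n j * θ) / 2) : ℝ)
    -- The factor 2 is the value of E_i + 1 at E_i = 1.
    let K : ℂ := ∏ l, (if l = i then 2 else (E l).eval (Complex.exp (θ * Complex.I)) - 1)
    have hone : ∀ j, i ≠ j → ∏ l, ((E l).eval (Complex.exp (θ * Complex.I)) +
        (if l = i ∨ l = j then 1 else -1)) = K * q j := by
      intro j hij
      have : ∀ l, (E l).eval (Complex.exp (θ * Complex.I)) + (if l = i ∨ l = j then 1 else -1) =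
          (if l = i then 2 else (E l).eval (Complex.exp (θ * Complex.I)) - 1) *
          (if l = i ∨ l = j then (if l = i then 1 else q l) else 1) := by
        intro l
        by_cases hl : l = i
        · subst hl; simp [hE1]; norm_num
        · by_cases hl' : l = j
          · subst hl'
            have := exp_add_one_eq (hgen' i l hij θ hi)
            simp only [hE, hl, or_true, if_true, if_false]
            exact this
          · simp [hl, hl', sub_eq_add_neg]
      simp_rw [this, Finset.prod_mul_distrib]
      rw [prod_ite_pair hij fun l => if l = i then 1 else q l]
      simp [hij.symm, K]
    have hterm : ∀ j l, (c j l : ℂ) * ∏ m, ((E m).eval (Complex.exp (θ * Complex.I)) +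
        (if m = j ∨ m = l then 1 else -1)) =
        (if j = i then c i l * (K * q l) else 0) + (if l = i then c i j * (K * q j) else 0) := by
      intro j l
      by_cases hj : j = i
      · subst hj
        by_cases hl : l = j
        · subst hl; simp [hc]
        · simp [hl, hone l (Ne.symm hl)]
      · by_cases hl : l = i
        · subst hl
          have := hone j (Ne.symm hj)
          simp only [hj, if_true, if_false, zero_add]
          rw [← this, hsymm]
          simp_rw [or_comm]
        · simp only [hj, hl, if_false, add_zero]
          rw [Finset.prod_eq_zero (Finset.mem_univ i), mul_zero]
          simp [hE1, Ne.symm hj, Ne.symm hl]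
    have hsum : ∑ j, (c i j : ℂ) * (K * q j) = 0 := by
      have := hres i θ hi
      have h2 : ∑ j, (c i j : ℂ) * (K * q j) = K * -Complex.I * ((∑ j, c i j *
          (Real.cos ((x j + n j * θ) / 2) / Real.sin ((x j + n j * θ) / 2)) : ℝ) : ℂ) := by
        rw [Complex.ofReal_sum, Finset.mul_sum]
        refine Finset.sum_congr rfl fun j _ => ?_
        simp only [q]
        push_cast
        ring
      rw [h2, this]; simp
    rw [hNe, hD0, mul_zero]
    simp_rw [hterm, Finset.sum_add_distrib]
    simp [Finset.sum_ite_eq', hsum]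
  -- the explicit zeros
  let θ : (Σ l, Fin (n l)) → ℝ := fun p => (2 * Real.pi * p.2 - x p.1) / n p.1
  have hn0 : ∀ l, (n l : ℝ) ≠ 0 := fun l => by exact_mod_cast (hn l).ne'
  have hθ : ∀ p, x p.1 + n p.1 * θ p = 2 * Real.pi * p.2 := fun p => by
    simp only [θ]
    field_simp [hn0 p.1]
    ring
  have hθ0 : ∀ p, Real.sin ((x p.1 + n p.1 * θ p) / 2) = 0 := fun p => by
    rw [hθ, Real.sin_eq_zero_iff]
    exact ⟨p.2, by push_cast; ring⟩
  -- The n_l solutions of E_l = 1 for each l, together with z = 0, are Σ n_l + 1 points, one more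
  -- than the degree bound for N - aD. Genericity separates solutions for different l; residues mod
  -- n_l separate those for the same l.
  let f : Option (Σ l, Fin (n l)) → ℂ := fun o => o.elim 0 fun p => Complex.exp (θ p * Complex.I)
  have hf : Function.Injective f := by
    have hnz : ∀ p, f (some p) ≠ 0 := fun p => Complex.exp_ne_zero _
    have hsome : ∀ p q, f (some p) = f (some q) → p = q := by
      intro p q hpq
      obtain ⟨m, hm⟩ := Complex.exp_eq_exp_iff_exists_int.1 hpq
      have hm' : (θ p : ℂ) = θ q + m * (2 * Real.pi) :=
        mul_right_cancel₀ Complex.I_ne_zero (hm.trans (by ring))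
      have hm'' : θ p = θ q + m * (2 * Real.pi) := by exact_mod_cast hm'
      have hl : p.1 = q.1 := by
        by_contra hne
        refine hgen' p.1 q.1 hne (θ p) (hθ0 p) ?_
        rw [Real.sin_eq_zero_iff]
        refine ⟨q.2 + n q.1 * m, ?_⟩
        have := hθ q
        push_cast
        rw [hm'']
        linarith
      obtain ⟨l, r⟩ := p
      obtain ⟨l', r'⟩ := q
      obtain rfl : l = l' := hl
      have h1 := hθ ⟨l, r⟩
      have h2 := hθ ⟨l, r'⟩
      simp only at h1 h2
      have h3 : (r : ℝ) = r' + n l * m := by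
        have : 2 * Real.pi * (r : ℝ) = 2 * Real.pi * (r' + n l * m) := by
          rw [← h1, hm'']
          linear_combination h2
        exact mul_left_cancel₀ (by positivity) this
      have h4 : (r : ℤ) = r' + n l * m := by exact_mod_cast h3
      have hr := r.2
      have hr' := r'.2
      have h5 : (r : ℤ) % n l = r' % n l := by rw [h4]; simp
      rw [Int.emod_eq_of_lt (by positivity) (by exact_mod_cast hr),
        Int.emod_eq_of_lt (by positivity) (by exact_mod_cast hr')] at h5
      have : r = r' := Fin.ext (by exact_mod_cast h5)
      rw [this]
    rintro (_ | p) (_ | q) h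
    · rfl
    · exact absurd h.symm (hnz q)
    · exact absurd h (hnz p)
    · rw [hsome p q h]
  have hpoly : N - Polynomial.C a * D = 0 := by
    refine Polynomial.eq_zero_of_natDegree_lt_card_of_eval_eq_zero _ hf ?_ ?_
    · rintro (_ | p)
      · simp only [f, Option.elim_none, Polynomial.eval_sub, Polynomial.eval_mul,
          Polynomial.eval_C, hzero, sub_self]
      · simp only [f, Option.elim_some, Polynomial.eval_sub, Polynomial.eval_mul,
          Polynomial.eval_C, hcirc p.1 (θ p) (hθ0 p), sub_self]
    · rw [Fintype.card_option, Fintype.card_sigma]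
      simp only [Fintype.card_fin]
      refine Nat.lt_succ_of_le ((Polynomial.natDegree_sub_le _ _).trans (max_le hN ?_))
      exact (Polynomial.natDegree_C_mul_le _ _).trans (hprod _)
  -- evaluation at `1`
  have hfin : N.eval 1 = a * D.eval 1 := by
    rw [sub_eq_zero.1 hpoly]; simp
  have hE1 : ∀ l, (E l).eval 1 = Complex.exp (x l * Complex.I) := fun l => by simp [E]
  have hD1 : D.eval 1 ≠ 0 := by
    rw [hDe, Finset.prod_ne_zero_iff]
    intro l _ h
    rw [hE1, ← sub_eq_add_neg, sub_eq_zero, exp_eq_one_iff_sin_half] at h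
    exact hx l h
  have hN1 : N.eval 1 = D.eval 1 * -((∑ i, ∑ j, c i j *
      ((Real.cos (x i / 2) / Real.sin (x i / 2)) *
      (Real.cos (x j / 2) / Real.sin (x j / 2))) : ℝ) : ℂ) := by
    rw [hNe, hDe, Complex.ofReal_sum, ← Finset.sum_neg_distrib, Finset.mul_sum]
    refine Finset.sum_congr rfl fun i _ => ?_
    rw [Complex.ofReal_sum, ← Finset.sum_neg_distrib, Finset.mul_sum]
    refine Finset.sum_congr rfl fun j _ => ?_
    by_cases hij : i = j
    · subst hij; simp [hc]
    · let q : κ → ℂ := fun j =>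
        -Complex.I * (Real.cos (x j / 2) / Real.sin (x j / 2) : ℝ)
      have : ∀ l, (E l).eval 1 + (if l = i ∨ l = j then 1 else -1) =
          ((E l).eval 1 + -1) * (if l = i ∨ l = j then q l else 1) := by
        intro l
        by_cases hl : l = i ∨ l = j
        · have := exp_add_one_eq (hx l)
          simp only [hE1, hl, if_true]
          rw [← sub_eq_add_neg]
          exact this
        · simp [hl]
      simp_rw [this, Finset.prod_mul_distrib]
      rw [prod_ite_pair hij]
      simp only [q]
      push_cast
      linear_combination ((c i j : ℂ) * (∏ l, (Polynomial.eval 1 (E l) + -1)) *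
        (Complex.cos (x i / 2) / Complex.sin (x i / 2) *
          (Complex.cos (x j / 2) / Complex.sin (x j / 2)))) * Complex.I_sq
  rw [hN1, mul_comm a] at hfin
  have := mul_left_cancel₀ hD1 hfin
  have h2 : ((∑ i, ∑ j, c i j * ((Real.cos (x i / 2) / Real.sin (x i / 2)) *
      (Real.cos (x j / 2) / Real.sin (x j / 2))) : ℝ) : ℂ) = ((-∑ i, ∑ j, c i j : ℝ) : ℂ) := by
    rw [neg_eq_iff_eq_neg] at this
    rw [this]
    push_cast
    rfl
  exact_mod_cast h2

/-- The function `cot (⟨α, h⟩ / 2)`, with the value `0` at its poles. -/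
def cotHalf (i : ι) (h : V) : ℝ := Real.cos (P.root' i h / 2) / Real.sin (P.root' i h / 2)

lemma cotHalf_neg (i : ι) (h : V) : cotHalf P (P.reflectionPerm i i) h = -cotHalf P i h := by
  simp only [cotHalf, root'_neg, neg_div, Real.cos_neg, Real.sin_neg, div_neg]

lemma cotHalf_reflectionPerm (i j : ι) (h : V) :
    cotHalf P (P.reflectionPerm i j) h = cotHalf P j (P.coreflection i h) := by
  simp only [cotHalf, root'_reflectionPerm]

/-- If α_i(y) = 2πm, the reflection shifts α_j(y)/2 by an integral multiple of π. Sine and cosine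
change by the same sign, which cancels in the quotient. -/
lemma cotHalf_coreflection_of_sin_eq_zero [P.IsCrystallographic] {i : ι} {y : V}
    (hy : Real.sin (P.root' i y / 2) = 0) (j : ι) :
    cotHalf P j (P.coreflection i y) = cotHalf P j y := by
  obtain ⟨m, hm⟩ := Real.sin_eq_zero_iff.1 hy
  obtain ⟨n, hn⟩ := P.exists_value (S := ℤ) j i
  have : P.root' j (P.coreflection i y) / 2 = P.root' j y / 2 - (m * n : ℤ) * Real.pi := by
    rw [P.coreflection_apply, map_sub, map_smul, P.root'_coroot_eq_pairing, ← hn]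
    push_cast
    simp only [smul_eq_mul, algebraMap_int_eq, eq_intCast]
    linear_combination (n : ℝ) * hm
  rw [cotHalf, cotHalf, this, Real.sin_sub_int_mul_pi, Real.cos_sub_int_mul_pi,
    mul_div_mul_left]
  exact zpow_ne_zero _ (by norm_num)

section CotIdentity

open scoped Classical

variable {P} [P.IsCrystallographic] (b : P.Base)
  (hinv : ∀ i x y, inner ℝ (P.coreflection i x) (P.coreflection i y) = inner ℝ x y)
  {k : ι → ℝ} (hk : ∀ i j, k (P.reflectionPerm i j) = k j)
include hinv hk

/-- Substituting s_i j for j keeps k_j and, on the wall of α_i, the cotangents, but negates the Gram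
entry. So the sum over all roots equals its own negative, and the sum over the positive ones is half
of it. -/
lemma sum_gram_mul_cotHalf_eq_zero {i : ι} {y : V} (hy : Real.sin (P.root' i y / 2) = 0) :
    ∑ j with b.IsPos j, k j * gram P i j * cotHalf P j y = 0 := by
  have h1 : ∑ j, k j * gram P i j * cotHalf P j y = -∑ j, k j * gram P i j * cotHalf P j y := by
    conv_lhs => rw [← Equiv.sum_comp (P.reflectionPerm i)]
    rw [← Finset.sum_neg_distrib]
    refine Finset.sum_congr rfl fun j _ => ?_
    rw [hk, gram_reflection_right hinv, cotHalf_reflectionPerm,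
      cotHalf_coreflection_of_sin_eq_zero P hy]
    ring
  have h2 := sum_eq_two_mul_sum_pos b (f := fun j => k j * gram P i j * cotHalf P j y) fun j => by
    simp only [hk, gram_neg_right, cotHalf_neg]; ring
  linarith

/-- The sum of the cross terms `kᵢ kⱼ ⟨αᵢ, αⱼ⟩ cot (αᵢ / 2) cot (αⱼ / 2)` is constant. -/
lemma sum_cotHalf_mul_cotHalf [P.IsRootSystem] [P.IsReduced] {h : V}
    (hreg : ∀ i, Real.sin (P.root' i h / 2) ≠ 0) :
    ∑ i with b.IsPos i, ∑ j with b.IsPos j,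
      (if i = j then 0 else k i * k j * gram P i j) * (cotHalf P i h * cotHalf P j h) =
    -∑ i with b.IsPos i, ∑ j with b.IsPos j, (if i = j then 0 else k i * k j * gram P i j) := by
  obtain ⟨v, hv⟩ := exists_height_vector b
  let n : ι → ℕ := fun i => (b.height i).toNat
  have hn : ∀ i, b.IsPos i → 0 < n i := fun i hi => by
    rw [RootPairing.Base.isPos_iff] at hi
    simp only [n]; omega
  have hnv : ∀ i, b.IsPos i → P.root' i v = n i := fun i hi => by
    rw [hv]
    have : ((b.height i).toNat : ℤ) = b.height i := Int.toNat_of_nonneg hi.le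
    exact_mod_cast this.symm
  -- Along the height vector two factors can have a common zero only where n_j α_i - n_i α_j takes a
  -- value in 2πℤ. Distinct positive roots of a reduced system are not proportional, so these forms
  -- are nonzero and one direction `w` avoids all their kernels.
  let φ : {p : ι × ι // b.IsPos p.1 ∧ b.IsPos p.2 ∧ p.1 ≠ p.2} → Module.Dual ℝ V := fun p =>
    (n p.1.2 : ℝ) • P.root' p.1.1 + (-n p.1.1 : ℝ) • P.root' p.1.2
  obtain ⟨w, hw⟩ := Module.Dual.exists_forall_ne_zero_of_forall_exists φ fun p =>
    exists_combination_ne_zero p.2.2.2 (ne_neg_of_isPos b p.2.1 p.2.2.1)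
      (by exact_mod_cast (hn _ p.2.2.1).ne')
  -- the identity at generic points
  have hgen : ∀ x : V, (∀ i, Real.sin (P.root' i x / 2) ≠ 0) →
      (∀ p (m : ℤ), φ p x ≠ m * (2 * Real.pi)) →
      ∑ i with b.IsPos i, ∑ j with b.IsPos j,
        (if i = j then 0 else k i * k j * gram P i j) * (cotHalf P i x * cotHalf P j x) =
      -∑ i with b.IsPos i, ∑ j with b.IsPos j,
        (if i = j then 0 else k i * k j * gram P i j) := by
    intro x hx hφ
    have hmem : ∀ i, i ∈ Finset.univ.filter b.IsPos ↔ b.IsPos i := by simp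
    simp_rw [Finset.sum_subtype _ hmem]
    have key := sum_cot_mul_cot_eq_of_generic (κ := {i // b.IsPos i}) (fun i => n i)
      (fun i => hn i i.2) (fun i => P.root' i x)
      (fun i j => if (i : ι) = j then 0 else k i * k j * gram P i j) (by simp)
      (fun i j => by simp only [eq_comm, gram_comm P i j, mul_comm (k i)])
      (fun i j hij m => by
        have := hφ ⟨(i, j), i.2, j.2, fun h => hij (Subtype.ext h)⟩ m
        simpa [φ, ← sub_eq_add_neg] using this)
      (fun i θ hθ => ?_) (fun i => hx i)
    · exact key
    · have hy : ∀ j : {i // b.IsPos i}, P.root' j x + n j * θ = P.root' j (x + θ • v) := fun j => by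
        rw [map_add, map_smul, hnv j j.2, smul_eq_mul, mul_comm θ]
      simp_rw [hy] at hθ ⊢
      have h0 := sum_gram_mul_cotHalf_eq_zero b hinv hk hθ
      rw [Finset.sum_subtype _ hmem] at h0
      -- Leaving out j = i costs nothing: at its pole `cotHalf` is 0, by division by zero.
      have h1 : ∀ j : {i // b.IsPos i}, (if (i : ι) = j then 0 else k i * k j * gram P i j) *
          (Real.cos (P.root' j (x + θ • v) / 2) / Real.sin (P.root' j (x + θ • v) / 2)) =
          k i * (k j * gram P i j * cotHalf P j (x + θ • v)) := fun j => by
        split_ifs with hij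
        · rw [← hij, cotHalf, hθ]; simp
        · rw [cotHalf]; ring
      simp_rw [h1]
      rw [← Finset.mul_sum, h0, mul_zero]
  -- and at the other regular points
  by_contra hne
  -- A failure at h would persist for all small s by continuity, yet only countably many points h +
  -- s w are not generic.
  let g : ℝ → ℝ := fun s => ∑ i with b.IsPos i, ∑ j with b.IsPos j,
    (if i = j then 0 else k i * k j * gram P i j) *
      (cotHalf P i (h + s • w) * cotHalf P j (h + s • w))
  have hlin : ∀ i, Continuous fun s : ℝ => P.root' i (h + s • w) / 2 := fun i => by
    simp_rw [map_add, map_smul]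
    fun_prop
  have hcot : ∀ i, ContinuousAt (fun s : ℝ => cotHalf P i (h + s • w)) 0 := fun i =>
    ((Real.continuous_cos.comp (hlin i)).continuousAt).div
      ((Real.continuous_sin.comp (hlin i)).continuousAt) (by simpa using hreg i)
  have hg : ContinuousAt g 0 :=
    tendsto_finsetSum _ fun i _ => tendsto_finsetSum _ fun j _ =>
      ((hcot i).mul (hcot j)).const_mul _
  have hev1 := hg.eventually_ne (y := -∑ i with b.IsPos i, ∑ j with b.IsPos j,
        (if i = j then 0 else k i * k j * gram P i j)) (by simpa [g] using hne)
  have hev2 : ∀ᶠ s in nhds (0 : ℝ), ∀ i, Real.sin (P.root' i (h + s • w) / 2) ≠ 0 :=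
    Filter.eventually_all.2 fun i =>
      (Real.continuous_sin.comp (hlin i)).continuousAt.eventually_ne (by simpa using hreg i)
  have hcount : (⋃ (p) (m : ℤ), {s : ℝ | φ p (h + s • w) = m * (2 * Real.pi)}).Countable := by
    refine Set.countable_iUnion fun p => Set.countable_iUnion fun m => ?_
    refine Set.Subsingleton.countable fun s hs t ht => ?_
    simp only [Set.mem_ofPred_eq, map_add, map_smul, smul_eq_mul] at hs ht
    exact mul_right_cancel₀ (hw p) (by linarith)
  obtain ⟨s, hs, hs1, hs2⟩ := (hcount.dense_compl ℝ).inter_nhds_nonempty (hev1.and hev2)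
  refine hs1 (hgen _ hs2 fun p m hpm => hs ?_)
  simp only [Set.mem_iUnion]
  exact ⟨p, m, hpm⟩

end CotIdentity

/-! ### Calculus on the torus -/

lemma isQuotientMap_proj : Topology.IsQuotientMap (proj P) :=
  isQuotientMap_quotient_mk' (s := QuotientAddGroup.leftRel (torusLattice P))

lemma isOpenMap_proj : IsOpenMap (proj P) :=
  QuotientAddGroup.isOpenMap_coe (N := torusLattice P)

instance : SecondCountableTopology (Torus P) :=
  (isQuotientMap_proj P).secondCountableTopology (isOpenMap_proj P)

lemma continuous_of_comp_proj {E : Type*} [TopologicalSpace E] {u : Torus P → E}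
    (hu : Continuous fun h => u (proj P h)) : Continuous u :=
  (isQuotientMap_proj P).continuous_iff.2 hu

lemma exists_bound_of_continuous [P.IsRootSystem] {u : Torus P → ℂ} (hu : Continuous u) :
    ∃ C : ℝ, 0 ≤ C ∧ ∀ t, ‖u t‖ ≤ C := by
  obtain ⟨C, hC⟩ := isCompact_univ.exists_bound_of_continuousOn hu.continuousOn
  exact ⟨C, (norm_nonneg _).trans (hC 0 trivial), fun t => hC t trivial⟩

lemma integrable_of_continuous [P.IsRootSystem] {u : Torus P → ℂ} (hu : Continuous u) :
    Integrable u (haarT P) := by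
  obtain ⟨C, -, hC⟩ := exists_bound_of_continuous P hu
  exact .of_bound hu.aestronglyMeasurable C (.of_forall hC)

lemma memLp_of_continuous [P.IsRootSystem] {u : Torus P → ℂ} (hu : Continuous u) :
    MemLp u 2 (haarT P) := by
  obtain ⟨C, -, hC⟩ := exists_bound_of_continuous P hu
  exact .of_bound hu.aestronglyMeasurable C (.of_forall hC)

/-- The derivative of a function on `T` in the direction of a vector of `V`. -/
def dirDeriv (v : V) (u : Torus P → ℂ) : Torus P → ℂ :=
  descend P fun h => fderiv ℝ (fun h => u (proj P h)) h v

lemma dirDeriv_proj (v : V) (u : Torus P → ℂ) (h : V) :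
    dirDeriv P v u (proj P h) = fderiv ℝ (fun h => u (proj P h)) h v := by
  refine descend_proj P (fun l hl x => ?_) h
  have hper : (fun h => u (proj P (h + l))) = fun h => u (proj P h) := by
    funext y
    congr 1
    rw [proj_eq_iff]
    simpa using hl
  rw [← fderiv_comp_add_right (f := fun h => u (proj P h)) l, hper]

lemma contDiff_dirDeriv {n : ℕ} {u : Torus P → ℂ} (v : V)
    (hu : ContDiff ℝ (n + 1 : ℕ) fun h => u (proj P h)) :
    ContDiff ℝ n fun h => dirDeriv P v u (proj P h) := by
  simp_rw [dirDeriv_proj]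
  exact (hu.fderiv_right (m := n) (by norm_cast)).clm_apply contDiff_const

lemma hasDerivAt_line {u : Torus P → ℂ} (hu : ContDiff ℝ 1 fun h => u (proj P h)) (v : V)
    (t : Torus P) (s : ℝ) :
    HasDerivAt (fun s : ℝ => u (t + proj P (s • v))) (dirDeriv P v u (t + proj P (s • v))) s := by
  obtain ⟨h, rfl⟩ := proj_surjective P t
  simp_rw [← map_add]
  rw [dirDeriv_proj]
  have h1 := ((hu.differentiable one_ne_zero) (h + s • v)).hasFDerivAt
  have h2 : HasDerivAt (fun s : ℝ => h + s • v) v s := by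
    simpa using ((hasDerivAt_id s).smul_const v).const_add h
  exact h1.comp_hasDerivAt s h2

/-- By translation invariance the integral of u(t + sv) does not depend on s; differentiate under
the integral at s = 0. -/
lemma integral_dirDeriv [P.IsRootSystem] {u : Torus P → ℂ}
    (hu : ContDiff ℝ 1 fun h => u (proj P h)) (v : V) :
    ∫ t, dirDeriv P v u t ∂haarT P = 0 := by
  have hc : Continuous u := continuous_of_comp_proj P hu.continuous
  have hd : Continuous (dirDeriv P v u) :=
    continuous_of_comp_proj P (contDiff_dirDeriv P (n := 0) v hu).continuous
  obtain ⟨C, -, hC⟩ := exists_bound_of_continuous P hd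
  have key := (hasDerivAt_integral_of_dominated_loc_of_deriv_le (μ := haarT P) (𝕜 := ℝ)
    (F := fun (s : ℝ) t => u (t + proj P (s • v))) (F' := fun s t => dirDeriv P v u (t + proj P (s • v)))
    (x₀ := 0) (s := Set.univ) (bound := fun _ => C) Filter.univ_mem
    (.of_forall fun s => (hc.comp (continuous_add_const _)).aestronglyMeasurable)
    (integrable_of_continuous P (hc.comp (continuous_add_const _)))
    (hd.comp (continuous_add_const _)).aestronglyMeasurable
    (.of_forall fun t s _ => hC _) (integrable_const _)
    (.of_forall fun t s _ => hasDerivAt_line P hu v t s)).2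
  have hconst : (fun s : ℝ => ∫ t, u (t + proj P (s • v)) ∂haarT P) =
      fun _ => ∫ t, u t ∂haarT P := by
    funext s
    exact integral_add_right_eq_self u _
  rw [hconst] at key
  have := key.unique (hasDerivAt_const _ _)
  simpa using this

lemma dirDeriv_mul {u w : Torus P → ℂ} (hu : ContDiff ℝ 1 fun h => u (proj P h))
    (hw : ContDiff ℝ 1 fun h => w (proj P h)) (v : V) (t : Torus P) :
    dirDeriv P v (fun t => u t * w t) t = dirDeriv P v u t * w t + u t * dirDeriv P v w t := by
  obtain ⟨h, rfl⟩ := proj_surjective P t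
  simp only [dirDeriv_proj]
  rw [fderiv_fun_mul ((hu.differentiable one_ne_zero) h) ((hw.differentiable one_ne_zero) h)]
  simp only [add_apply, smul_apply, smul_eq_mul]
  ring

lemma laplacian_eq_sum_fderiv {f : V → ℂ} (hf : ContDiff ℝ 2 f) (h : V) :
    Laplacian.laplacian f h = ∑ i, fderiv ℝ (fun x => fderiv ℝ f x (stdOrthonormalBasis ℝ V i)) h
      (stdOrthonormalBasis ℝ V i) := by
  rw [laplacian_eq_iteratedFDeriv_stdOrthonormalBasis]
  refine Finset.sum_congr rfl fun i _ => ?_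
  have hd : DifferentiableAt ℝ (fderiv ℝ f) h :=
    ((hf.fderiv_right (m := 1) (by norm_num)).differentiable one_ne_zero) h
  rw [iteratedFDeriv_two_apply, fderiv_clm_apply hd (differentiableAt_const _)]
  simp

lemma laplacianT_eq_sum {u : Torus P → ℂ} (hu : u ∈ C2 P) (t : Torus P) :
    laplacianT P u t = ∑ i, dirDeriv P (stdOrthonormalBasis ℝ V i)
      (dirDeriv P (stdOrthonormalBasis ℝ V i) u) t := by
  obtain ⟨h, rfl⟩ := proj_surjective P t
  rw [laplacianT_proj, laplacian_eq_sum_fderiv hu]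
  simp only [dirDeriv_proj]

lemma continuous_laplacianT {u : Torus P → ℂ} (hu : u ∈ C2 P) : Continuous (laplacianT P u) := by
  have : laplacianT P u = fun t => _ := funext (laplacianT_eq_sum P hu)
  rw [this]
  refine continuous_finsetSum _ fun i _ => continuous_of_comp_proj P ?_
  exact (contDiff_dirDeriv P (n := 0) _ (contDiff_dirDeriv P (n := 1) _ hu)).continuous

/-- Green's identity on the torus. -/
lemma integral_laplacianT_mul [P.IsRootSystem] {u w : Torus P → ℂ} (hu : u ∈ C2 P)
    (hw : w ∈ C2 P) :
    ∫ t, laplacianT P u t * w t ∂haarT P = ∫ t, u t * laplacianT P w t ∂haarT P := by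
  have hu1 : ContDiff ℝ 1 fun h => u (proj P h) := ((mem_C2 P).1 hu).of_le (by norm_num)
  have hw1 : ContDiff ℝ 1 fun h => w (proj P h) := ((mem_C2 P).1 hw).of_le (by norm_num)
  have hu2 := fun v => contDiff_dirDeriv P (n := 1) v hu
  have hw2 := fun v => contDiff_dirDeriv P (n := 1) v hw
  have hcu : Continuous u := continuous_of_comp_proj P hu1.continuous
  have hcw : Continuous w := continuous_of_comp_proj P hw1.continuous
  have hi1 : Integrable (fun t => laplacianT P u t * w t) (haarT P) :=
    integrable_of_continuous P ((continuous_laplacianT P hu).mul hcw)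
  have hi2 : Integrable (fun t => u t * laplacianT P w t) (haarT P) :=
    integrable_of_continuous P (hcu.mul (continuous_laplacianT P hw))
  rw [← sub_eq_zero, ← integral_sub hi1 hi2]
  have hF : ∀ v, ContDiff ℝ 1 fun h => dirDeriv P v u (proj P h) * w (proj P h) := fun v =>
    (hu2 v).mul hw1
  have hG : ∀ v, ContDiff ℝ 1 fun h => u (proj P h) * dirDeriv P v w (proj P h) := fun v =>
    hu1.mul (hw2 v)
  have hcd : ∀ {f : Torus P → ℂ} (v : V), (ContDiff ℝ 1 fun h => f (proj P h)) →
      Integrable (dirDeriv P v f) (haarT P) := fun v hf =>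
    integrable_of_continuous P
      (continuous_of_comp_proj P (contDiff_dirDeriv P (n := 0) v hf).continuous)
  -- The difference is a divergence, and each of its terms integrates to 0.
  have hpt : ∀ t, laplacianT P u t * w t - u t * laplacianT P w t =
      ∑ i, (dirDeriv P (stdOrthonormalBasis ℝ V i)
          (fun t => dirDeriv P (stdOrthonormalBasis ℝ V i) u t * w t) t -
        dirDeriv P (stdOrthonormalBasis ℝ V i)
          (fun t => u t * dirDeriv P (stdOrthonormalBasis ℝ V i) w t) t) := fun t => by
    rw [laplacianT_eq_sum P hu, laplacianT_eq_sum P hw, Finset.sum_mul, Finset.mul_sum,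
      ← Finset.sum_sub_distrib]
    refine Finset.sum_congr rfl fun i _ => ?_
    rw [dirDeriv_mul P (hu2 _) hw1, dirDeriv_mul P hu1 (hw2 _)]
    ring
  simp_rw [hpt]
  refine (integral_finsetSum _ fun i _ => (hcd _ (hF _)).sub (hcd _ (hG _))).trans ?_
  refine Finset.sum_eq_zero fun i _ => ?_
  refine (integral_sub (hcd _ (hF _)) (hcd _ (hG _))).trans ?_
  rw [integral_dirDeriv P (hF _), integral_dirDeriv P (hG _), sub_zero]

/-! ### Integration along lines -/

/-- Tonelli and translation invariance; the 2 is the length of [-1, 1]. This lets statements on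
lines be integrated over the torus without coordinates or a fundamental domain. -/
lemma lintegral_line [P.IsRootSystem] {f : Torus P → ENNReal} (hf : Measurable f) (v : V) :
    ∫⁻ t, ∫⁻ s in Set.Icc (-1 : ℝ) 1, f (t + proj P (s • v)) ∂volume ∂haarT P =
      2 * ∫⁻ t, f t ∂haarT P := by
  have hcont : Continuous fun p : Torus P × ℝ => p.1 + proj P (p.2 • v) :=
    continuous_fst.add ((continuous_proj P).comp (continuous_snd.smul continuous_const))
  rw [lintegral_lintegral_swap (f := fun t (s : ℝ) => f (t + proj P (s • v)))
    (hf.comp hcont.measurable).aemeasurable]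
  simp_rw [lintegral_add_right_eq_self f]
  rw [lintegral_const, mul_comm]
  norm_num

lemma measure_eq_zero_of_line [P.IsRootSystem] {Z : Set (Torus P)} (hZ : MeasurableSet Z) (v : V)
    (h : ∀ t, {s : ℝ | t + proj P (s • v) ∈ Z}.Countable) : haarT P Z = 0 := by
  have key := lintegral_line P (measurable_const.indicator hZ : Measurable (Z.indicator 1)) v
  rw [lintegral_indicator_one hZ] at key
  have h0 : ∀ t, ∫⁻ s in Set.Icc (-1 : ℝ) 1, Z.indicator (1 : Torus P → ENNReal)
      (t + proj P (s • v)) = 0 := by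
    intro t
    refine (lintegral_congr_ae (g := fun _ => 0) ?_).trans (lintegral_zero)
    filter_upwards [(h t).ae_notMem (volume.restrict (Set.Icc (-1 : ℝ) 1))] with s hs
    exact Set.indicator_of_notMem hs _
  simp only [h0, lintegral_zero] at key
  simpa using key.symm

lemma ae_integrableOn_line [P.IsRootSystem] {f : Torus P → ℂ} (hf : Measurable f)
    (hf' : Integrable f (haarT P)) (v : V) :
    ∀ᵐ t ∂haarT P, IntegrableOn (fun s : ℝ => f (t + proj P (s • v))) (Set.Icc (-1) 1) := by
  have key := lintegral_line P hf.enorm v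
  have hcont : Continuous fun p : Torus P × ℝ => p.1 + proj P (p.2 • v) :=
    continuous_fst.add ((continuous_proj P).comp (continuous_snd.smul continuous_const))
  have hmeas : Measurable fun t : Torus P => ∫⁻ s in Set.Icc (-1 : ℝ) 1, ‖f (t + proj P (s • v))‖ₑ :=
    Measurable.lintegral_prod_right' (f := fun p : Torus P × ℝ => ‖f (p.1 + proj P (p.2 • v))‖ₑ)
      (hf.comp hcont.measurable).enorm
  have hfin : ∫⁻ t, ∫⁻ s in Set.Icc (-1 : ℝ) 1, ‖f (t + proj P (s • v))‖ₑ ∂volume ∂haarT P ≠ ⊤ := by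
    rw [key]
    exact ENNReal.mul_ne_top (by simp) hf'.2.ne
  filter_upwards [ae_lt_top hmeas hfin] with t ht
  refine ⟨(hf.comp ?_).aestronglyMeasurable, ht⟩
  exact (continuous_const.add
    ((continuous_proj P).comp (continuous_id.smul continuous_const))).measurable

lemma measurable_absSin [P.IsCrystallographic] (i : ι) : Measurable (absSin P i) := by
  refine (continuous_of_comp_proj P ?_).measurable
  simp_rw [absSin_proj]
  have : Continuous (P.root' i) := (P.root' i).continuous_of_finiteDimensional
  fun_prop

/-- Along its own coroot a root has slope 2, so every such line meets the zeros of the sine in a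
countable set. -/
lemma ae_absSin_ne_zero [P.IsRootSystem] [P.IsCrystallographic] :
    ∀ᵐ t ∂haarT P, ∀ i, absSin P i t ≠ 0 := by
  refine ae_all_iff.2 fun i => ?_
  refine measure_eq_zero_of_line P (Z := {t | ¬ absSin P i t ≠ 0}) ?_ (P.coroot i) fun t => ?_
  · simp only [not_not]
    exact measurable_absSin P i (measurableSet_singleton 0)
  · obtain ⟨h, rfl⟩ := proj_surjective P t
    refine (Set.countable_range fun m : ℤ => m * Real.pi - P.root' i h / 2).mono fun s hs => ?_
    simp only [Set.mem_ofPred_eq, not_not, ← map_add, absSin_proj, abs_eq_zero] at hs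
    obtain ⟨m, hm⟩ := Real.sin_eq_zero_iff.1 hs
    refine ⟨m, ?_⟩
    simp only [hm, map_add, map_smul, P.root'_coroot_eq_pairing, P.pairing_same, smul_eq_mul]
    ring

/-! ### The regularized ground state -/

/-- The quotient `sin (α / 2) cos (α / 2) / (sin² (α / 2) + ε)`. -/
def regCot (ε : ℝ) (i : ι) (h : V) : ℝ :=
  Real.sin (P.root' i h / 2) * Real.cos (P.root' i h / 2) / (Real.sin (P.root' i h / 2) ^ 2 + ε)

/-- Twice the logarithmic derivative of `regCot` with respect to the angle. -/
def regCotDeriv (ε : ℝ) (i : ι) (h : V) : ℝ :=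
  (Real.cos (P.root' i h / 2) ^ 2 - Real.sin (P.root' i h / 2) ^ 2) /
      (Real.sin (P.root' i h / 2) ^ 2 + ε) -
    2 * Real.sin (P.root' i h / 2) ^ 2 * Real.cos (P.root' i h / 2) ^ 2 /
      (Real.sin (P.root' i h / 2) ^ 2 + ε) ^ 2

lemma fderiv_apply_eq_of_hasDerivAt_line {E : Type*} [NormedAddCommGroup E] [NormedSpace ℝ E]
    {f : V → E} {h v : V} {d : E} (hf : DifferentiableAt ℝ f h)
    (hd : HasDerivAt (fun s : ℝ => f (h + s • v)) d 0) : fderiv ℝ f h v = d := by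
  have h2 : HasDerivAt (fun s : ℝ => h + s • v) v 0 := by
    simpa using ((hasDerivAt_id (0 : ℝ)).smul_const v).const_add h
  have h1 : HasFDerivAt f (fderiv ℝ f h) (h + (0 : ℝ) • v) := by simpa using hf.hasFDerivAt
  exact (h1.comp_hasDerivAt (0 : ℝ) h2).unique hd

lemma contDiff_root' {n : WithTop ℕ∞} (i : ι) : ContDiff ℝ n fun h : V => P.root' i h :=
  (LinearMap.toContinuousLinearMap (P.root' i)).contDiff

lemma contDiff_sin_sq_add {n : WithTop ℕ∞} (ε : ℝ) (i : ι) :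
    ContDiff ℝ n fun h : V => Real.sin (P.root' i h / 2) ^ 2 + ε :=
  ((Real.contDiff_sin.comp ((contDiff_root' P i).div_const 2)).pow 2).add contDiff_const

lemma contDiff_regCot {n : WithTop ℕ∞} {ε : ℝ} (hε : 0 < ε) (i : ι) :
    ContDiff ℝ n (regCot P ε i) :=
  ((Real.contDiff_sin.comp ((contDiff_root' P i).div_const 2)).mul
    (Real.contDiff_cos.comp ((contDiff_root' P i).div_const 2))).div
    (contDiff_sin_sq_add P ε i) fun h => by positivity

lemma fderiv_regCot {ε : ℝ} (hε : 0 < ε) (i : ι) (h v : V) :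
    fderiv ℝ (regCot P ε i) h v = regCotDeriv P ε i h * (P.root' i v / 2) := by
  refine fderiv_apply_eq_of_hasDerivAt_line
    (((contDiff_regCot P (n := 1) hε i).differentiable one_ne_zero) h) ?_
  have hl : HasDerivAt (fun s : ℝ => P.root' i (h + s • v) / 2) (P.root' i v / 2) 0 := by
    simp_rw [map_add, map_smul]
    simpa using (((hasDerivAt_id (0 : ℝ)).smul_const (P.root' i v)).const_add
      (P.root' i h)).div_const 2
  have hne : Real.sin (P.root' i (h + (0 : ℝ) • v) / 2) ^ 2 + ε ≠ 0 := by positivity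
  have key := (hl.sin.mul hl.cos).div ((hl.sin.pow 2).add_const ε) hne
  refine key.congr_deriv ?_
  have hne' : Real.sin (P.root' i h / 2) ^ 2 + ε ≠ 0 := by positivity
  simp only [zero_smul, add_zero, regCotDeriv, Pi.mul_apply, Pi.pow_apply]
  field_simp
  push_cast
  ring

open scoped Classical in
/-- The smooth function `∏_{α > 0} (sin² (α / 2) + ε) ^ (k_α / 2)` on `T`. -/
def regState [P.IsCrystallographic] (b : P.Base) (k : ι → ℝ) (ε : ℝ) (t : Torus P) : ℝ :=
  ∏ i with b.IsPos i, (absSin P i t ^ 2 + ε) ^ (k i / 2)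

section Regularized

open scoped Classical

variable {P} [P.IsCrystallographic] (b : P.Base) (k : ι → ℝ)

lemma regState_proj (ε : ℝ) (h : V) : regState P b k ε (proj P h) =
    ∏ i with b.IsPos i, (Real.sin (P.root' i h / 2) ^ 2 + ε) ^ (k i / 2) := by
  simp only [regState, absSin_proj, sq_abs]

lemma contDiff_regState {n : WithTop ℕ∞} {ε : ℝ} (hε : 0 < ε) :
    ContDiff ℝ n fun h => regState P b k ε (proj P h) := by
  simp_rw [regState_proj]
  exact contDiff_prod fun i _ =>
    (contDiff_sin_sq_add P ε i).rpow_const_of_ne fun h => by positivity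

lemma fderiv_regState {ε : ℝ} (hε : 0 < ε) (h v : V) :
    fderiv ℝ (fun h => regState P b k ε (proj P h)) h v =
      regState P b k ε (proj P h) *
        ∑ i with b.IsPos i, k i / 2 * regCot P ε i h * P.root' i v := by
  refine fderiv_apply_eq_of_hasDerivAt_line
    (((contDiff_regState b k (n := 1) hε).differentiable one_ne_zero) h) ?_
  have hexp : ∀ h, regState P b k ε (proj P h) = Real.exp (∑ i with b.IsPos i,
      Real.log (Real.sin (P.root' i h / 2) ^ 2 + ε) * (k i / 2)) := fun h => by
    rw [regState_proj, Real.exp_sum]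
    exact Finset.prod_congr rfl fun i _ => Real.rpow_def_of_pos (by positivity) _
  have hl : ∀ i, HasDerivAt (fun s : ℝ => P.root' i (h + s • v) / 2) (P.root' i v / 2) 0 := by
    intro i
    simp_rw [map_add, map_smul]
    simpa using (((hasDerivAt_id (0 : ℝ)).smul_const (P.root' i v)).const_add
      (P.root' i h)).div_const 2
  have hterm : ∀ i, HasDerivAt (fun s : ℝ =>
      Real.log (Real.sin (P.root' i (h + s • v) / 2) ^ 2 + ε) * (k i / 2))
      (k i / 2 * regCot P ε i h * P.root' i v) 0 := fun i => by
    have hne : Real.sin (P.root' i (h + (0 : ℝ) • v) / 2) ^ 2 + ε ≠ 0 := by positivity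
    refine (((((hl i).sin.pow 2).add_const ε).log hne).mul_const (k i / 2)).congr_deriv ?_
    have hne' : Real.sin (P.root' i h / 2) ^ 2 + ε ≠ 0 := by positivity
    simp only [zero_smul, add_zero, regCot, Pi.pow_apply]
    field_simp
    push_cast
    ring
  simp_rw [hexp]
  refine ((HasDerivAt.fun_sum fun i _ => hterm i).exp).congr_deriv ?_
  simp only [zero_smul, add_zero]

lemma sum_root'_mul_root' (i j : ι) :
    ∑ e, P.root' i (stdOrthonormalBasis ℝ V e) * P.root' j (stdOrthonormalBasis ℝ V e) =
      gram P i j := by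
  rw [gram, ← (stdOrthonormalBasis ℝ V).sum_inner_mul_inner]
  refine Finset.sum_congr rfl fun e _ => ?_
  rw [inner_dualVec, real_inner_comm, inner_dualVec]

lemma sum_root'_mul_clm (i : ι) (L : V →L[ℝ] ℂ) :
    ∑ e, (P.root' i (stdOrthonormalBasis ℝ V e) : ℂ) * L (stdOrthonormalBasis ℝ V e) =
      L (dualVec P (P.root i)) := by
  conv_rhs => rw [← (stdOrthonormalBasis ℝ V).sum_repr' (dualVec P (P.root i))]
  rw [map_sum]
  refine Finset.sum_congr rfl fun e _ => ?_
  rw [map_smul, real_inner_comm, inner_dualVec, Complex.real_smul]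

/-- The Laplacian of the product of a function with the regularized ground state. -/
lemma laplacian_mul_regState {ε : ℝ} (hε : 0 < ε) {f : V → ℂ} (hf : ContDiff ℝ 2 f) (h : V) :
    Laplacian.laplacian (fun h => f h * (regState P b k ε (proj P h) : ℂ)) h =
      regState P b k ε (proj P h) * (Laplacian.laplacian f h +
        ∑ i with b.IsPos i, (k i * regCot P ε i h : ℝ) * fderiv ℝ f h (dualVec P (P.root i)) +
        f h * ((∑ i with b.IsPos i, k i / 4 * regCotDeriv P ε i h * gram P i i +
          ∑ i with b.IsPos i, ∑ j with b.IsPos j,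
            k i * k j / 4 * (regCot P ε i h * regCot P ε j h) * gram P i j : ℝ) : ℂ)) := by
  let ψ : V → ℝ := fun h => regState P b k ε (proj P h)
  let G : V → V → ℝ := fun v h => ∑ i with b.IsPos i, k i / 2 * regCot P ε i h * P.root' i v
  have hψ : ContDiff ℝ 2 fun h => (ψ h : ℂ) :=
    Complex.ofRealCLM.contDiff.comp (contDiff_regState b k hε)
  have hψd : Differentiable ℝ ψ := (contDiff_regState b k (n := 1) hε).differentiable one_ne_zero
  have hψcd : Differentiable ℝ fun h => (ψ h : ℂ) := hψ.differentiable (by norm_num)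
  have hG : ∀ v, Differentiable ℝ (G v) := fun v => by
    refine Differentiable.fun_sum fun i _ => ?_
    exact (((contDiff_regCot P (n := 1) hε i).differentiable one_ne_zero).const_mul _).mul_const _
  have hGc : ∀ v, Differentiable ℝ fun h => (G v h : ℂ) := fun v =>
    Complex.ofRealCLM.differentiable.comp (hG v)
  have dcast : ∀ {g : V → ℝ}, Differentiable ℝ g → ∀ h v,
      fderiv ℝ (fun h => (g h : ℂ)) h v = (fderiv ℝ g h v : ℝ) := fun hg h v => by
    have := (Complex.ofRealCLM.hasFDerivAt.comp h (hg h).hasFDerivAt).fderiv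
    change fderiv ℝ (Complex.ofRealCLM ∘ _) h v = _
    rw [this]
    rfl
  have dψ : ∀ h v, fderiv ℝ (fun h => (ψ h : ℂ)) h v = ψ h * G v h := fun h v => by
    rw [dcast hψd, fderiv_regState b k hε, ← Complex.ofReal_mul]
  have dG : ∀ h v, fderiv ℝ (fun h => (G v h : ℂ)) h v =
      (∑ i with b.IsPos i, k i / 4 * regCotDeriv P ε i h *
        (P.root' i v * P.root' i v) : ℝ) := fun h v => by
    rw [dcast (hG v)]
    congr 1
    simp only [G]
    rw [fderiv_fun_sum fun i _ => ((((contDiff_regCot P (n := 1) hε i).differentiable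
      one_ne_zero).const_mul _).mul_const _) h, _root_.sum_apply]
    refine Finset.sum_congr rfl fun i _ => ?_
    have hd := ((contDiff_regCot P (n := 1) hε i).differentiable one_ne_zero) h
    rw [fderiv_mul_const (hd.const_mul _), fderiv_const_mul hd]
    simp only [smul_apply, smul_eq_mul, fderiv_regCot P hε]
    ring
  have dmul : ∀ {f g : V → ℂ}, Differentiable ℝ f → Differentiable ℝ g → ∀ h v,
      fderiv ℝ (fun h => f h * g h) h v = fderiv ℝ f h v * g h + f h * fderiv ℝ g h v :=
    fun hf hg h v => by
      rw [fderiv_fun_mul (hf h) (hg h)]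
      simp only [add_apply, smul_apply, smul_eq_mul]
      ring
  have hfd : Differentiable ℝ f := hf.differentiable (by norm_num)
  have hfd' : ∀ v, Differentiable ℝ fun h => fderiv ℝ f h v := fun v =>
    ((hf.fderiv_right (m := 1) (by norm_num)).clm_apply contDiff_const).differentiable one_ne_zero
  -- Since ∂_v ψ = ψ G_v, the first derivative of fψ is again a function times ψ. Repeating the rule
  -- gives ψ (f'' + 2 f' G + f (G' + G²)), and summing over an orthonormal basis turns products of
  -- root values into Gram entries.
  have d1 : ∀ v, (fun h => fderiv ℝ (fun h => f h * (ψ h : ℂ)) h v) =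
      fun h => (fderiv ℝ f h v + f h * G v h) * ψ h := fun v => by
    funext h
    rw [dmul hfd hψcd, dψ]
    ring
  have d2 : ∀ v h, fderiv ℝ (fun h => fderiv ℝ (fun h => f h * (ψ h : ℂ)) h v) h v =
      ψ h * (fderiv ℝ (fun h => fderiv ℝ f h v) h v + 2 * (fderiv ℝ f h v * G v h) + f h *
        ((∑ i with b.IsPos i, k i / 4 * regCotDeriv P ε i h *
          (P.root' i v * P.root' i v) + G v h * G v h : ℝ) : ℂ)) := fun v h => by
    have hfG : Differentiable ℝ fun h => f h * (G v h : ℂ) := hfd.mul (hGc v)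
    have hfG' : Differentiable ℝ fun h => fderiv ℝ f h v + f h * (G v h : ℂ) := (hfd' v).add hfG
    have hadd : fderiv ℝ (fun h => fderiv ℝ f h v + f h * G v h) h v =
        fderiv ℝ (fun h => fderiv ℝ f h v) h v + fderiv ℝ (fun h => f h * (G v h : ℂ)) h v := by
      rw [fderiv_fun_add (hfd' v h) (hfG h)]
      rfl
    rw [d1, dmul hfG' hψcd, dψ, hadd, dmul hfd (hGc v), dG]
    push_cast
    ring
  rw [laplacian_eq_sum_fderiv (hf.mul hψ), laplacian_eq_sum_fderiv hf]
  simp_rw [← sum_root'_mul_root', ← sum_root'_mul_clm]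
  refine (Finset.sum_congr rfl fun e _ => d2 _ h).trans ?_
  rw [← Finset.mul_sum]
  congr 1
  rw [Finset.sum_add_distrib, Finset.sum_add_distrib, ← Finset.mul_sum]
  congr 1
  · congr 1
    simp only [G, Complex.ofReal_sum, Finset.mul_sum]
    rw [Finset.sum_comm]
    refine Finset.sum_congr rfl fun i _ => Finset.sum_congr rfl fun e _ => ?_
    push_cast
    ring
  · rw [← Finset.mul_sum, ← Complex.ofReal_sum, Finset.sum_add_distrib]
    congr 3
    · simp_rw [Finset.mul_sum]
      exact Finset.sum_comm
    · simp only [G, Finset.sum_mul_sum]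
      simp only [Finset.mul_sum]
      rw [Finset.sum_comm]
      refine Finset.sum_congr rfl fun i _ => ?_
      rw [Finset.sum_comm]
      refine Finset.sum_congr rfl fun j _ => Finset.sum_congr rfl fun e _ => ?_
      ring

end Regularized

/-! ### Limits and uniform bounds as the regularization is removed. -/

section Limits

open scoped Classical
open Filter Topology

variable {P} [P.IsCrystallographic] (b : P.Base) (k : ι → ℝ)

lemma continuous_absSin (i : ι) : Continuous (absSin P i) := by
  refine continuous_of_comp_proj P ?_
  simp_rw [absSin_proj]
  have : Continuous (P.root' i) := (P.root' i).continuous_of_finiteDimensional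
  fun_prop

lemma absSin_nonneg (i : ι) (t : Torus P) : 0 ≤ absSin P i t := by
  obtain ⟨h, rfl⟩ := proj_surjective P t
  rw [absSin_proj]
  exact abs_nonneg _

lemma absSin_le_one (i : ι) (t : Torus P) : absSin P i t ≤ 1 := by
  obtain ⟨h, rfl⟩ := proj_surjective P t
  rw [absSin_proj]
  exact Real.abs_sin_le_one _

lemma groundState_nonneg (t : Torus P) : 0 ≤ groundState P b k t :=
  Finset.prod_nonneg fun i _ => Real.rpow_nonneg (absSin_nonneg i t) _

variable {k} in
lemma groundState_le_one (hk : ∀ i, 0 ≤ k i) (t : Torus P) : groundState P b k t ≤ 1 :=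
  Finset.prod_le_one (fun i _ => Real.rpow_nonneg (absSin_nonneg i t) _)
    fun i _ => Real.rpow_le_one (absSin_nonneg i t) (absSin_le_one i t) (hk i)

variable {k} in
lemma continuous_groundState (hk : ∀ i, 0 ≤ k i) : Continuous (groundState P b k) :=
  continuous_finsetProd _ fun i _ => (continuous_absSin i).rpow_const fun _ => .inr (hk i)

lemma measurable_potentialTerm (i : ι) : Measurable (potentialTerm P i) := by
  have := measurable_absSin P i
  unfold potentialTerm
  fun_prop

lemma measurable_potential : Measurable (potential P b k) :=
  Finset.measurable_sum _ fun i _ => (measurable_potentialTerm i).const_mul _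

/-- The eigenvalue shift of the Jacobi operator. -/
def jacobiShift : ℝ :=
  ∑ i with b.IsPos i, k i * (k i - 1) * gram P i i / 12 -
    ∑ i with b.IsPos i, k i ^ 2 * gram P i i / 4 -
    (∑ i with b.IsPos i, ∑ j with b.IsPos j, (if i = j then 0 else k i * k j * gram P i j)) / 4

/-- The conjugate of the Hamiltonian by the ground state. -/
def jacobiOp (p : Torus P → ℂ) (h : V) : ℂ :=
  -laplacianT P p (proj P h) -
    ∑ i with b.IsPos i, (k i * cotHalf P i h : ℝ) * dirDeriv P (dualVec P (P.root i)) p (proj P h) -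
    jacobiShift b k * p (proj P h)

lemma tendsto_regCot {h : V} {i : ι} (hi : Real.sin (P.root' i h / 2) ≠ 0) :
    Tendsto (fun ε => regCot P ε i h) (𝓝 0) (𝓝 (cotHalf P i h)) := by
  have hc : ContinuousAt (fun ε => regCot P ε i h) 0 := by
    unfold regCot
    refine ContinuousAt.div (by fun_prop) (by fun_prop) (by positivity)
  have : regCot P 0 i h = cotHalf P i h := by
    rw [regCot, cotHalf, add_zero, sq, mul_div_mul_left _ _ hi]
  rw [← this]
  exact hc

lemma tendsto_regCotDeriv {h : V} {i : ι} (hi : Real.sin (P.root' i h / 2) ≠ 0) :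
    Tendsto (fun ε => regCotDeriv P ε i h) (𝓝 0) (𝓝 (-1 / Real.sin (P.root' i h / 2) ^ 2)) := by
  have hc : ContinuousAt (fun ε => regCotDeriv P ε i h) 0 := by
    unfold regCotDeriv
    refine ContinuousAt.sub (ContinuousAt.div (by fun_prop) (by fun_prop) (by positivity))
      (ContinuousAt.div (by fun_prop) (by fun_prop) (by positivity))
  have : regCotDeriv P 0 i h = -1 / Real.sin (P.root' i h / 2) ^ 2 := by
    rw [regCotDeriv, add_zero]
    have := Real.sin_sq_add_cos_sq (P.root' i h / 2)
    field_simp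
    linear_combination -this
  rw [← this]
  exact hc

lemma tendsto_regState {t : Torus P} (ht : ∀ i, absSin P i t ≠ 0) :
    Tendsto (fun ε => regState P b k ε t) (𝓝 0) (𝓝 (groundState P b k t)) := by
  have : groundState P b k t = regState P b k 0 t := by
    refine Finset.prod_congr rfl fun i _ => ?_
    rw [add_zero, ← Real.rpow_natCast, ← Real.rpow_mul (absSin_nonneg i t)]
    congr 1
    push_cast
    ring
  rw [this]
  refine tendsto_finsetProd _ fun i _ => ?_
  have : 0 < absSin P i t ^ 2 + 0 := by have := ht i; positivity
  have hc : ContinuousAt (fun ε : ℝ => (absSin P i t ^ 2 + ε) ^ (k i / 2)) 0 :=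
    ContinuousAt.rpow_const (by fun_prop) (.inl this.ne')
  exact hc

variable {k} in
-- For ε ≤ 1 each base is at most 2 and the exponents are nonnegative, which gives a bound that does
-- not depend on ε.
lemma regState_bounds (hk : ∀ i, 0 ≤ k i) {ε : ℝ} (hε : 0 < ε) (hε1 : ε ≤ 1) (t : Torus P) :
    0 ≤ regState P b k ε t ∧ regState P b k ε t ≤ ∏ i with b.IsPos i, (2 : ℝ) ^ (k i / 2) := by
  have h0 : ∀ i, 0 ≤ absSin P i t ^ 2 + ε := fun i => by positivity
  refine ⟨Finset.prod_nonneg fun i _ => Real.rpow_nonneg (h0 i) _,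
    Finset.prod_le_prod (fun i _ => Real.rpow_nonneg (h0 i) _) fun i _ =>
      Real.rpow_le_rpow (h0 i) ?_ (by have := hk i; positivity)⟩
  have := absSin_nonneg i t
  nlinarith [absSin_le_one i t]

lemma mul_regState_mem_C2 {ε : ℝ} (hε : 0 < ε) {p : Torus P → ℂ} (hp : p ∈ C2 P) :
    (fun t => p t * (regState P b k ε t : ℂ)) ∈ C2 P :=
  ContDiff.mul ((mem_C2 P).1 hp) (Complex.ofRealCLM.contDiff.comp (contDiff_regState b k hε))

lemma laplacianT_mul_regState {ε : ℝ} (hε : 0 < ε) {p : Torus P → ℂ} (hp : p ∈ C2 P) (h : V) :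
    laplacianT P (fun t => p t * (regState P b k ε t : ℂ)) (proj P h) =
      regState P b k ε (proj P h) * (laplacianT P p (proj P h) +
        ∑ i with b.IsPos i, (k i * regCot P ε i h : ℝ) *
          dirDeriv P (dualVec P (P.root i)) p (proj P h) +
        p (proj P h) * ((∑ i with b.IsPos i, k i / 4 * regCotDeriv P ε i h * gram P i i +
          ∑ i with b.IsPos i, ∑ j with b.IsPos j,
            k i * k j / 4 * (regCot P ε i h * regCot P ε j h) * gram P i j : ℝ) : ℂ)) := by
  simp only [laplacianT_proj, dirDeriv_proj]
  exact laplacian_mul_regState b k hε hp h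

/-- This contains ∇²Δ = (V + c)Δ with c the `jacobiShift`. A diagonal term -k/(4 sin²) + k² cot²/4
equals k(k-1)/(4 sin²) - k²/4, where the first part is the singular part of V. The cross terms are
constant by `sum_cotHalf_mul_cotHalf`, and c collects all constants. -/
lemma tendsto_laplacianT_mul_regState [P.IsRootSystem] [P.IsReduced]
    (hinv : ∀ i x y, inner ℝ (P.coreflection i x) (P.coreflection i y) = inner ℝ x y)
    (hkr : ∀ i j, k (P.reflectionPerm i j) = k j)
    {p : Torus P → ℂ} (hp : p ∈ C2 P) {h : V} (hreg : ∀ i, Real.sin (P.root' i h / 2) ≠ 0) :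
    Tendsto (fun ε => laplacianT P (fun t => p t * (regState P b k ε t : ℂ)) (proj P h))
      (𝓝[>] 0) (𝓝 ((potential P b k (proj P h) * p (proj P h) - jacobiOp b k p h) *
        groundState P b k (proj P h))) := by
  have hst : Tendsto (fun ε => regState P b k ε (proj P h)) (𝓝[>] 0)
      (𝓝 (groundState P b k (proj P h))) :=
    (tendsto_regState b k fun i => by simpa [absSin_proj] using hreg i).mono_left
      nhdsWithin_le_nhds
  have hc : ∀ i, Tendsto (fun ε => regCot P ε i h) (𝓝[>] 0) (𝓝 (cotHalf P i h)) := fun i =>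
    (tendsto_regCot (hreg i)).mono_left nhdsWithin_le_nhds
  have hcd : ∀ i, Tendsto (fun ε => regCotDeriv P ε i h) (𝓝[>] 0)
      (𝓝 (-1 / Real.sin (P.root' i h / 2) ^ 2)) := fun i =>
    (tendsto_regCotDeriv (hreg i)).mono_left nhdsWithin_le_nhds
  have hbr : Tendsto (fun ε => ∑ i with b.IsPos i, k i / 4 * regCotDeriv P ε i h * gram P i i +
      ∑ i with b.IsPos i, ∑ j with b.IsPos j,
        k i * k j / 4 * (regCot P ε i h * regCot P ε j h) * gram P i j) (𝓝[>] 0)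
      (𝓝 (potential P b k (proj P h) + jacobiShift b k)) := by
    have hval : potential P b k (proj P h) + jacobiShift b k =
        ∑ i with b.IsPos i, k i / 4 * (-1 / Real.sin (P.root' i h / 2) ^ 2) * gram P i i +
        ∑ i with b.IsPos i, ∑ j with b.IsPos j,
          k i * k j / 4 * (cotHalf P i h * cotHalf P j h) * gram P i j := by
      have hcross := sum_cotHalf_mul_cotHalf b hinv hkr hreg
      have hsplit : ∑ i with b.IsPos i, ∑ j with b.IsPos j,
          k i * k j / 4 * (cotHalf P i h * cotHalf P j h) * gram P i j =
          ∑ i with b.IsPos i, k i ^ 2 / 4 * cotHalf P i h ^ 2 * gram P i i +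
          (∑ i with b.IsPos i, ∑ j with b.IsPos j, (if i = j then 0 else k i * k j * gram P i j) *
            (cotHalf P i h * cotHalf P j h)) / 4 := by
        rw [Finset.sum_div, ← Finset.sum_add_distrib]
        refine Finset.sum_congr rfl fun i hi => ?_
        rw [Finset.sum_div, ← Finset.sum_ite_eq_of_mem (Finset.univ.filter b.IsPos) i
          (fun j => k i ^ 2 / 4 * cotHalf P i h ^ 2 * gram P i i) hi, ← Finset.sum_add_distrib]
        refine Finset.sum_congr rfl fun j _ => ?_
        split_ifs with hij
        · subst hij; ring
        · ring
      rw [hsplit, hcross, jacobiShift, potential]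
      have hcot : ∀ i, cotHalf P i h ^ 2 = 1 / Real.sin (P.root' i h / 2) ^ 2 - 1 := fun i => by
        have h1 := Real.sin_sq_add_cos_sq (P.root' i h / 2)
        have := hreg i
        rw [cotHalf]
        field_simp
        linear_combination h1
      have hmain : ∑ i with b.IsPos i, k i * (k i - 1) * potentialTerm P i (proj P h) +
          ∑ i with b.IsPos i, k i * (k i - 1) * gram P i i / 12 -
          ∑ i with b.IsPos i, k i ^ 2 * gram P i i / 4 =
          ∑ i with b.IsPos i, k i / 4 * (-1 / Real.sin (P.root' i h / 2) ^ 2) * gram P i i +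
          ∑ i with b.IsPos i, k i ^ 2 / 4 * cotHalf P i h ^ 2 * gram P i i := by
        rw [← Finset.sum_add_distrib, ← Finset.sum_sub_distrib, ← Finset.sum_add_distrib]
        refine Finset.sum_congr rfl fun i _ => ?_
        have := hreg i
        rw [hcot, potentialTerm, rootNormSq_eq_gram, absSin_proj, sq_abs]
        field_simp
        ring
      linear_combination hmain
    rw [hval]
    refine Tendsto.add (tendsto_finsetSum _ fun i _ => ((hcd i).const_mul _).mul_const _)
      (tendsto_finsetSum _ fun i _ => tendsto_finsetSum _ fun j _ =>
        (((hc i).mul (hc j)).const_mul _).mul_const _)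
  have hlim : Tendsto (fun ε => (regState P b k ε (proj P h) : ℂ) * (laplacianT P p (proj P h) +
        ∑ i with b.IsPos i, (k i * regCot P ε i h : ℝ) *
          dirDeriv P (dualVec P (P.root i)) p (proj P h) +
        p (proj P h) * ((∑ i with b.IsPos i, k i / 4 * regCotDeriv P ε i h * gram P i i +
          ∑ i with b.IsPos i, ∑ j with b.IsPos j,
            k i * k j / 4 * (regCot P ε i h * regCot P ε j h) * gram P i j : ℝ) : ℂ))) (𝓝[>] 0)
      (𝓝 ((groundState P b k (proj P h) : ℂ) * (laplacianT P p (proj P h) +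
        ∑ i with b.IsPos i, (k i * cotHalf P i h : ℝ) *
          dirDeriv P (dualVec P (P.root i)) p (proj P h) +
        p (proj P h) * ((potential P b k (proj P h) + jacobiShift b k : ℝ) : ℂ)))) := by
    refine ((Complex.continuous_ofReal.tendsto _).comp hst).mul (Tendsto.add (Tendsto.add
      tendsto_const_nhds (tendsto_finsetSum _ fun i _ => Tendsto.mul_const _ ?_))
      (((Complex.continuous_ofReal.tendsto _).comp hbr).const_mul _))
    exact (Complex.continuous_ofReal.tendsto _).comp ((hc i).const_mul _)
  have hEq : (potential P b k (proj P h) * p (proj P h) - jacobiOp b k p h) *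
        groundState P b k (proj P h) = (groundState P b k (proj P h) : ℂ) *
        (laplacianT P p (proj P h) + ∑ i with b.IsPos i, (k i * cotHalf P i h : ℝ) *
          dirDeriv P (dualVec P (P.root i)) p (proj P h) +
        p (proj P h) * ((potential P b k (proj P h) + jacobiShift b k : ℝ) : ℂ)) := by
    rw [jacobiOp]
    push_cast
    ring
  rw [hEq]
  refine hlim.congr' ?_
  filter_upwards [self_mem_nhdsWithin] with ε hε
  rw [laplacianT_mul_regState b k hε hp]

/-- The bound is uniform in ε: regularization never makes the cotangent worse than its pole 1/|sin|.
-/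
lemma abs_regCot_mul_le {ε : ℝ} (hε : 0 < ε) (i : ι) (h : V) :
    |regCot P ε i h| * |Real.sin (P.root' i h / 2)| ≤ 1 := by
  have hs : 0 < Real.sin (P.root' i h / 2) ^ 2 + ε := by positivity
  rw [regCot, abs_div, abs_mul, abs_of_pos hs, div_mul_eq_mul_div, div_le_one hs, mul_right_comm,
    ← sq, sq_abs]
  have := Real.abs_cos_le_one (P.root' i h / 2)
  nlinarith [sq_nonneg (Real.sin (P.root' i h / 2)), abs_nonneg (Real.cos (P.root' i h / 2))]

/-- The two summands contribute 1 and 2, because s²/(s² + ε) ≤ 1; again the bound does not depend on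
ε. -/
lemma abs_regCotDeriv_mul_le {ε : ℝ} (hε : 0 < ε) (i : ι) (h : V) :
    |regCotDeriv P ε i h| * Real.sin (P.root' i h / 2) ^ 2 ≤ 3 := by
  have hcs := Real.sin_sq_add_cos_sq (P.root' i h / 2)
  set s := Real.sin (P.root' i h / 2) with hs
  set c := Real.cos (P.root' i h / 2) with hc
  have hd : 0 < s ^ 2 + ε := by positivity
  have hr : s ^ 2 / (s ^ 2 + ε) ≤ 1 := by rw [div_le_one hd]; linarith
  have hr0 : 0 ≤ s ^ 2 / (s ^ 2 + ε) := by positivity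
  have h1 : |(c ^ 2 - s ^ 2) / (s ^ 2 + ε)| * s ^ 2 ≤ 1 := by
    rw [abs_div, abs_of_pos hd, div_mul_eq_mul_div, mul_div_assoc]
    have : |c ^ 2 - s ^ 2| ≤ 1 := by rw [abs_le]; constructor <;> nlinarith [sq_nonneg s, sq_nonneg c]
    exact mul_le_one₀ this hr0 hr
  have h2 : |2 * s ^ 2 * c ^ 2 / (s ^ 2 + ε) ^ 2| * s ^ 2 ≤ 2 := by
    rw [abs_of_nonneg (by positivity)]
    have : 2 * s ^ 2 * c ^ 2 / (s ^ 2 + ε) ^ 2 * s ^ 2 =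
        2 * (c ^ 2 * ((s ^ 2 / (s ^ 2 + ε)) * (s ^ 2 / (s ^ 2 + ε)))) := by
      field_simp
    rw [this]
    have hc1 : c ^ 2 ≤ 1 := by nlinarith [sq_nonneg s]
    have := mul_le_one₀ hc1 (mul_nonneg hr0 hr0) (mul_le_one₀ hr hr0 hr)
    linarith
  have h3 : |regCotDeriv P ε i h| ≤ |(c ^ 2 - s ^ 2) / (s ^ 2 + ε)| +
      |2 * s ^ 2 * c ^ 2 / (s ^ 2 + ε) ^ 2| := abs_sub _ _
  have := mul_le_mul_of_nonneg_right h3 (sq_nonneg s)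
  linarith

end Limits

/-! ### The adjoint relation and the symmetry of the Jacobi operator. -/

section Integrals

open scoped Classical
open Filter Topology

variable {P} [P.IsCrystallographic] (b : P.Base) {k : ι → ℝ}

lemma continuous_dirDeriv {p : Torus P → ℂ} (hp : p ∈ C2 P) (v : V) :
    Continuous (dirDeriv P v p) :=
  continuous_of_comp_proj P (contDiff_dirDeriv P (n := 1) v hp).continuous

lemma continuous_of_mem_C2 {u : Torus P → ℂ} (hu : u ∈ C2 P) : Continuous u :=
  continuous_of_comp_proj P ((mem_C2 P).1 hu).continuous

/-- The regularized Laplacian stays bounded when it is multiplied by a function that vanishes to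
second order on the walls. -/
lemma exists_bound_mul_laplacianT [P.IsRootSystem] (hk : ∀ i, 0 ≤ k i) {u p : Torus P → ℂ}
    (hp : p ∈ C2 P) {K : ℝ} (hu0 : ∀ t, ‖u t‖ ≤ K)
    (hu : ∀ i, k i ≠ 0 → ∀ h, ‖u (proj P h)‖ ≤ K * Real.sin (P.root' i h / 2) ^ 2) :
    ∃ C : ℝ, ∀ ε : ℝ, 0 < ε → ε ≤ 1 → ∀ t,
      ‖u t * laplacianT P (fun t => p t * (regState P b k ε t : ℂ)) t‖ ≤ C := by
  obtain ⟨Cp, hCp0, hCp⟩ := exists_bound_of_continuous P (continuous_of_mem_C2 hp)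
  obtain ⟨Cl, hCl0, hCl⟩ := exists_bound_of_continuous P (continuous_laplacianT P hp)
  choose Cd hCd0 hCd using fun i : ι =>
    exists_bound_of_continuous P (continuous_dirDeriv hp (dualVec P (P.root i)))
  have hK : 0 ≤ K := (norm_nonneg _).trans (hu0 0)
  have hu1 : ∀ i, k i ≠ 0 → ∀ h, ‖u (proj P h)‖ ≤ K * |Real.sin (P.root' i h / 2)| := by
    intro i hi h
    refine (hu i hi h).trans (mul_le_mul_of_nonneg_left ?_ hK)
    rw [← sq_abs]
    nlinarith [abs_nonneg (Real.sin (P.root' i h / 2)), Real.abs_sin_le_one (P.root' i h / 2)]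
  -- Cross terms have simple poles on two walls. Vanishing to order sin² on either wall gives the
  -- square of the smaller sine, which is at most the product.
  have hu2 : ∀ i j, k i ≠ 0 → k j ≠ 0 → ∀ h, ‖u (proj P h)‖ ≤
      K * (|Real.sin (P.root' i h / 2)| * |Real.sin (P.root' j h / 2)|) := by
    intro i j hi hj h
    rcases le_total |Real.sin (P.root' i h / 2)| |Real.sin (P.root' j h / 2)| with hle | hle
    · refine (hu i hi h).trans (mul_le_mul_of_nonneg_left ?_ hK)
      rw [← sq_abs, sq]
      exact mul_le_mul_of_nonneg_left hle (abs_nonneg _)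
    · refine (hu j hj h).trans (mul_le_mul_of_nonneg_left ?_ hK)
      rw [← sq_abs, sq]
      exact mul_le_mul_of_nonneg_right hle (abs_nonneg _)
  let B : ℝ := ∏ i with b.IsPos i, (2 : ℝ) ^ (k i / 2)
  refine ⟨B * (K * Cl + ∑ i with b.IsPos i, k i * K * Cd i + Cp *
    (∑ i with b.IsPos i, k i / 4 * (K * 3) * |gram P i i| +
      ∑ i with b.IsPos i, ∑ j with b.IsPos j, k i * k j / 4 * K * |gram P i j|)), ?_⟩
  intro ε hε hε1 t
  obtain ⟨h, rfl⟩ := proj_surjective P t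
  obtain ⟨hB0, hB⟩ := regState_bounds b hk hε hε1 (proj P h)
  have hBpos : 0 ≤ B := hB0.trans hB
  rw [laplacianT_mul_regState b k hε hp]
  have t2 : ∀ i, ‖u (proj P h)‖ * ‖((k i * regCot P ε i h : ℝ) : ℂ) *
      dirDeriv P (dualVec P (P.root i)) p (proj P h)‖ ≤ k i * K * Cd i := by
    intro i
    -- Roots with k = 0 drop out of the Laplacian, so u need not vanish on their walls.
    by_cases hi : k i = 0
    · simp [hi]
    · rw [norm_mul, Complex.norm_real, Real.norm_eq_abs, abs_mul, abs_of_nonneg (hk i)]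
      have h1 : ‖u (proj P h)‖ * |regCot P ε i h| ≤ K := by
        calc ‖u (proj P h)‖ * |regCot P ε i h|
            ≤ K * |Real.sin (P.root' i h / 2)| * |regCot P ε i h| :=
              mul_le_mul_of_nonneg_right (hu1 i hi h) (abs_nonneg _)
          _ = K * (|regCot P ε i h| * |Real.sin (P.root' i h / 2)|) := by ring
          _ ≤ K * 1 := mul_le_mul_of_nonneg_left (abs_regCot_mul_le hε i h) hK
          _ = K := mul_one K
      calc _ = k i * (‖u (proj P h)‖ * |regCot P ε i h|) *
            ‖dirDeriv P (dualVec P (P.root i)) p (proj P h)‖ := by ring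
        _ ≤ k i * K * Cd i := mul_le_mul (mul_le_mul_of_nonneg_left h1 (hk i)) (hCd i _)
            (norm_nonneg _) (mul_nonneg (hk i) hK)
  have t3 : ∀ i, ‖u (proj P h)‖ * |k i / 4 * regCotDeriv P ε i h * gram P i i| ≤
      k i / 4 * (K * 3) * |gram P i i| := by
    intro i
    by_cases hi : k i = 0
    · simp [hi]
    · rw [abs_mul, abs_mul, abs_of_nonneg (div_nonneg (hk i) (by norm_num : (0 : ℝ) ≤ 4))]
      have h1 : ‖u (proj P h)‖ * |regCotDeriv P ε i h| ≤ K * 3 := by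
        calc ‖u (proj P h)‖ * |regCotDeriv P ε i h|
            ≤ K * Real.sin (P.root' i h / 2) ^ 2 * |regCotDeriv P ε i h| :=
              mul_le_mul_of_nonneg_right (hu i hi h) (abs_nonneg _)
          _ = K * (|regCotDeriv P ε i h| * Real.sin (P.root' i h / 2) ^ 2) := by ring
          _ ≤ K * 3 := mul_le_mul_of_nonneg_left (abs_regCotDeriv_mul_le hε i h) hK
      calc _ = k i / 4 * (‖u (proj P h)‖ * |regCotDeriv P ε i h|) * |gram P i i| := by ring
        _ ≤ _ := mul_le_mul_of_nonneg_right (mul_le_mul_of_nonneg_left h1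
            (div_nonneg (hk i) (by norm_num))) (abs_nonneg _)
  have t4 : ∀ i j, ‖u (proj P h)‖ *
      |k i * k j / 4 * (regCot P ε i h * regCot P ε j h) * gram P i j| ≤
      k i * k j / 4 * K * |gram P i j| := by
    intro i j
    by_cases hi : k i = 0
    · simp [hi]
    by_cases hj : k j = 0
    · simp [hj]
    have hkk : 0 ≤ k i * k j / 4 := div_nonneg (mul_nonneg (hk i) (hk j)) (by norm_num)
    rw [abs_mul, abs_mul, abs_of_nonneg hkk, abs_mul]
    have h1 : ‖u (proj P h)‖ * (|regCot P ε i h| * |regCot P ε j h|) ≤ K := by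
      calc ‖u (proj P h)‖ * (|regCot P ε i h| * |regCot P ε j h|)
          ≤ K * (|Real.sin (P.root' i h / 2)| * |Real.sin (P.root' j h / 2)|) *
              (|regCot P ε i h| * |regCot P ε j h|) :=
            mul_le_mul_of_nonneg_right (hu2 i j hi hj h) (by positivity)
        _ = K * ((|regCot P ε i h| * |Real.sin (P.root' i h / 2)|) *
              (|regCot P ε j h| * |Real.sin (P.root' j h / 2)|)) := by ring
        _ ≤ K * 1 := mul_le_mul_of_nonneg_left (mul_le_one₀ (abs_regCot_mul_le hε i h)
            (by positivity) (abs_regCot_mul_le hε j h)) hK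
        _ = K := mul_one K
    calc _ = k i * k j / 4 * (‖u (proj P h)‖ * (|regCot P ε i h| * |regCot P ε j h|)) *
          |gram P i j| := by ring
      _ ≤ _ := mul_le_mul_of_nonneg_right (mul_le_mul_of_nonneg_left h1 hkk) (abs_nonneg _)
  rw [mul_left_comm, norm_mul, Complex.norm_real, Real.norm_eq_abs, abs_of_nonneg hB0]
  refine mul_le_mul hB ?_ (norm_nonneg _) hBpos
  rw [mul_add, mul_add]
  refine (norm_add₃_le).trans (add_le_add (add_le_add ?_ ?_) ?_)
  · rw [norm_mul]
    exact mul_le_mul (hu0 _) (hCl _) (norm_nonneg _) hK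
  · rw [Finset.mul_sum]
    refine (norm_sum_le _ _).trans (Finset.sum_le_sum fun i _ => ?_)
    rw [norm_mul]
    exact t2 i
  · rw [mul_left_comm, norm_mul]
    refine mul_le_mul (hCp _) ?_ (norm_nonneg _) hCp0
    rw [norm_mul, Complex.norm_real, Real.norm_eq_abs]
    refine (mul_le_mul_of_nonneg_left (abs_add_le _ _) (norm_nonneg _)).trans ?_
    rw [mul_add]
    refine add_le_add ?_ ?_
    · refine (mul_le_mul_of_nonneg_left (Finset.abs_sum_le_sum_abs _ _) (norm_nonneg _)).trans ?_
      rw [Finset.mul_sum]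
      exact Finset.sum_le_sum fun i _ => t3 i
    · refine (mul_le_mul_of_nonneg_left ((Finset.abs_sum_le_sum_abs _ _).trans
        (Finset.sum_le_sum fun i _ => Finset.abs_sum_le_sum_abs _ _)) (norm_nonneg _)).trans ?_
      rw [Finset.mul_sum]
      refine Finset.sum_le_sum fun i _ => ?_
      rw [Finset.mul_sum]
      exact Finset.sum_le_sum fun j _ => t4 i j

lemma exists_reg_seq : ∃ e : ℕ → ℝ, (∀ n, 0 < e n) ∧ (∀ n, e n ≤ 1) ∧ Tendsto e atTop (𝓝[>] 0) := by
  refine ⟨fun n => 1 / ((n : ℝ) + 1), fun n => by positivity, fun n => ?_, ?_⟩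
  · rw [div_le_one (by positivity)]
    have : (0 : ℝ) ≤ n := n.cast_nonneg
    linarith
  · exact tendsto_nhdsWithin_iff.2 ⟨tendsto_one_div_add_atTop_nhds_zero_nat,
      .of_forall fun n => Set.mem_Ioi.2 (by positivity)⟩

lemma ae_exists_regular [P.IsRootSystem] :
    ∀ᵐ t ∂haarT P, (∀ i, absSin P i t ≠ 0) ∧
      ∃ h, proj P h = t ∧ ∀ i, Real.sin (P.root' i h / 2) ≠ 0 := by
  filter_upwards [ae_absSin_ne_zero P] with t ht
  refine ⟨ht, ?_⟩
  obtain ⟨h, rfl⟩ := proj_surjective P t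
  exact ⟨h, rfl, fun i hi => ht i (by rw [absSin_proj, hi, abs_zero])⟩

variable [P.IsRootSystem] [P.IsReduced]
  (hinv : ∀ i x y, inner ℝ (P.coreflection i x) (P.coreflection i y) = inner ℝ x y)
  (hkr : ∀ i j, k (P.reflectionPerm i j) = k j) (hk : ∀ i, 0 ≤ k i)
include hinv hkr hk

/-- The weak form of `H (p Δ) = (L p) Δ`, where `L` is the Jacobi operator. -/
theorem integral_hamiltonianFun_mul {u p q : Torus P → ℂ} (hu : u ∈ C2 P) (hp : p ∈ C2 P)
    (hq : Continuous q)
    (hpq : ∀ h, (∀ i, Real.sin (P.root' i h / 2) ≠ 0) → q (proj P h) = jacobiOp b k p h)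
    {K : ℝ} (hu0 : ∀ t, ‖u t‖ ≤ K)
    (huv : ∀ i, k i ≠ 0 → ∀ h, ‖u (proj P h)‖ ≤ K * Real.sin (P.root' i h / 2) ^ 2) :
    ∫ t, hamiltonianFun P b k u t * (p t * groundState P b k t) ∂haarT P =
      ∫ t, u t * (q t * groundState P b k t) ∂haarT P := by
  obtain ⟨e, he0, he1, he⟩ := exists_reg_seq
  obtain ⟨C, hC⟩ := exists_bound_mul_laplacianT b hk hp hu0 huv
  have hcu := continuous_of_mem_C2 hu
  have hcp := continuous_of_mem_C2 hp
  have hcl := continuous_laplacianT P hu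
  have hcΔ : Continuous fun t => (groundState P b k t : ℂ) :=
    Complex.continuous_ofReal.comp (continuous_groundState b hk)
  have hcψ : ∀ n, (fun t => p t * (regState P b k (e n) t : ℂ)) ∈ C2 P := fun n =>
    mul_regState_mem_C2 b k (he0 n) hp
  -- The almost everywhere limit of u ∇²(pΔ_ε). As a limit of uniformly bounded functions it is
  -- integrable, although the potential in it is singular.
  let F : Torus P → ℂ := fun t =>
    u t * ((potential P b k t * p t - q t) * groundState P b k t)
  have hlimF : ∀ᵐ t ∂haarT P, Tendsto (fun n => u t *
      laplacianT P (fun t => p t * (regState P b k (e n) t : ℂ)) t) atTop (𝓝 (F t)) := by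
    filter_upwards [ae_exists_regular (P := P)] with t ht
    obtain ⟨-, h, rfl, hreg⟩ := ht
    have := (tendsto_laplacianT_mul_regState b k hinv hkr hp hreg).comp he
    rw [← hpq h hreg] at this
    exact this.const_mul _
  have hFm : AEStronglyMeasurable F (haarT P) := by
    have := measurable_potential b k
    have h1 : Measurable fun t => (potential P b k t : ℂ) := Complex.measurable_ofReal.comp this
    exact (hcu.measurable.mul (((h1.mul hcp.measurable).sub hq.measurable).mul
      hcΔ.measurable)).aestronglyMeasurable
  have hFb : ∀ᵐ t ∂haarT P, ‖F t‖ ≤ C := by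
    filter_upwards [hlimF] with t ht
    exact le_of_tendsto ht.norm (.of_forall fun n => hC _ (he0 n) (he1 n) t)
  have hFi : Integrable F (haarT P) := .of_bound hFm C hFb
  have hlim1 : Tendsto (fun n => ∫ t, u t *
      laplacianT P (fun t => p t * (regState P b k (e n) t : ℂ)) t ∂haarT P) atTop
      (𝓝 (∫ t, F t ∂haarT P)) :=
    tendsto_integral_of_dominated_convergence (fun _ => C)
      (fun n => (hcu.mul (continuous_laplacianT P (hcψ n))).aestronglyMeasurable)
      (integrable_const _) (fun n => .of_forall fun t => hC _ (he0 n) (he1 n) t) hlimF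
  have hlim2 : Tendsto (fun n => ∫ t, laplacianT P u t *
      (p t * (regState P b k (e n) t : ℂ)) ∂haarT P) atTop
      (𝓝 (∫ t, laplacianT P u t * (p t * groundState P b k t) ∂haarT P)) := by
    obtain ⟨Cl, hCl0, hCl⟩ := exists_bound_of_continuous P hcl
    obtain ⟨Cp, hCp0, hCp⟩ := exists_bound_of_continuous P hcp
    refine tendsto_integral_of_dominated_convergence
      (fun _ => Cl * (Cp * ∏ i with b.IsPos i, (2 : ℝ) ^ (k i / 2)))
      (fun n => (hcl.mul (continuous_of_mem_C2 (hcψ n))).aestronglyMeasurable)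
      (integrable_const _) (fun n => .of_forall fun t => ?_) ?_
    · obtain ⟨h0, h1⟩ := regState_bounds b hk (he0 n) (he1 n) t
      rw [norm_mul, norm_mul, Complex.norm_real, Real.norm_eq_abs, abs_of_nonneg h0]
      exact mul_le_mul (hCl t) (mul_le_mul (hCp t) h1 h0 hCp0) (by positivity) hCl0
    · filter_upwards [ae_exists_regular (P := P)] with t ht
      have := ((tendsto_regState b k ht.1).mono_left nhdsWithin_le_nhds).comp he
      exact (((Complex.continuous_ofReal.tendsto _).comp this).const_mul _).const_mul _
  -- Green's identity holds for each ε, since pΔ_ε is C²; the two sides converge separately.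
  have hEq : ∫ t, laplacianT P u t * (p t * groundState P b k t) ∂haarT P =
      ∫ t, F t ∂haarT P := by
    refine tendsto_nhds_unique hlim2 (hlim1.congr fun n => ?_)
    exact (integral_laplacianT_mul P hu (hcψ n)).symm
  have hi1 : Integrable (fun t => laplacianT P u t * (p t * groundState P b k t)) (haarT P) :=
    integrable_of_continuous P (hcl.mul (hcp.mul hcΔ))
  have hi2 : Integrable (fun t => u t * (q t * groundState P b k t)) (haarT P) :=
    integrable_of_continuous P (hcu.mul (hq.mul hcΔ))
  have hpt : ∀ t, hamiltonianFun P b k u t * (p t * groundState P b k t) =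
      F t + u t * (q t * groundState P b k t) -
        laplacianT P u t * (p t * groundState P b k t) := fun t => by
    simp only [hamiltonianFun, F]
    ring
  simp_rw [hpt]
  refine (integral_sub (hFi.add hi2) hi1).trans ?_
  refine (congrArg (· - _) (integral_add hFi hi2)).trans ?_
  rw [hEq]
  ring

/-- The Jacobi operator is symmetric for the weight `Δ²`. -/
theorem integral_jacobiOp_symm {p p' q q' : Torus P → ℂ} (hp : p ∈ C2 P) (hp' : p' ∈ C2 P)
    (hpq : ∀ h, (∀ i, Real.sin (P.root' i h / 2) ≠ 0) → q (proj P h) = jacobiOp b k p h)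
    (hpq' : ∀ h, (∀ i, Real.sin (P.root' i h / 2) ≠ 0) → q' (proj P h) = jacobiOp b k p' h)
    {r r' : ι → Torus P → ℂ} (hr : ∀ i, Continuous (r i)) (hr' : ∀ i, Continuous (r' i))
    (hpr : ∀ i h, Real.cos (P.root' i h / 2) * dirDeriv P (dualVec P (P.root i)) p (proj P h) =
      Real.sin (P.root' i h / 2) * r i (proj P h))
    (hpr' : ∀ i h, Real.cos (P.root' i h / 2) * dirDeriv P (dualVec P (P.root i)) p' (proj P h) =
      Real.sin (P.root' i h / 2) * r' i (proj P h))
    (hq : Continuous q) (hq' : Continuous q') :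
    ∫ t, (q t * groundState P b k t) * (p' t * groundState P b k t) ∂haarT P =
      ∫ t, (p t * groundState P b k t) * (q' t * groundState P b k t) ∂haarT P := by
  obtain ⟨e, he0, he1, he⟩ := exists_reg_seq
  have hcΔ : Continuous fun t => (groundState P b k t : ℂ) :=
    Complex.continuous_ofReal.comp (continuous_groundState b hk)
  -- Subtracting p ∇²Δ_ε removes the zeroth-order terms, the only ones with a double pole. In what
  -- is left, regCot · ∂_α p is sin²/(sin² + ε) times the continuous function r, hence bounded
  -- uniformly in ε.
  have main : ∀ {p p' q : Torus P → ℂ} {r : ι → Torus P → ℂ}, p ∈ C2 P → p' ∈ C2 P →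
      Continuous q → (∀ i, Continuous (r i)) →
      (∀ h, (∀ i, Real.sin (P.root' i h / 2) ≠ 0) → q (proj P h) = jacobiOp b k p h) →
      (∀ i h, Real.cos (P.root' i h / 2) * dirDeriv P (dualVec P (P.root i)) p (proj P h) =
        Real.sin (P.root' i h / 2) * r i (proj P h)) →
      Tendsto (fun n => ∫ t, (p' t * regState P b k (e n) t) *
        (laplacianT P (fun t => p t * (regState P b k (e n) t : ℂ)) t -
          p t * laplacianT P (fun t => 1 * (regState P b k (e n) t : ℂ)) t) ∂haarT P) atTop
        (𝓝 (-(∫ t, (q t * groundState P b k t) * (p' t * groundState P b k t) ∂haarT P) -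
          jacobiShift b k * ∫ t, p t * p' t * groundState P b k t ^ 2 ∂haarT P)) := by
    intro p p' q r hp hp' hq hr hpq hpr
    have h1C2 : (fun _ => 1 : Torus P → ℂ) ∈ C2 P := (mem_C2 P).2 contDiff_const
    have hcp := continuous_of_mem_C2 hp
    have hcp' := continuous_of_mem_C2 hp'
    have hd1 : ∀ v t, dirDeriv P v (fun _ => 1) t = 0 := fun v t => by
      obtain ⟨h, rfl⟩ := proj_surjective P t
      rw [dirDeriv_proj]; simp
    have hl1 : ∀ t, laplacianT P (fun _ => 1) t = 0 := fun t => by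
      rw [laplacianT_eq_sum P h1C2]
      refine Finset.sum_eq_zero fun i _ => ?_
      have : dirDeriv P (stdOrthonormalBasis ℝ V i) (fun _ => 1) = fun _ => 0 := funext (hd1 _)
      rw [this]
      obtain ⟨h, rfl⟩ := proj_surjective P t
      rw [dirDeriv_proj]; simp
    have hval : ∀ ε, 0 < ε → ∀ h, laplacianT P (fun t => p t * (regState P b k ε t : ℂ)) (proj P h) -
          p (proj P h) * laplacianT P (fun t => 1 * (regState P b k ε t : ℂ)) (proj P h) =
        regState P b k ε (proj P h) * (laplacianT P p (proj P h) +
        ∑ i with b.IsPos i, (k i * regCot P ε i h : ℝ) *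
          dirDeriv P (dualVec P (P.root i)) p (proj P h)) := fun ε hε h => by
      rw [laplacianT_mul_regState b k hε hp, laplacianT_mul_regState b k hε h1C2]
      simp only [hd1, hl1, mul_zero, Finset.sum_const_zero]
      ring
    obtain ⟨Cl, hCl0, hCl⟩ := exists_bound_of_continuous P (continuous_laplacianT P hp)
    obtain ⟨Cp, hCp0, hCp⟩ := exists_bound_of_continuous P hcp'
    choose Cr hCr0 hCr using fun i : ι => exists_bound_of_continuous P (hr i)
    have hcotr : ∀ ε, 0 < ε → ∀ i h, ‖((k i * regCot P ε i h : ℝ) : ℂ) *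
        dirDeriv P (dualVec P (P.root i)) p (proj P h)‖ ≤ k i * Cr i := by
      intro ε hε i h
      have hs : 0 < Real.sin (P.root' i h / 2) ^ 2 + ε := by positivity
      have : ((k i * regCot P ε i h : ℝ) : ℂ) * dirDeriv P (dualVec P (P.root i)) p (proj P h) =
          ((k i * (Real.sin (P.root' i h / 2) ^ 2 / (Real.sin (P.root' i h / 2) ^ 2 + ε)) : ℝ) : ℂ)
            * r i (proj P h) := by
        have h1 : ((k i * regCot P ε i h : ℝ) : ℂ) = ((k i * (Real.sin (P.root' i h / 2) /
            (Real.sin (P.root' i h / 2) ^ 2 + ε)) : ℝ) : ℂ) * Real.cos (P.root' i h / 2) := by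
          rw [← Complex.ofReal_mul, regCot]
          congr 1
          ring
        rw [h1, mul_assoc, hpr, ← mul_assoc, ← Complex.ofReal_mul]
        congr 2
        ring
      rw [this, norm_mul, Complex.norm_real, Real.norm_eq_abs, abs_mul, abs_of_nonneg (hk i),
        abs_of_nonneg (by positivity)]
      refine mul_le_mul ?_ (hCr i _) (norm_nonneg _) (hk i)
      refine mul_le_of_le_one_right (hk i) ?_
      rw [div_le_one hs]
      linarith
    let B : ℝ := ∏ i with b.IsPos i, (2 : ℝ) ^ (k i / 2)
    have hcψ : ∀ n, Continuous fun t => (p' t * (regState P b k (e n) t : ℂ)) := fun n =>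
      continuous_of_mem_C2 (mul_regState_mem_C2 b k (he0 n) hp')
    have hlim := tendsto_integral_of_dominated_convergence (μ := haarT P)
      (F := fun n t => (p' t * regState P b k (e n) t) *
        (laplacianT P (fun t => p t * (regState P b k (e n) t : ℂ)) t -
          p t * laplacianT P (fun t => 1 * (regState P b k (e n) t : ℂ)) t))
      (f := fun t => (p' t * groundState P b k t) * (groundState P b k t *
        (-q t - jacobiShift b k * p t)))
      (fun _ => (Cp * B) * (B * (Cl + ∑ i with b.IsPos i, k i * Cr i)))
      (fun n => ((hcψ n).mul ((continuous_laplacianT P (mul_regState_mem_C2 b k (he0 n) hp)).sub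
        (hcp.mul (continuous_laplacianT P (mul_regState_mem_C2 b k (he0 n)
          h1C2))))).aestronglyMeasurable)
      (integrable_const _) (fun n => .of_forall fun t => ?_) ?_
    · have hint : ∫ t, (p' t * groundState P b k t) * (groundState P b k t *
          (-q t - jacobiShift b k * p t)) ∂haarT P =
          -(∫ t, (q t * groundState P b k t) * (p' t * groundState P b k t) ∂haarT P) -
          jacobiShift b k * ∫ t, p t * p' t * groundState P b k t ^ 2 ∂haarT P := by
        have hi1 : Integrable (fun t => (q t * groundState P b k t) *
            (p' t * groundState P b k t)) (haarT P) :=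
          integrable_of_continuous P ((hq.mul hcΔ).mul (hcp'.mul hcΔ))
        have hi2 : Integrable (fun t => p t * p' t * (groundState P b k t : ℂ) ^ 2) (haarT P) :=
          integrable_of_continuous P ((hcp.mul hcp').mul (hcΔ.pow 2))
        rw [← integral_neg, ← integral_const_mul]
        refine Eq.trans ?_ (integral_sub hi1.neg (hi2.const_mul _))
        refine integral_congr_ae (.of_forall fun t => ?_)
        simp only
        ring
      rw [← hint]
      exact hlim
    · obtain ⟨h, rfl⟩ := proj_surjective P t
      obtain ⟨h0, h1⟩ := regState_bounds b hk (he0 n) (he1 n) (proj P h)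
      have hB0 : 0 ≤ B := h0.trans h1
      rw [hval _ (he0 n), norm_mul, norm_mul, norm_mul, Complex.norm_real, Real.norm_eq_abs,
        abs_of_nonneg h0]
      refine mul_le_mul (mul_le_mul (hCp _) h1 h0 hCp0) (mul_le_mul h1 ?_ (norm_nonneg _) hB0)
        (by positivity) (by positivity)
      refine (norm_add_le _ _).trans (add_le_add (hCl _) ((norm_sum_le _ _).trans ?_))
      exact Finset.sum_le_sum fun i _ => hcotr _ (he0 n) i h
    · filter_upwards [ae_exists_regular (P := P)] with t ht
      obtain ⟨hne, h, rfl, hreg⟩ := ht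
      have hst := (Complex.continuous_ofReal.tendsto _).comp
        (((tendsto_regState b k hne).mono_left nhdsWithin_le_nhds).comp he)
      have hc : ∀ i, Tendsto (fun n => ((k i * regCot P (e n) i h : ℝ) : ℂ)) atTop
          (𝓝 ((k i * cotHalf P i h : ℝ) : ℂ)) := fun i =>
        (Complex.continuous_ofReal.tendsto _).comp
          ((((tendsto_regCot (hreg i)).mono_left nhdsWithin_le_nhds).comp he).const_mul _)
      have hEq : -q (proj P h) - jacobiShift b k * p (proj P h) = laplacianT P p (proj P h) +
          ∑ i with b.IsPos i, (k i * cotHalf P i h : ℝ) *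
          dirDeriv P (dualVec P (P.root i)) p (proj P h) := by
        rw [hpq h hreg, jacobiOp]
        ring
      simp only [hval _ (he0 _), hEq]
      exact (hst.const_mul _).mul (hst.mul (tendsto_const_nhds.add
        (tendsto_finsetSum _ fun i _ => (hc i).mul_const _)))
  have hl1 := main hp hp' hq hr hpq hpr
  have hl2 := main hp' hp hq' hr' hpq' hpr'
  -- For each ε the integral is unchanged when p and p' are exchanged: Green's identity handles the
  -- main term, and the subtracted one is visibly symmetric. In the limit the shift term is
  -- symmetric too and cancels.
  have hEq := tendsto_nhds_unique hl1 (hl2.congr fun n => ?_)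
  · have hsw : ∫ t, p' t * p t * (groundState P b k t : ℂ) ^ 2 ∂haarT P =
        ∫ t, p t * p' t * (groundState P b k t : ℂ) ^ 2 ∂haarT P := by
      simp_rw [mul_comm (p' _) (p _)]
    rw [hsw] at hEq
    have h3 := neg_injective (sub_left_injective hEq)
    rw [h3]
    exact integral_congr_ae (.of_forall fun t => mul_comm _ _)
  · have hψ := mul_regState_mem_C2 b k (he0 n) hp
    have hψ' := mul_regState_mem_C2 b k (he0 n) hp'
    have hψ1 := mul_regState_mem_C2 b k (he0 n) (p := fun _ => 1) ((mem_C2 P).2 contDiff_const)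
    have hg := integral_laplacianT_mul P hψ hψ'
    have hc1 := (continuous_of_mem_C2 hψ).mul (continuous_laplacianT P hψ')
    have hc2 := (continuous_of_mem_C2 hψ').mul (continuous_laplacianT P hψ)
    have hc3 := (continuous_of_mem_C2 hψ).mul
      ((continuous_of_mem_C2 hp').mul (continuous_laplacianT P hψ1))
    have e1 : ∫ t, (p t * (regState P b k (e n) t : ℂ)) *
        (laplacianT P (fun t => p' t * (regState P b k (e n) t : ℂ)) t -
          p' t * laplacianT P (fun t => 1 * (regState P b k (e n) t : ℂ)) t) ∂haarT P =
        ∫ t, (p t * (regState P b k (e n) t : ℂ)) *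
          laplacianT P (fun t => p' t * (regState P b k (e n) t : ℂ)) t ∂haarT P -
        ∫ t, (p t * (regState P b k (e n) t : ℂ)) *
          (p' t * laplacianT P (fun t => 1 * (regState P b k (e n) t : ℂ)) t) ∂haarT P := by
      simp_rw [mul_sub]
      exact integral_sub (integrable_of_continuous P hc1) (integrable_of_continuous P hc3)
    have e2 : ∫ t, (p' t * (regState P b k (e n) t : ℂ)) *
        (laplacianT P (fun t => p t * (regState P b k (e n) t : ℂ)) t -
          p t * laplacianT P (fun t => 1 * (regState P b k (e n) t : ℂ)) t) ∂haarT P =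
        ∫ t, (p' t * (regState P b k (e n) t : ℂ)) *
          laplacianT P (fun t => p t * (regState P b k (e n) t : ℂ)) t ∂haarT P -
        ∫ t, (p t * (regState P b k (e n) t : ℂ)) *
          (p' t * laplacianT P (fun t => 1 * (regState P b k (e n) t : ℂ)) t) ∂haarT P := by
      refine Eq.trans ?_
        (integral_sub (integrable_of_continuous P hc2) (integrable_of_continuous P hc3))
      refine integral_congr_ae (.of_forall fun t => ?_)
      simp only
      ring
    rw [e1, e2, ← hg]
    congr 1
    exact integral_congr_ae (.of_forall fun t => mul_comm _ _)

end Integrals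

/-! ### A criterion for essential self-adjointness -/

section Criterion

open Filter Topology

variable {H : Type*} [NormedAddCommGroup H] [InnerProductSpace ℂ H]
  {A : H →ₗ.[ℂ] H}

/-- Symmetry makes ⟨Ax, x⟩ real, so for imaginary c the cross term has real part 0. This gives
injectivity of A + c and control of x by (A + c)x. -/
lemma norm_sq_add_smul_of_symmetric
    (hsymm : ∀ x y : A.domain, inner ℂ (A x) (y : H) = inner ℂ (x : H) (A y)) {c : ℂ}
    (hc : c.re = 0) (hc1 : ‖c‖ = 1) (x : A.domain) :
    ‖A x + c • (x : H)‖ ^ 2 = ‖A x‖ ^ 2 + ‖(x : H)‖ ^ 2 := by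
  have hreal : (inner ℂ (A x) (x : H) : ℂ).im = 0 := by
    have := hsymm x x
    rw [← inner_conj_symm (x : H)] at this
    have h2 := congrArg Complex.im this
    simp only [Complex.conj_im] at h2
    linarith
  rw [@norm_add_sq ℂ, inner_smul_right, norm_smul, hc1, one_mul]
  have : RCLike.re (c * inner ℂ (A x) (x : H)) = 0 := by
    change (c * inner ℂ (A x) (x : H)).re = 0
    rw [Complex.mul_re, hc, hreal]
    ring
  rw [this]
  ring

/-- On a finite-dimensional invariant subspace the injective map A + c is surjective. Thus the range
of A + c contains the whole domain and is dense when the domain is. -/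
lemma exists_apply_add_smul_eq
    (hsymm : ∀ x y : A.domain, inner ℂ (A x) (y : H) = inner ℂ (x : H) (A y))
    (hfin : ∀ x ∈ A.domain, ∃ E : Submodule ℂ H, FiniteDimensional ℂ E ∧ x ∈ E ∧
      ∃ hE : E ≤ A.domain, ∀ y (hy : y ∈ E), A ⟨y, hE hy⟩ ∈ E) {c : ℂ}
    (hc : c.re = 0) (hc1 : ‖c‖ = 1) {x : H} (hx : x ∈ A.domain) :
    ∃ y : A.domain, A y + c • (y : H) = x := by
  obtain ⟨E, hEf, hxE, hE, hAE⟩ := hfin x hx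
  let L : E →ₗ[ℂ] E :=
    ((A.toFun.comp (Submodule.inclusion hE)).codRestrict E fun y => hAE y y.2) + c • LinearMap.id
  have hL : ∀ y : E, ((L y : E) : H) = A ⟨y, hE y.2⟩ + c • (y : H) := fun y => rfl
  have hinj : Function.Injective L := by
    rw [injective_iff_map_eq_zero]
    intro y hy
    have h1 := norm_sq_add_smul_of_symmetric hsymm hc hc1 ⟨y, hE y.2⟩
    rw [← hL, hy] at h1
    simp only [ZeroMemClass.coe_zero, norm_zero] at h1
    have h2 : ‖(y : H)‖ = 0 := by nlinarith [sq_nonneg ‖A ⟨y, hE y.2⟩‖, sq_nonneg ‖(y : H)‖]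
    exact Subtype.ext (norm_eq_zero.1 h2)
  obtain ⟨y, hy⟩ := LinearMap.injective_iff_surjective.1 hinj ⟨x, hxE⟩
  exact ⟨⟨y, hE y.2⟩, by rw [← hL, hy]⟩

/-- A densely defined symmetric operator is essentially self-adjoint if its domain is a union of
finite-dimensional invariant subspaces. -/
theorem isEssentiallySelfAdjoint_of_invariant_finiteDimensional [CompleteSpace H]
    (hd : Dense (A.domain : Set H))
    (hsymm : ∀ x y : A.domain, inner ℂ (A x) (y : H) = inner ℂ (x : H) (A y))
    (hfin : ∀ x ∈ A.domain, ∃ E : Submodule ℂ H, FiniteDimensional ℂ E ∧ x ∈ E ∧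
      ∃ hE : E ≤ A.domain, ∀ y (hy : y ∈ E), A ⟨y, hE hy⟩ ∈ E) :
    IsEssentiallySelfAdjoint A := by
  have hle : A ≤ A.adjoint := LinearPMap.IsFormalAdjoint.le_adjoint hd hsymm
  have hclosable : A.IsClosable := (LinearPMap.adjoint_isClosed hd).isClosable.leIsClosable hle
  refine ⟨hd, hclosable, ?_⟩
  have hd' : Dense (A.closure.domain : Set H) := hd.mono (LinearPMap.le_closure A).1
  have hC : (A.closure.graph : Set (H × H)) = closure (A.graph : Set (H × H)) := by
    rw [← hclosable.graph_closure_eq_closure_graph, Submodule.topologicalClosure_coe]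
  have hG : ∀ p ∈ A.graph, ∀ q ∈ A.graph, inner ℂ p.2 q.1 = inner ℂ p.1 q.2 := by
    intro p hp q hq
    obtain ⟨x, hx1, hx2⟩ := (LinearPMap.mem_graph_iff A).1 hp
    obtain ⟨y, hy1, hy2⟩ := (LinearPMap.mem_graph_iff A).1 hq
    rw [← hx1, ← hx2, ← hy1, ← hy2]
    exact hsymm x y
  have hGC : ∀ p ∈ A.graph, ∀ q ∈ A.closure.graph, inner ℂ p.2 q.1 = inner ℂ p.1 q.2 := by
    intro p hp q hq
    have hcl : IsClosed {q : H × H | inner ℂ p.2 q.1 = inner ℂ p.1 q.2} :=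
      isClosed_eq (by fun_prop) (by fun_prop)
    have hq' : q ∈ closure (A.graph : Set (H × H)) := hC ▸ hq
    exact hcl.closure_subset_iff.2 (hG p hp) hq'
  have hCC : ∀ p ∈ A.closure.graph, ∀ q ∈ A.closure.graph,
      inner ℂ p.2 q.1 = inner ℂ p.1 q.2 := by
    intro p hp q hq
    have hcl : IsClosed {p : H × H | inner ℂ p.2 q.1 = inner ℂ p.1 q.2} :=
      isClosed_eq (by fun_prop) (by fun_prop)
    have hp' : p ∈ closure (A.graph : Set (H × H)) := hC ▸ hp
    exact hcl.closure_subset_iff.2 (fun p hp => hGC p hp q hq) hp'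
  -- Here (y, z) is in the graph of the adjoint. Solving (A + i)w_n = s_n with s_n → z + iy gives a
  -- Cauchy sequence whose limit x satisfies (Ā + i)x = z + iy, where Ā is the closure of A. Then y
  -- - x is orthogonal to the range of A - i, which contains the dense domain, so y = x.
  have hmain : ∀ y z : H, (∀ p ∈ A.graph, inner ℂ p.2 y = inner ℂ p.1 z) →
      (y, z) ∈ A.closure.graph := by
    intro y z hyz
    obtain ⟨s, hs, hlim⟩ := mem_closure_iff_seq_limit.1 (hd (z + Complex.I • y))
    choose w hw using fun n => exists_apply_add_smul_eq hsymm hfin (c := Complex.I)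
      (by simp) (by simp) (hs n)
    have hbound : ∀ u v : A.domain, dist (u : H) v ≤
        dist (A u + Complex.I • (u : H)) (A v + Complex.I • (v : H)) := by
      intro u v
      have h1 := norm_sq_add_smul_of_symmetric hsymm (c := Complex.I) (by simp) (by simp) (u - v)
      have h2 : A (u - v) + Complex.I • ((u - v : A.domain) : H) =
          A u + Complex.I • (u : H) - (A v + Complex.I • (v : H)) := by
        rw [LinearPMap.map_sub, Submodule.coe_sub, smul_sub]
        abel
      rw [h2] at h1
      rw [dist_eq_norm, dist_eq_norm]
      refine le_of_sq_le_sq ?_ (norm_nonneg _)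
      rw [h1, Submodule.coe_sub]
      nlinarith [sq_nonneg ‖A (u - v)‖]
    have hcauchy : CauchySeq fun n => (w n : H) := by
      refine Metric.cauchySeq_iff.2 fun ε hε => ?_
      obtain ⟨N, hN⟩ := Metric.cauchySeq_iff.1 hlim.cauchySeq ε hε
      refine ⟨N, fun m hm n hn => (hbound _ _).trans_lt ?_⟩
      rw [hw, hw]
      exact hN m hm n hn
    obtain ⟨x, hx⟩ := cauchySeq_tendsto_of_complete hcauchy
    have hAx : Tendsto (fun n => A (w n)) atTop (𝓝 (z + Complex.I • y - Complex.I • x)) := by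
      have := hlim.sub (hx.const_smul Complex.I)
      refine this.congr fun n => ?_
      rw [← hw n, add_sub_cancel_right]
    have hxC : (x, z + Complex.I • y - Complex.I • x) ∈ A.closure.graph := by
      change _ ∈ (A.closure.graph : Set (H × H))
      rw [hC]
      exact mem_closure_of_tendsto (hx.prodMk_nhds hAx)
        (.of_forall fun n => A.mem_graph (w n))
    have hdiff : ∀ p ∈ A.graph, inner ℂ (p.2 + (-Complex.I) • p.1) (y - x) = 0 := by
      intro p hp
      have h1 := hyz p hp
      have h2 := hGC p hp _ hxC
      simp only [inner_sub_right, inner_add_right, inner_smul_right, inner_add_left,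
        inner_smul_left, map_neg, Complex.conj_I, neg_neg] at h1 h2 ⊢
      rw [h1, h2]
      ring
    have hzero : y - x = 0 := by
      refine hd.eq_zero_of_inner_right ℂ fun v hv => ?_
      obtain ⟨u, hu⟩ := exists_apply_add_smul_eq hsymm hfin (c := -Complex.I) (by simp) (by simp) hv
      rw [← hu]
      exact hdiff _ (A.mem_graph u)
    have hyx : y = x := sub_eq_zero.1 hzero
    rw [hyx]
    rw [hyx, add_sub_cancel_right] at hxC
    exact hxC
  rw [LinearPMap.isSelfAdjoint_def]
  refine LinearPMap.eq_of_eq_graph ?_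
  rw [LinearPMap.adjoint_graph_eq_graph_adjoint hd']
  ext ⟨y, z⟩
  rw [Submodule.mem_adjoint_iff]
  constructor
  · intro h
    refine hmain y z fun p hp => ?_
    exact sub_eq_zero.1 (h p.1 p.2 (LinearPMap.le_graph_of_le (LinearPMap.le_closure A) hp))
  · intro h a c hac
    exact sub_eq_zero.2 (hCC _ hac _ h)

end Criterion

/-! ### Weyl invariance -/

lemma mem_invariants_of_coreflection {u : Torus P → ℂ}
    (hu : ∀ i h, u (proj P (P.coreflection i h)) = u (proj P h)) : u ∈ invariants P := by
  have key : ∀ w ∈ weyl P, ∀ h, u (proj P (w h)) = u (proj P h) := by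
    intro w hw
    induction hw using Subgroup.closure_induction with
    | mem x hx =>
      obtain ⟨i, rfl⟩ := hx
      exact hu i
    | one => exact fun h => rfl
    | mul x y _ _ hx hy => exact fun h => (hx (y h)).trans (hy h)
    | inv x _ hx =>
      intro h
      rw [← hx (x⁻¹ h)]
      congr 2
      exact x.apply_symm_apply h
  intro w t
  obtain ⟨h, rfl⟩ := proj_surjective P t
  rw [weylT_proj]
  exact key w w.2 h

lemma invariants_coreflection {u : Torus P → ℂ} (hu : u ∈ invariants P) (i : ι) (h : V) :
    u (proj P (P.coreflection i h)) = u (proj P h) :=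
  hu ⟨P.coreflection i, Subgroup.subset_closure ⟨i, rfl⟩⟩ (proj P h)

section Positive

open scoped Classical

variable {P} [P.IsCrystallographic] (b : P.Base)

lemma sum_eq_sum_pos_add_sum_pos {R : Type*} [AddCommMonoid R] {f : ι → R}
    (hf : ∀ i, f (P.reflectionPerm i i) = f i) :
    ∑ i, f i = (∑ i with b.IsPos i, f i) + ∑ i with b.IsPos i, f i :=
  prod_eq_sq_prod_pos b (R := Multiplicative R) (f := fun i => Multiplicative.ofAdd (f i))
    fun i => by rw [hf i]

lemma reflectionPerm_neg (i j : ι) :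
    P.reflectionPerm i (P.reflectionPerm j j) =
      P.reflectionPerm (P.reflectionPerm i j) (P.reflectionPerm i j) := by
  apply P.root.injective
  simp only [P.root_reflectionPerm, P.reflection_apply_self, map_neg]
  rw [← P.root_reflectionPerm, ← P.root_reflectionPerm, P.root_reflectionPerm _ (P.reflectionPerm i j),
    P.reflection_apply_self]

/-- A reflection need not preserve the positive roots, but for an even function the sum over them is
half the sum over all roots. Torsion-freeness permits the division by 2. -/
lemma sum_pos_reflectionPerm {R : Type*} [AddCommGroup R] [IsAddTorsionFree R] {f : ι → R}
    (hf : ∀ i, f (P.reflectionPerm i i) = f i) (j : ι) :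
    ∑ i with b.IsPos i, f (P.reflectionPerm j i) = ∑ i with b.IsPos i, f i := by
  have h1 := sum_eq_sum_pos_add_sum_pos b hf
  have h2 := sum_eq_sum_pos_add_sum_pos b (f := fun i => f (P.reflectionPerm j i)) fun i => by
    rw [reflectionPerm_neg, hf]
  rw [Equiv.sum_comp (P.reflectionPerm j) f, h1, ← two_nsmul, ← two_nsmul] at h2
  exact (nsmul_right_injective two_ne_zero h2).symm

/-- The multiplicative analogue, in which nonnegativity makes the square root unique. -/
lemma prod_pos_reflectionPerm {f : ι → ℝ} (hf0 : ∀ i, 0 ≤ f i)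
    (hf : ∀ i, f (P.reflectionPerm i i) = f i) (j : ι) :
    ∏ i with b.IsPos i, f (P.reflectionPerm j i) = ∏ i with b.IsPos i, f i := by
  have h1 := prod_eq_sq_prod_pos b hf
  have h2 := prod_eq_sq_prod_pos b (f := fun i => f (P.reflectionPerm j i)) fun i => by
    rw [reflectionPerm_neg, hf]
  rw [Equiv.prod_comp (P.reflectionPerm j) f, h1] at h2
  exact ((mul_self_inj (Finset.prod_nonneg fun i _ => hf0 _)
    (Finset.prod_nonneg fun i _ => hf0 _)).1 h2).symm

lemma absSin_coreflection (i j : ι) (h : V) :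
    absSin P i (proj P (P.coreflection j h)) = absSin P (P.reflectionPerm j i) (proj P h) := by
  rw [absSin_proj, absSin_proj, root'_reflectionPerm]

lemma absSin_neg (i : ι) (t : Torus P) : absSin P (P.reflectionPerm i i) t = absSin P i t := by
  obtain ⟨h, rfl⟩ := proj_surjective P t
  rw [absSin_proj, absSin_proj, root'_neg, neg_div, Real.sin_neg, abs_neg]

variable {k : ι → ℝ} (hkr : ∀ i j, k (P.reflectionPerm i j) = k j)

include hkr in
lemma groundState_coreflection (j : ι) (h : V) :
    groundState P b k (proj P (P.coreflection j h)) = groundState P b k (proj P h) := by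
  simp only [groundState, absSin_coreflection]
  rw [← prod_pos_reflectionPerm b (f := fun i => absSin P i (proj P h) ^ k i)
    (fun i => Real.rpow_nonneg (absSin_nonneg i _) _) (fun i => by rw [absSin_neg, hkr]) j]
  simp only [hkr]

include hkr in
lemma groundState_mem_invariants : (fun t => (groundState P b k t : ℂ)) ∈ invariants P :=
  mem_invariants_of_coreflection P fun i h => by rw [groundState_coreflection b hkr]

variable (hinv : ∀ i x y, inner ℝ (P.coreflection i x) (P.coreflection i y) = inner ℝ x y)

include hkr hinv in
lemma potential_mem_invariants : (fun t => (potential P b k t : ℂ)) ∈ invariants P := by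
  refine mem_invariants_of_coreflection P fun j h => ?_
  congr 1
  simp only [potential, potentialTerm, rootNormSq_eq_gram, absSin_coreflection]
  rw [← sum_pos_reflectionPerm b (f := fun i => k i * (k i - 1) * (gram P i i *
    (1 / (4 * absSin P i (proj P h) ^ 2) - 1 / 12)))
    (fun i => by rw [absSin_neg, hkr, gram_reflection hinv]) j]
  simp only [hkr, gram_reflection hinv]

end Positive

/-! ### Equivariance of the differential operators. -/

section Reflections

variable {P} (hinv : ∀ i x y, inner ℝ (P.coreflection i x) (P.coreflection i y) = inner ℝ x y)

/-- The reflection in a coroot, as a linear isometry. -/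
def coreflectionIsometry (i : ι) : V ≃ₗᵢ[ℝ] V :=
  (P.coreflection i).isometryOfInner (hinv i)

include hinv in
-- The Laplacian may be computed in any orthonormal basis. At the reflected point the reflected
-- basis is used, and the chain rule for f ∘ s = f matches the terms.
lemma laplacianT_mem_invariants {u : Torus P → ℂ} (hu : u ∈ C2 P) (hu' : u ∈ invariants P) :
    laplacianT P u ∈ invariants P := by
  refine mem_invariants_of_coreflection P fun i h => ?_
  let s := coreflectionIsometry hinv i
  let f : V → ℂ := fun h => u (proj P h)
  have hf : f ∘ s = f := funext fun h => invariants_coreflection P hu' i h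
  rw [laplacianT_proj, laplacianT_proj,
    congrFun (laplacian_eq_iteratedFDeriv_orthonormalBasis f ((stdOrthonormalBasis ℝ V).map s)) _,
    congrFun (laplacian_eq_iteratedFDeriv_stdOrthonormalBasis f) h]
  refine Finset.sum_congr rfl fun e _ => ?_
  conv_rhs => rw [← hf]
  rw [show f ∘ s = f ∘ (s.toContinuousLinearEquiv : V →L[ℝ] V) from rfl,
    ContinuousLinearMap.iteratedFDeriv_comp_right _ ((mem_C2 P).1 hu) _ le_rfl]
  simp only [ContinuousMultilinearMap.compContinuousLinearMap_apply, OrthonormalBasis.map_apply]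
  change iteratedFDeriv ℝ 2 f (s h) _ = iteratedFDeriv ℝ 2 f (s h) _
  congr 1
  ext j
  fin_cases j <;> rfl

include hinv in
lemma dirDeriv_coreflection {u : Torus P → ℂ} (hu : u ∈ C2 P) (hu' : u ∈ invariants P) (i : ι)
    (v h : V) : dirDeriv P v u (proj P (P.coreflection i h)) =
      dirDeriv P (P.coreflection i v) u (proj P h) := by
  let s := coreflectionIsometry hinv i
  let f : V → ℂ := fun h => u (proj P h)
  have hf : f ∘ s = f := funext fun h => invariants_coreflection P hu' i h
  have hd : Differentiable ℝ f := ((mem_C2 P).1 hu).differentiable (by norm_num)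
  rw [dirDeriv_proj, dirDeriv_proj]
  change fderiv ℝ f (s h) v = fderiv ℝ f h (s v)
  have := ((hd (s h)).hasFDerivAt.comp h s.toContinuousLinearEquiv.hasFDerivAt).fderiv
  have h2 : fderiv ℝ f h = (fderiv ℝ f (s h)).comp
      (s.toContinuousLinearEquiv : V →L[ℝ] V) := by
    conv_lhs => rw [← hf]
    exact this
  rw [h2]
  change _ = fderiv ℝ f (s h) (s (s v))
  congr 1
  exact (P.coreflection_same i v).symm

include hinv in
lemma hamiltonianFun_mem_invariants [P.IsCrystallographic] (b : P.Base) {k : ι → ℝ}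
    (hkr : ∀ i j, k (P.reflectionPerm i j) = k j) {u : Torus P → ℂ} (hu : u ∈ C2 P)
    (hu' : u ∈ invariants P) : hamiltonianFun P b k u ∈ invariants P := by
  intro w t
  have h1 := laplacianT_mem_invariants hinv hu hu' w t
  have h2 := potential_mem_invariants b hkr hinv w t
  simp only at h2
  rw [hamiltonianFun, hamiltonianFun, h1, h2, hu' w t]

end Reflections

/-! ### Exponential polynomials of bounded degree -/

/-- The span of the functions `e^λ` with `|λ| ≤ R`. -/
def expPolyLe (R : ℝ) : Submodule ℂ (Torus P → ℂ) :=
  Submodule.span ℂ (expWeight P '' {l | l ∈ weights P ∧ ‖dualVec P l‖ ≤ R})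

lemma expWeight_mem_expPolyLe {R : ℝ} {l : M} (hl : l ∈ weights P) (hR : ‖dualVec P l‖ ≤ R) :
    expWeight P l ∈ expPolyLe P R :=
  Submodule.subset_span ⟨l, ⟨hl, hR⟩, rfl⟩

lemma expPolyLe_mono {R S : ℝ} (h : R ≤ S) : expPolyLe P R ≤ expPolyLe P S :=
  Submodule.span_mono (Set.image_mono fun _ hl => ⟨hl.1, hl.2.trans h⟩)

lemma expPolyLe_le (R : ℝ) : expPolyLe P R ≤ expPoly P :=
  Submodule.span_mono (Set.image_mono fun _ hl => hl.1)

lemma exists_mem_expPolyLe {p : Torus P → ℂ} (hp : p ∈ expPoly P) : ∃ R, p ∈ expPolyLe P R := by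
  induction hp using Submodule.span_induction with
  | mem x hx =>
    obtain ⟨l, hl, rfl⟩ := hx
    exact ⟨_, expWeight_mem_expPolyLe P hl le_rfl⟩
  | zero => exact ⟨0, zero_mem _⟩
  | add x y _ _ hx hy =>
    obtain ⟨R, hR⟩ := hx
    obtain ⟨S, hS⟩ := hy
    exact ⟨max R S, add_mem (expPolyLe_mono P (le_max_left _ _) hR)
      (expPolyLe_mono P (le_max_right _ _) hS)⟩
  | smul c x _ hx =>
    obtain ⟨R, hR⟩ := hx
    exact ⟨R, Submodule.smul_mem _ c hR⟩

/-- A weight is determined by its integral values on the coroots, and |λ| ≤ R bounds the value at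
α^∨ by R‖α^∨‖. So only finitely many weights occur. -/
instance finiteDimensional_expPolyLe [P.IsRootSystem] (R : ℝ) :
    FiniteDimensional ℂ (expPolyLe P R) := by
  refine FiniteDimensional.span_of_finite ℂ (Set.Finite.image _ ?_)
  let F : M → ι → ℝ := fun l i => P.toLinearMap l (P.coroot i)
  have hF : Function.Injective F := by
    intro l m hlm
    apply P.toLinearMap.toPerfPair.injective
    have hs : Submodule.span ℝ (Set.range P.coroot) = ⊤ :=
      RootPairing.IsRootSystem.span_coroot_eq_top
    exact LinearMap.ext_on hs (by rintro _ ⟨i, rfl⟩; exact congrFun hlm i)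
  refine Set.Finite.of_finite_image (f := F) ?_ hF.injOn
  have hbox : (Set.pi Set.univ fun i : ι => (fun n : ℤ => (n : ℝ)) ''
      {n | |(n : ℝ)| ≤ R * ‖P.coroot i‖}).Finite := by
    refine Set.Finite.pi fun i : ι => Set.Finite.image _ ?_
    refine (Set.finite_Icc (-⌈R * ‖P.coroot i‖⌉) ⌈R * ‖P.coroot i‖⌉).subset fun n hn => ?_
    have h1 := (abs_le.1 (Set.mem_ofPred.1 hn))
    have h2 := Int.le_ceil (R * ‖P.coroot i‖)
    constructor
    · have : ((-⌈R * ‖P.coroot i‖⌉ : ℤ) : ℝ) ≤ n := by push_cast; linarith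
      exact_mod_cast this
    · have : (n : ℝ) ≤ (⌈R * ‖P.coroot i‖⌉ : ℤ) := by linarith
      exact_mod_cast this
  refine hbox.subset ?_
  rintro _ ⟨l, ⟨hl, hR⟩, rfl⟩ i -
  obtain ⟨n, hn⟩ := hl i
  refine ⟨n, ?_, hn.symm⟩
  simp only [Set.mem_ofPred]
  rw [← hn, ← inner_dualVec]
  exact (abs_real_inner_le_norm _ _).trans (mul_le_mul_of_nonneg_right hR (norm_nonneg _))

lemma expWeight_mem_C2 {l : M} (hl : l ∈ weights P) : expWeight P l ∈ C2 P := by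
  rw [mem_C2]
  simp_rw [expWeight_proj P hl]
  have : ContDiff ℝ 2 fun h : V => P.toLinearMap l h :=
    (LinearMap.toContinuousLinearMap (P.toLinearMap l)).contDiff
  exact (contDiff_const.mul (Complex.ofRealCLM.contDiff.comp this)).cexp

lemma expPoly_le_C2 : expPoly P ≤ C2 P :=
  Submodule.span_le.2 (by rintro _ ⟨l, hl, rfl⟩; exact expWeight_mem_C2 P hl)

lemma dirDeriv_expWeight {l : M} (hl : l ∈ weights P) (v : V) :
    dirDeriv P v (expWeight P l) = (Complex.I * (P.toLinearMap l v : ℝ)) • expWeight P l := by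
  funext t
  obtain ⟨h, rfl⟩ := proj_surjective P t
  rw [dirDeriv_proj]
  refine fderiv_apply_eq_of_hasDerivAt_line
    ((((mem_C2 P).1 (expWeight_mem_C2 P hl)).differentiable (by norm_num)) h) ?_
  have hl' : HasDerivAt (fun s : ℝ => P.toLinearMap l (h + s • v)) (P.toLinearMap l v) 0 := by
    simp_rw [map_add, map_smul]
    simpa using ((hasDerivAt_id (0 : ℝ)).smul_const (P.toLinearMap l v)).const_add
      (P.toLinearMap l h)
  simp_rw [expWeight_proj P hl]
  refine ((hl'.ofReal_comp.const_mul Complex.I).cexp).congr_deriv ?_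
  simp only [zero_smul, add_zero, Pi.smul_apply, smul_eq_mul, expWeight_proj P hl]
  ring

lemma dirDeriv_add {u w : Torus P → ℂ} (hu : u ∈ C2 P) (hw : w ∈ C2 P) (v : V) :
    dirDeriv P v (u + w) = dirDeriv P v u + dirDeriv P v w := by
  funext t
  obtain ⟨h, rfl⟩ := proj_surjective P t
  simp only [dirDeriv_proj, Pi.add_apply]
  rw [fderiv_fun_add ((((mem_C2 P).1 hu).differentiable (by norm_num)) h)
    ((((mem_C2 P).1 hw).differentiable (by norm_num)) h), add_apply]

lemma dirDeriv_smul {u : Torus P → ℂ} (hu : u ∈ C2 P) (c : ℂ) (v : V) :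
    dirDeriv P v (c • u) = c • dirDeriv P v u := by
  funext t
  obtain ⟨h, rfl⟩ := proj_surjective P t
  simp only [dirDeriv_proj, Pi.smul_apply]
  rw [fderiv_fun_const_smul ((((mem_C2 P).1 hu).differentiable (by norm_num)) h), smul_apply]

lemma dirDeriv_mem_expPolyLe {R : ℝ} {p : Torus P → ℂ} (hp : p ∈ expPolyLe P R) (v : V) :
    dirDeriv P v p ∈ expPolyLe P R := by
  have hC2 : expPolyLe P R ≤ C2 P := (expPolyLe_le P R).trans (expPoly_le_C2 P)
  induction hp using Submodule.span_induction with
  | mem x hx =>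
    obtain ⟨l, hl, rfl⟩ := hx
    rw [dirDeriv_expWeight P hl.1]
    exact Submodule.smul_mem _ _ (expWeight_mem_expPolyLe P hl.1 hl.2)
  | zero =>
    have := dirDeriv_smul P (zero_mem (C2 P)) 0 v
    rw [zero_smul, zero_smul] at this
    rw [this]
    exact zero_mem _
  | add x y hx' hy' hx hy =>
    rw [dirDeriv_add P (hC2 hx') (hC2 hy')]
    exact add_mem hx hy
  | smul c x hx' hx =>
    rw [dirDeriv_smul P (hC2 hx')]
    exact Submodule.smul_mem _ _ hx

lemma laplacianT_mem_expPolyLe {R : ℝ} {p : Torus P → ℂ} (hp : p ∈ expPolyLe P R) :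
    laplacianT P p ∈ expPolyLe P R := by
  have hC2 : expPolyLe P R ≤ C2 P := (expPolyLe_le P R).trans (expPoly_le_C2 P)
  have : laplacianT P p = ∑ i, dirDeriv P (stdOrthonormalBasis ℝ V i)
      (dirDeriv P (stdOrthonormalBasis ℝ V i) p) := by
    funext t
    rw [laplacianT_eq_sum P (hC2 hp), Finset.sum_apply]
  rw [this]
  exact Submodule.sum_mem _ fun i _ =>
    dirDeriv_mem_expPolyLe P (dirDeriv_mem_expPolyLe P hp _) _

/-! ### Root strings and the cotangent terms. -/

section RootStrings

variable {P} [P.IsCrystallographic]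

lemma root_mem_weights (i : ι) : P.root i ∈ weights P := fun j => by
  obtain ⟨n, hn⟩ := P.exists_value (S := ℤ) i j
  exact ⟨n, by simpa using hn.symm⟩

lemma sub_zsmul_root_mem_weights {l : M} (hl : l ∈ weights P) (i : ι) (m : ℤ) :
    l - m • P.root i ∈ weights P := fun j => by
  obtain ⟨n, hn⟩ := hl j
  obtain ⟨n', hn'⟩ := root_mem_weights (P := P) i j
  refine ⟨n - m * n', ?_⟩
  rw [map_sub, LinearMap.sub_apply, map_zsmul, LinearMap.smul_apply, hn, hn', zsmul_eq_mul]
  push_cast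
  ring

lemma reflection_eq_sub_zsmul {l : M} {i : ι} {n : ℤ}
    (hn : P.toLinearMap l (P.coroot i) = n) : P.reflection i l = l - n • P.root i := by
  rw [P.reflection_apply, LinearMap.flip_apply, hn, Int.cast_smul_eq_zsmul]

lemma reflection_mem_weights {l : M} (hl : l ∈ weights P) (i : ι) :
    P.reflection i l ∈ weights P := by
  obtain ⟨n, hn⟩ := hl i
  rw [reflection_eq_sub_zsmul hn]
  exact sub_zsmul_root_mem_weights hl i n

lemma expWeight_sub_zsmul {l : M} (hl : l ∈ weights P) (i : ι) (m : ℤ) (h : V) :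
    expWeight P (l - m • P.root i) (proj P h) =
      expWeight P l (proj P h) * Complex.exp (-Complex.I * (P.root' i h : ℝ)) ^ m := by
  rw [expWeight_proj P (sub_zsmul_root_mem_weights hl i m), expWeight_proj P hl,
    ← Complex.exp_int_mul, ← Complex.exp_add]
  congr 1
  rw [map_sub, LinearMap.sub_apply, map_zsmul, LinearMap.smul_apply, zsmul_eq_mul]
  push_cast
  ring

lemma expWeight_coreflection {l : M} (hl : l ∈ weights P) (i : ι) (h : V) :
    expWeight P l (proj P (P.coreflection i h)) = expWeight P (P.reflection i l) (proj P h) := by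
  rw [expWeight_proj P hl, expWeight_proj P (reflection_mem_weights hl i), toLinearMap_reflection]

variable (hinv : ∀ i x y, inner ℝ (P.coreflection i x) (P.coreflection i y) = inner ℝ x y)
include hinv

/-- The string member lies on the segment from λ to its reflection; both ends have the same norm,
and the norm is convex. -/
lemma norm_dualVec_string_le {l : M} {i : ι} {n : ℕ}
    (hn : P.toLinearMap l (P.coroot i) = n) {j : ℕ} (hj : j ≤ n) :
    ‖dualVec P (l - (j : ℤ) • P.root i)‖ ≤ ‖dualVec P l‖ := by
  rcases Nat.eq_zero_or_pos n with h0 | hpos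
  · have : j = 0 := by omega
    simp [this]
  have hn0 : (0 : ℝ) < n := by exact_mod_cast hpos
  have hn' : P.toLinearMap l (P.coroot i) = (n : ℤ) := by exact_mod_cast hn
  have hcomb : l - (j : ℤ) • P.root i =
      (1 - (j : ℝ) / n) • l + ((j : ℝ) / n) • P.reflection i l := by
    rw [reflection_eq_sub_zsmul hn', smul_sub, sub_smul, one_smul, ← Int.cast_smul_eq_zsmul ℝ,
      ← Int.cast_smul_eq_zsmul ℝ, smul_smul]
    have : (j : ℝ) / n * ((n : ℤ) : ℝ) = ((j : ℤ) : ℝ) := by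
      push_cast
      field_simp
    rw [this]
    abel
  have hjn : (j : ℝ) / n ≤ 1 := by
    rw [div_le_one hn0]
    exact_mod_cast hj
  rw [hcomb, dualVec_add, dualVec_smul, dualVec_smul]
  refine (norm_add_le _ _).trans ?_
  rw [norm_smul, norm_smul, norm_dualVec_reflection hinv, Real.norm_of_nonneg (by linarith),
    Real.norm_of_nonneg (by positivity)]
  exact le_of_eq (by ring)

/-- The operator `cot (α / 2) ∂_α` preserves the exponential polynomials, on functions that are
invariant under the reflection in `α`. -/
lemma exists_cot_mul_dirDeriv_expWeight {l : M} (hl : l ∈ weights P) (i : ι) :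
    ∃ r ∈ expPolyLe P ‖dualVec P l‖, ∀ h,
      Real.cos (P.root' i h / 2) * dirDeriv P (dualVec P (P.root i))
        (expWeight P l + expWeight P (P.reflection i l)) (proj P h) =
      Real.sin (P.root' i h / 2) * r (proj P h) := by
  have main : ∀ {l : M}, l ∈ weights P → ∀ n : ℕ, P.toLinearMap l (P.coroot i) = n →
      ∃ r ∈ expPolyLe P ‖dualVec P l‖, ∀ h,
      Real.cos (P.root' i h / 2) * dirDeriv P (dualVec P (P.root i))
        (expWeight P l + expWeight P (P.reflection i l)) (proj P h) =
      Real.sin (P.root' i h / 2) * r (proj P h) := by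
    intro l hl n hn
    -- With w = e^{-iα}, ∂_α(e^λ + e^{sλ}) is i⟨λ,α⟩ e^λ (1 - wⁿ), and cot(α/2)(1 - w) = i(1 + w).
    -- Factoring 1 - wⁿ as a geometric sum gives the stated sum over neighbouring members of the
    -- string.
    refine ⟨(Complex.I * (P.toLinearMap l (dualVec P (P.root i)) : ℝ) * Complex.I) •
      ∑ j ∈ Finset.range n, (expWeight P (l - (j : ℤ) • P.root i) +
        expWeight P (l - ((j + 1 : ℕ) : ℤ) • P.root i)), ?_, fun h => ?_⟩
    · refine Submodule.smul_mem _ _ (Submodule.sum_mem _ fun j hj => add_mem ?_ ?_)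
      · exact expWeight_mem_expPolyLe P (sub_zsmul_root_mem_weights hl i _)
          (norm_dualVec_string_le hinv hn (Finset.mem_range.1 hj).le)
      · exact expWeight_mem_expPolyLe P (sub_zsmul_root_mem_weights hl i _)
          (norm_dualVec_string_le hinv hn (Finset.mem_range.1 hj))
    · have hr := reflection_mem_weights hl i
      have hn' : P.toLinearMap l (P.coroot i) = (n : ℤ) := by exact_mod_cast hn
      rw [dirDeriv_add P (expWeight_mem_C2 P hl) (expWeight_mem_C2 P hr),
        dirDeriv_expWeight P hl, dirDeriv_expWeight P hr, toLinearMap_reflection_dualVec hinv,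
        reflection_eq_sub_zsmul hn']
      simp only [Pi.add_apply, Pi.smul_apply, Finset.sum_apply, smul_eq_mul,
        expWeight_sub_zsmul hl, zpow_natCast]
      set w := Complex.exp (-Complex.I * (P.root' i h : ℝ)) with hw
      set e := expWeight P l (proj P h)
      have hgeom : (∑ j ∈ Finset.range n, w ^ j) * (1 - w) = 1 - w ^ n := by
        have := geom_sum_mul w n
        linear_combination -this
      have hsum : ∑ j ∈ Finset.range n, (e * w ^ j + e * w ^ (j + 1)) =
          e * (1 + w) * ∑ j ∈ Finset.range n, w ^ j := by
        rw [Finset.mul_sum]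
        exact Finset.sum_congr rfl fun j _ => by ring
      rw [hsum]
      have htrig : Complex.I * (1 + w) * Real.sin (P.root' i h / 2) =
          Real.cos (P.root' i h / 2) * (1 - w) := by
        have hw2 : w = (Complex.cos ((P.root' i h / 2 : ℝ)) -
            Complex.sin ((P.root' i h / 2 : ℝ)) * Complex.I) ^ 2 := by
          have : w = Complex.exp (-((P.root' i h / 2 : ℝ) : ℂ) * Complex.I) ^ 2 := by
            rw [hw, ← Complex.exp_nat_mul]
            congr 1
            push_cast
            ring
          rw [this, Complex.exp_mul_I, Complex.cos_neg, Complex.sin_neg]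
          ring
        have hcs := Complex.sin_sq_add_cos_sq ((P.root' i h / 2 : ℝ) : ℂ)
        rw [hw2, Complex.ofReal_sin, Complex.ofReal_cos]
        set s := Complex.sin ((P.root' i h / 2 : ℝ) : ℂ)
        set c := Complex.cos ((P.root' i h / 2 : ℝ) : ℂ)
        linear_combination (-2 * c * s ^ 2 + s ^ 3 * Complex.I + s ^ 2 * c) * Complex.I_sq
          + (c - s * Complex.I) * hcs
      push_cast at htrig ⊢
      linear_combination (Complex.I * (P.toLinearMap l (dualVec P (P.root i)) : ℝ) * e *
        Complex.cos (P.root' i h / 2)) * (-hgeom) - (Complex.I *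
        (P.toLinearMap l (dualVec P (P.root i)) : ℝ) * e * ∑ j ∈ Finset.range n, w ^ j) * htrig
  obtain ⟨n, hn⟩ := hl i
  -- The expression is symmetric in λ and sλ, so a negative pairing reduces to a positive one by
  -- starting from sλ.
  rcases le_total 0 n with h0 | h0
  · obtain ⟨m, rfl⟩ := Int.eq_ofNat_of_zero_le h0
    exact main hl m (by exact_mod_cast hn)
  · obtain ⟨m, hm⟩ := Int.eq_ofNat_of_zero_le (neg_nonneg.2 h0)
    have hr := reflection_mem_weights hl i
    have hm' : P.toLinearMap (P.reflection i l) (P.coroot i) = m := by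
      rw [toLinearMap_reflection, P.coreflection_apply_self, map_neg, hn]
      exact_mod_cast hm
    have := main hr m hm'
    rw [P.reflection_same, norm_dualVec_reflection hinv] at this
    rw [add_comm]
    exact this

/-- Invariance of p does not pass to the exponentials in its expansion. The span induction therefore
treats p + p ∘ s for arbitrary p, which is 2p in the invariant case. -/
lemma exists_cot_mul_dirDeriv {R : ℝ} {p : Torus P → ℂ} (hp : p ∈ expPolyLe P R)
    (hpW : p ∈ invariants P) (i : ι) :
    ∃ r ∈ expPolyLe P R, ∀ h,
      Real.cos (P.root' i h / 2) * dirDeriv P (dualVec P (P.root i)) p (proj P h) =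
      Real.sin (P.root' i h / 2) * r (proj P h) := by
  have hC2 : expPolyLe P R ≤ C2 P := (expPolyLe_le P R).trans (expPoly_le_C2 P)
  have key : ∃ p' ∈ expPolyLe P R, (∀ h, p' (proj P h) = p (proj P (P.coreflection i h))) ∧
      ∃ r ∈ expPolyLe P R, ∀ h,
      Real.cos (P.root' i h / 2) * dirDeriv P (dualVec P (P.root i)) (p + p') (proj P h) =
      Real.sin (P.root' i h / 2) * r (proj P h) := by
    clear hpW
    induction hp using Submodule.span_induction with
    | mem x hx =>
      obtain ⟨l, hl, rfl⟩ := hx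
      obtain ⟨r, hr, hr'⟩ := exists_cot_mul_dirDeriv_expWeight hinv hl.1 i
      exact ⟨_, expWeight_mem_expPolyLe P (reflection_mem_weights hl.1 i)
        ((norm_dualVec_reflection hinv i l).le.trans hl.2),
        fun h => (expWeight_coreflection hl.1 i h).symm, r, expPolyLe_mono P hl.2 hr, hr'⟩
    | zero =>
      refine ⟨0, zero_mem _, fun _ => rfl, 0, zero_mem _, fun h => ?_⟩
      have := dirDeriv_smul P (zero_mem (C2 P)) 0 (dualVec P (P.root i))
      rw [zero_smul, zero_smul] at this
      rw [add_zero, this]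
      simp
    | add x y hx' hy' hx hy =>
      obtain ⟨x', hx1, hx2, r, hr, hr'⟩ := hx
      obtain ⟨y', hy1, hy2, r₂, hr₂, hr₂'⟩ := hy
      refine ⟨x' + y', add_mem hx1 hy1, fun h => by simp [hx2, hy2], r + r₂, add_mem hr hr₂,
        fun h => ?_⟩
      rw [add_add_add_comm, dirDeriv_add P (add_mem (hC2 hx') (hC2 hx1))
        (add_mem (hC2 hy') (hC2 hy1)), Pi.add_apply, Pi.add_apply, mul_add, mul_add, hr', hr₂']
    | smul c x hx' hx =>
      obtain ⟨x', hx1, hx2, r, hr, hr'⟩ := hx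
      refine ⟨c • x', Submodule.smul_mem _ c hx1, fun h => by simp [hx2], c • r,
        Submodule.smul_mem _ c hr, fun h => ?_⟩
      rw [← smul_add, dirDeriv_smul P (add_mem (hC2 hx') (hC2 hx1)), Pi.smul_apply, Pi.smul_apply,
        smul_eq_mul, smul_eq_mul, mul_left_comm, hr', mul_left_comm]
  obtain ⟨p', -, hp', r, hr, hr'⟩ := key
  have hpp : p' = p := by
    funext t
    obtain ⟨h, rfl⟩ := proj_surjective P t
    rw [hp', invariants_coreflection P hpW]
  refine ⟨(2⁻¹ : ℂ) • r, Submodule.smul_mem _ _ hr, fun h => ?_⟩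
  have h1 := hr' h
  rw [hpp, dirDeriv_add P (hC2 hp) (hC2 hp), Pi.add_apply] at h1
  rw [Pi.smul_apply, smul_eq_mul]
  linear_combination (2⁻¹ : ℂ) * h1

end RootStrings

/-! ### The Jacobi operator on invariant exponential polynomials. -/

section JacobiOperator

open scoped Classical

variable {P} [P.IsCrystallographic] [P.IsRootSystem] (b : P.Base)
  (hinv : ∀ i x y, inner ℝ (P.coreflection i x) (P.coreflection i y) = inner ℝ x y)
  {k : ι → ℝ} (hkr : ∀ i j, k (P.reflectionPerm i j) = k j)
include hinv hkr

lemma jacobiOp_coreflection {p : Torus P → ℂ} (hp : p ∈ C2 P) (hpW : p ∈ invariants P) (j : ι)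
    (h : V) : jacobiOp b k p (P.coreflection j h) = jacobiOp b k p h := by
  have h1 := invariants_coreflection P (laplacianT_mem_invariants hinv hp hpW) j h
  rw [jacobiOp, jacobiOp, h1, invariants_coreflection P hpW]
  congr 2
  rw [← sum_pos_reflectionPerm b (f := fun i => ((k i * cotHalf P i h : ℝ) : ℂ) *
    dirDeriv P (dualVec P (P.root i)) p (proj P h)) (fun i => ?_) j]
  · refine Finset.sum_congr rfl fun i _ => ?_
    rw [hkr, cotHalf_reflectionPerm, dirDeriv_coreflection hinv hp hpW, P.root_reflectionPerm,
      dualVec_reflection hinv]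
  · rw [hkr, cotHalf_neg, dualVec_neg_root, dirDeriv_proj, dirDeriv_proj, map_neg]
    push_cast
    ring

/-- The Jacobi operator maps the invariant exponential polynomials of bounded degree to
themselves. -/
lemma exists_jacobiOp_eq {R : ℝ} {p : Torus P → ℂ} (hp : p ∈ expPolyLe P R)
    (hpW : p ∈ invariants P) :
    ∃ q ∈ expPolyLe P R ⊓ invariants P,
      ∀ h, (∀ i, Real.sin (P.root' i h / 2) ≠ 0) → q (proj P h) = jacobiOp b k p h := by
  have hC2 : expPolyLe P R ≤ C2 P := (expPolyLe_le P R).trans (expPoly_le_C2 P)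
  choose r hr hr' using fun i => exists_cot_mul_dirDeriv hinv hp hpW i
  let q : Torus P → ℂ := -laplacianT P p - ∑ i with b.IsPos i, (k i : ℂ) • r i -
    (jacobiShift b k : ℂ) • p
  have hq : q ∈ expPolyLe P R :=
    sub_mem (sub_mem (neg_mem (laplacianT_mem_expPolyLe P hp))
      (Submodule.sum_mem _ fun i _ => Submodule.smul_mem _ _ (hr i))) (Submodule.smul_mem _ _ hp)
  have hval : ∀ h, (∀ i, Real.sin (P.root' i h / 2) ≠ 0) → q (proj P h) = jacobiOp b k p h := by
    intro h hreg
    simp only [q, jacobiOp, Pi.sub_apply, Pi.neg_apply, Finset.sum_apply, Pi.smul_apply, smul_eq_mul]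
    congr 2
    refine Finset.sum_congr rfl fun i _ => ?_
    have h1 := hr' i h
    have h2 : (Real.sin (P.root' i h / 2) : ℂ) ≠ 0 := by exact_mod_cast hreg i
    rw [cotHalf]
    push_cast at h1 h2 ⊢
    field_simp
    linear_combination (-(k i : ℂ)) * h1
  refine ⟨q, ⟨hq, mem_invariants_of_coreflection P fun j h => ?_⟩, hval⟩
  have hcq := continuous_of_mem_C2 (hC2 hq)
  let w : weyl P := ⟨P.coreflection j, Subgroup.subset_closure ⟨j, rfl⟩⟩
  -- Invariance of q is checked at regular points, where q is the Jacobi operator applied to p.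
  -- These have full measure and q is continuous, so it extends everywhere.
  have hae : (fun t => q (weylT P w t)) =ᵐ[haarT P] q := by
    filter_upwards [ae_exists_regular (P := P)] with t ht
    obtain ⟨-, h, rfl, hreg⟩ := ht
    rw [weylT_proj]
    change q (proj P (P.coreflection j h)) = _
    rw [hval h hreg, hval _ fun i => ?_, jacobiOp_coreflection b hinv hkr (hC2 hp) hpW]
    rw [← root'_reflectionPerm]
    exact hreg _
  exact congrFun ((Continuous.ae_eq_iff_eq (haarT P) (hcq.comp (continuous_weylT P w)) hcq).1 hae)
    (proj P h)

end JacobiOperator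

/-! ### Vanishing on the walls -/

section Walls

open scoped Classical
open Filter Topology

variable {P}

lemma exists_sub_two_pi_abs_le (y : ℝ) : ∃ n : ℤ, |y - n * (2 * Real.pi)| ≤ Real.pi := by
  have hpi := Real.pi_pos
  refine ⟨round (y / (2 * Real.pi)), ?_⟩
  have h := abs_sub_round (y / (2 * Real.pi))
  have : y - round (y / (2 * Real.pi)) * (2 * Real.pi) =
      (y / (2 * Real.pi) - round (y / (2 * Real.pi))) * (2 * Real.pi) := by
    field_simp
  rw [this, abs_mul, abs_of_pos (by positivity : 0 < 2 * Real.pi)]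
  nlinarith

lemma sin_half_sq_sub (y : ℝ) (n : ℤ) :
    Real.sin (y / 2) ^ 2 = Real.sin ((y - n * (2 * Real.pi)) / 2) ^ 2 := by
  have : (y - n * (2 * Real.pi)) / 2 = y / 2 - n * Real.pi := by ring
  rw [this, Real.sin_sub_int_mul_pi, mul_pow]
  rcases Int.even_or_odd n with h | h <;> simp [h.neg_one_zpow]

lemma root'_half_coroot (i : ι) : P.root' i ((2⁻¹ : ℝ) • P.coroot i) = 1 := by
  rw [map_smul, P.root'_coroot_eq_pairing, P.pairing_same]
  norm_num

/-- An invariant `C²` function that vanishes on a wall vanishes there to second order. -/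
lemma exists_bound_of_eq_zero_on_wall [P.IsRootSystem] {u : Torus P → ℂ} (hu : u ∈ C2 P)
    (hW : u ∈ invariants P) (i : ι)
    (hz : ∀ h, Real.sin (P.root' i h / 2) = 0 → u (proj P h) = 0) :
    ∃ K : ℝ, ∀ h, ‖u (proj P h)‖ ≤ K * Real.sin (P.root' i h / 2) ^ 2 := by
  let w : V := (2⁻¹ : ℝ) • P.coroot i
  have hrw : P.root' i w = 1 := root'_half_coroot i
  have hu1 : ContDiff ℝ 1 fun h => u (proj P h) := ((mem_C2 P).1 hu).of_le (by norm_num)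
  have hu2 := contDiff_dirDeriv P (n := 1) w hu
  obtain ⟨C, hC0, hC⟩ := exists_bound_of_continuous P
    (continuous_of_comp_proj P (contDiff_dirDeriv P (n := 0) w hu2).continuous)
  refine ⟨C * Real.pi ^ 2, fun h => ?_⟩
  -- The vector α^∨/2 has α-slope 1. Moving along it by at most π reaches a wall at h₀, and this
  -- range is the one in which |sin(x/2)| ≥ |x|/π.
  obtain ⟨n, hn⟩ := exists_sub_two_pi_abs_le (P.root' i h)
  set x : ℝ := P.root' i h - n * (2 * Real.pi) with hx
  let h₀ : V := h - x • w
  have hh₀ : P.root' i h₀ = n * (2 * Real.pi) := by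
    simp only [h₀, map_sub, map_smul, hrw, hx, smul_eq_mul]
    ring
  let φ : ℝ → ℂ := fun s => u (proj P h₀ + proj P (s • w))
  let φ' : ℝ → ℂ := fun s => dirDeriv P w u (proj P h₀ + proj P (s • w))
  have hφ : ∀ s, HasDerivAt φ (φ' s) s := hasDerivAt_line P hu1 w _
  have hφ' : ∀ s, HasDerivAt φ' (dirDeriv P w (dirDeriv P w u) (proj P h₀ + proj P (s • w))) s :=
    hasDerivAt_line P hu2 w _
  have hφ0 : φ 0 = 0 := by
    simp only [φ, zero_smul, map_zero, add_zero]
    refine hz _ ?_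
    rw [hh₀, Real.sin_eq_zero_iff]
    exact ⟨n, by ring⟩
  -- As α(h₀) = 2πn, the reflection sends h₀ - s w to h₀ + s w up to n · 2πα^∨, an element of the
  -- lattice. So the restriction of u to this line is even and its derivative at the wall is 0.
  have heven : ∀ s, φ (-s) = φ s := by
    intro s
    simp only [φ, ← map_add]
    rw [← invariants_coreflection P hW i]
    congr 1
    rw [proj_eq_iff]
    have : h₀ + s • w - P.coreflection i (h₀ + -s • w) = n • ((2 * Real.pi) • P.coroot i) := by
      rw [P.coreflection_apply, map_add, map_smul, hrw, hh₀, ← Int.cast_smul_eq_zsmul ℝ]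
      simp only [w]
      module
    rw [this]
    exact AddSubgroup.zsmul_mem _ (AddSubgroup.subset_closure (Set.mem_range_self i)) n
  have hφ'0 : φ' 0 = 0 := by
    have h1 : HasDerivAt (fun s => φ (-s)) (-φ' 0) 0 := by
      have := (hφ (-0)).scomp (0 : ℝ) (hasDerivAt_neg (0 : ℝ))
      simpa using! this
    simp_rw [heven] at h1
    have h2 := h1.unique (hφ 0)
    linear_combination (-(1 / 2 : ℂ)) * h2
  have hb1 : ∀ s, ‖φ' s‖ ≤ C * |s| := by
    intro s
    have := convex_univ.norm_image_sub_le_of_norm_hasDerivWithin_le (f := φ') (C := C)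
      (fun s _ => (hφ' s).hasDerivWithinAt) (fun s _ => hC _) (Set.mem_univ 0) (Set.mem_univ s)
    simpa [hφ'0] using this
  have hb2 : ‖φ x‖ ≤ C * |x| * |x| := by
    have := (convex_uIcc (0 : ℝ) x).norm_image_sub_le_of_norm_hasDerivWithin_le (f := φ)
      (C := C * |x|) (fun s _ => (hφ s).hasDerivWithinAt) (fun s hs => (hb1 s).trans
        (mul_le_mul_of_nonneg_left ?_ hC0)) Set.left_mem_uIcc Set.right_mem_uIcc
    · simpa [hφ0] using this
    · simpa using Set.abs_sub_left_of_mem_uIcc hs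
  have hφx : φ x = u (proj P h) := by
    simp only [φ, h₀, ← map_add, sub_add_cancel]
  have hs : |x| / Real.pi ≤ |Real.sin (x / 2)| := by
    have := Real.mul_abs_le_abs_sin (x := x / 2) (by rw [abs_div, abs_two]; linarith)
    rw [abs_div, abs_two] at this
    refine le_trans (le_of_eq ?_) this
    field_simp
  rw [← hφx, sin_half_sq_sub _ n, ← hx, ← sq_abs (Real.sin (x / 2))]
  have hpi := Real.pi_pos
  have hs2 : |x| * |x| ≤ Real.pi ^ 2 * |Real.sin (x / 2)| ^ 2 := by
    rw [div_le_iff₀ hpi] at hs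
    have := mul_self_le_mul_self (abs_nonneg x) hs
    linarith
  calc ‖φ x‖ ≤ C * (|x| * |x|) := by linarith
    _ ≤ C * (Real.pi ^ 2 * |Real.sin (x / 2)| ^ 2) := mul_le_mul_of_nonneg_left hs2 hC0
    _ = _ := by ring

/-- A function with an inverse square singularity on a wall is not integrable. -/
lemma not_integrable_of_singular_on_wall [P.IsRootSystem] {f : Torus P → ℂ} (hf : Measurable f)
    {i : ι} {h₀ : V} (h0 : Real.sin (P.root' i h₀ / 2) = 0) {δ : ℝ} (hδ : 0 < δ)
    (hfδ : ∀ᶠ h in 𝓝 h₀, Real.sin (P.root' i h / 2) ≠ 0 →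
      δ ≤ ‖f (proj P h)‖ * Real.sin (P.root' i h / 2) ^ 2) :
    ¬ Integrable f (haarT P) := by
  intro hint
  let w : V := (2⁻¹ : ℝ) • P.coroot i
  have hrw : P.root' i w = 1 := root'_half_coroot i
  obtain ⟨n, hn⟩ := Real.sin_eq_zero_iff.1 h0
  -- Integrability holds only on almost every line, and the line through h₀ may be exceptional. A
  -- set of full measure is dense, so there is a good line starting near h₀, crossing the wall at a
  -- parameter s₀ near 0.
  have hdense := Measure.dense_of_ae (ae_integrableOn_line P hf hint w)
  have hroot : Continuous (P.root' i) := (P.root' i).continuous_of_finiteDimensional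
  have hcont : Continuous fun p : V × ℝ => p.1 + p.2 • w := by fun_prop
  have h1 : ∀ᶠ p : V × ℝ in 𝓝 (h₀, 0), Real.sin (P.root' i (p.1 + p.2 • w) / 2) ≠ 0 →
      δ ≤ ‖f (proj P (p.1 + p.2 • w))‖ * Real.sin (P.root' i (p.1 + p.2 • w) / 2) ^ 2 := by
    have := hcont.tendsto (h₀, 0)
    simp only [zero_smul, add_zero] at this
    exact this.eventually hfδ
  rw [nhds_prod_eq] at h1
  obtain ⟨pa, hpa, pb, hpb, hab⟩ := eventually_prod_iff.1 h1
  obtain ⟨η, hη, hηb⟩ := Metric.eventually_nhds_iff.1 hpb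
  have h2 : ∀ᶠ h in 𝓝 h₀, |P.root' i h - n * (2 * Real.pi)| < min η 1 := by
    have hc : Continuous fun h => |P.root' i h - n * (2 * Real.pi)| := by fun_prop
    refine hc.continuousAt.eventually (gt_mem_nhds ?_ |> fun h => h)
    have : P.root' i h₀ - n * (2 * Real.pi) = 0 := by linarith
    change |_| < _
    rw [this, abs_zero]
    exact lt_min hη one_pos
  obtain ⟨U, hU, hUo, hhU⟩ := eventually_nhds_iff.1 (hpa.and h2)
  obtain ⟨t, htU, ht⟩ := hdense.inter_open_nonempty _ (isOpenMap_proj P U hUo)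
    ⟨_, Set.mem_image_of_mem _ hhU⟩
  obtain ⟨h, hh, rfl⟩ := htU
  obtain ⟨hpah, hhn⟩ := hU h hh
  set s₀ : ℝ := -(P.root' i h - n * (2 * Real.pi)) with hs₀
  have hs₀η : |s₀| < η := by rw [hs₀, abs_neg]; exact hhn.trans_le (min_le_left _ _)
  have hs₀1 : |s₀| < 1 := by rw [hs₀, abs_neg]; exact hhn.trans_le (min_le_right _ _)
  have hsin : ∀ s : ℝ, Real.sin (P.root' i (h + s • w) / 2) ^ 2 = Real.sin ((s - s₀) / 2) ^ 2 := by
    intro s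
    rw [sin_half_sq_sub _ n, map_add, map_smul, hrw, hs₀]
    congr 3
    simp only [smul_eq_mul]
    ring
  refine not_intervalIntegrable_of_sub_inv_isBigO_punctured
    (f := fun s : ℝ => f (proj P h + proj P (s • w))) (a := -1) (b := 1) (c := s₀) ?_ (by norm_num)
    ?_ ?_
  -- Since sin²((s - s₀)/2) ≤ |s - s₀|²/4, the norm of f is at least 4δ/|s - s₀|². With |s - s₀| < 2
  -- this is at least 2δ/|s - s₀|, which is not integrable.
  · refine Asymptotics.IsBigO.of_bound (1 / (2 * δ)) ?_
    have hev : ∀ᶠ s in 𝓝[≠] s₀, |s| < min η 1 := by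
      refine nhdsWithin_le_nhds ((continuous_abs.tendsto s₀).eventually (gt_mem_nhds ?_))
      exact lt_min hs₀η hs₀1
    filter_upwards [hev, self_mem_nhdsWithin] with s hs hne
    have hs1 : |s - s₀| < 2 := by
      have := abs_sub s s₀
      have := hs.trans_le (min_le_right _ _)
      linarith
    have hs0 : 0 < |s - s₀| := abs_pos.2 (sub_ne_zero.2 hne)
    have hsne : Real.sin ((s - s₀) / 2) ≠ 0 := by
      refine mt (Real.sin_eq_zero_iff_of_lt_of_lt ?_ ?_).1
        (div_ne_zero (sub_ne_zero.2 hne) two_ne_zero)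
      · have := (abs_lt.1 hs1).1; have := Real.pi_gt_three; linarith
      · have := (abs_lt.1 hs1).2; have := Real.pi_gt_three; linarith
    have key := hab hpah (hηb (y := s) (by
      rw [Real.dist_eq, sub_zero]; exact hs.trans_le (min_le_left _ _)))
    simp only at key
    have hne' : Real.sin (P.root' i (h + s • w) / 2) ≠ 0 := by
      intro hc
      have := hsin s
      rw [hc] at this
      exact hsne (by simpa using this.symm)
    have key := key hne'
    rw [hsin s, map_add] at key
    have hsb : Real.sin ((s - s₀) / 2) ^ 2 ≤ |s - s₀| ^ 2 / 4 := by
      have := Real.abs_sin_le_abs (x := (s - s₀) / 2)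
      rw [abs_div, abs_two] at this
      rw [← sq_abs (Real.sin _)]
      have h3 := mul_self_le_mul_self (abs_nonneg _) this
      nlinarith
    rw [norm_inv, Real.norm_eq_abs]
    have hN := norm_nonneg (f (proj P h + proj P (s • w)))
    have h4 : δ ≤ ‖f (proj P h + proj P (s • w))‖ * (|s - s₀| ^ 2 / 4) :=
      key.trans (mul_le_mul_of_nonneg_left hsb hN)
    rw [inv_le_iff_one_le_mul₀ hs0, div_mul_eq_mul_div, one_mul, div_mul_eq_mul_div,
      one_le_div (by positivity)]
    nlinarith [mul_nonneg hN hs0.le]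
  · rw [Set.uIcc_of_le (by norm_num)]
    exact ⟨(abs_lt.1 hs₀1).1.le, (abs_lt.1 hs₀1).2.le⟩
  · rw [intervalIntegrable_iff_integrableOn_Icc_of_le (by norm_num)]
    exact ht

lemma gram_self_pos (i : ι) : 0 < gram P i i := by
  rw [gram, real_inner_self_eq_norm_sq]
  refine pow_pos (norm_pos_iff.2 fun h => ?_) 2
  have h1 := inner_dualVec P (P.root i) (P.coroot i)
  rw [h, inner_zero_left, P.root_coroot_two] at h1
  norm_num at h1

variable [P.IsCrystallographic] [P.IsRootSystem] [P.IsReduced] (b : P.Base)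

/-- Near a point of the wall on no other wall, sin² times the potential is continuous with nonzero
value c_i |α_i|²/4, so u ≠ 0 there would leave a nonintegrable inverse square. Such points are dense
in the wall. General coefficients c allow both a single term and the total potential. -/
lemma eq_zero_on_wall_of_integrable {u : Torus P → ℂ} (hu : Continuous u) {c : ι → ℝ} {i : ι}
    (hi : b.IsPos i) (hci : c i ≠ 0)
    (hint : Integrable (fun t => ((∑ j with b.IsPos j, c j * potentialTerm P j t : ℝ) : ℂ) * u t)
      (haarT P)) {h₀ : V} (h0 : Real.sin (P.root' i h₀ / 2) = 0) : u (proj P h₀) = 0 := by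
  have hroot : ∀ j, Continuous (P.root' j) := fun j => (P.root' j).continuous_of_finiteDimensional
  have hup : Continuous fun h => u (proj P h) := hu.comp (continuous_proj P)
  have hmeas : Measurable fun t => ((∑ j with b.IsPos j, c j * potentialTerm P j t : ℝ) : ℂ) * u t :=
    (Complex.measurable_ofReal.comp (Finset.measurable_sum _ fun j _ =>
      (measurable_potentialTerm j).const_mul _)).mul hu.measurable
  -- generic points of the wall
  have hgen : ∀ h, Real.sin (P.root' i h / 2) = 0 →
      (∀ j, b.IsPos j → j ≠ i → Real.sin (P.root' j h / 2) ≠ 0) → u (proj P h) = 0 := by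
    intro h h0 hj
    by_contra hne
    let F : V → ℝ := fun x => c i * gram P i i * (1 / 4 - Real.sin (P.root' i x / 2) ^ 2 / 12) +
      Real.sin (P.root' i x / 2) ^ 2 * ∑ j with b.IsPos j ∧ j ≠ i,
        c j * (gram P j j * (1 / (4 * Real.sin (P.root' j x / 2) ^ 2) - 1 / 12))
    have hF : ContinuousAt F h := by
      have hs : ∀ j, ContinuousAt (fun x => Real.sin (P.root' j x / 2) ^ 2) h := fun j => by
        have := hroot j
        exact Continuous.continuousAt (by fun_prop)
      refine ContinuousAt.add ?_ ((hs i).mul ?_)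
      · exact continuousAt_const.mul (continuousAt_const.sub ((hs i).div_const _))
      · refine tendsto_finsetSum _ fun j hj' => ?_
        have hjj := (Finset.mem_filter.1 hj').2
        have hsj := hj j hjj.1 hjj.2
        have : ContinuousAt (fun x => c j * (gram P j j *
            (1 / (4 * Real.sin (P.root' j x / 2) ^ 2) - 1 / 12))) h :=
          continuousAt_const.mul (continuousAt_const.mul
            ((continuousAt_const.div (continuousAt_const.mul (hs j))
              (mul_ne_zero four_ne_zero (pow_ne_zero 2 hsj))).sub
              continuousAt_const))
        exact this
    have hF0 : F h ≠ 0 := by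
      simp only [F, h0]
      have := (gram_self_pos (P := P) i).ne'
      norm_num
      exact ⟨hci, this⟩
    have hpos : 0 < ‖F h‖ * ‖u (proj P h)‖ :=
      mul_pos (norm_pos_iff.2 hF0) (norm_pos_iff.2 hne)
    have hev : ∀ᶠ x in 𝓝 h, ‖F h‖ * ‖u (proj P h)‖ / 2 < ‖F x‖ * ‖u (proj P x)‖ :=
      (hF.norm.mul hup.norm.continuousAt).eventually (lt_mem_nhds (by
        simp only [Pi.mul_apply]
        linarith))
    refine not_integrable_of_singular_on_wall hmeas h0 (half_pos hpos) ?_ hint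
    filter_upwards [hev] with x hx hsx
    refine hx.le.trans (le_of_eq ?_)
    rw [norm_mul, mul_right_comm, Complex.norm_real, ← Real.norm_of_nonneg (sq_nonneg (Real.sin _)),
      ← norm_mul]
    congr 2
    have hsplit : Finset.univ.filter b.IsPos =
        insert i (Finset.univ.filter fun j => b.IsPos j ∧ j ≠ i) := by
      ext j
      simp only [Finset.mem_filter, Finset.mem_univ, true_and, Finset.mem_insert]
      by_cases hji : j = i
      · simp [hji, hi]
      · simp [hji]
    rw [hsplit, Finset.sum_insert (by simp)]
    simp only [F, potentialTerm, rootNormSq_eq_gram, absSin_proj, sq_abs]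
    rw [add_mul, mul_comm (Real.sin _ ^ 2)]
    congr 1
    field_simp
  -- the other points of the wall
  let φ : {j // b.IsPos j ∧ j ≠ i} → Module.Dual ℝ V := fun j =>
    (1 : ℝ) • P.root' j + (-(P.pairing j i / 2)) • P.root' i
  obtain ⟨w, hw⟩ := Module.Dual.exists_forall_ne_zero_of_forall_exists φ fun j =>
    exists_combination_ne_zero j.2.2 (ne_neg_of_isPos b j.2.1 hi) one_ne_zero
  -- The component of `w` along the wall: `φ j` annihilates α_i^∨, so α_j(z) = φ_j(w) ≠ 0. Moving in
  -- the direction z stays on the wall and leaves all other walls except at countably many times.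
  let z : V := w - (P.root' i w / 2) • P.coroot i
  have hzi : P.root' i z = 0 := by
    simp only [z, map_sub, map_smul, P.root'_coroot_eq_pairing, P.pairing_same, smul_eq_mul]
    ring
  have hzj : ∀ j : {j // b.IsPos j ∧ j ≠ i}, P.root' j z ≠ 0 := fun j => by
    have := hw j
    simp only [φ, LinearMap.add_apply, LinearMap.smul_apply, smul_eq_mul] at this
    simp only [z, map_sub, map_smul, P.root'_coroot_eq_pairing, smul_eq_mul]
    intro h
    exact this (by linear_combination h)
  have hcount : (⋃ (j : {j // b.IsPos j ∧ j ≠ i}) (m : ℤ),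
      {τ : ℝ | P.root' j (h₀ + τ • z) / 2 = m * Real.pi}).Countable := by
    refine Set.countable_iUnion fun j => Set.countable_iUnion fun m => ?_
    refine Set.Subsingleton.countable fun s hs t ht => ?_
    simp only [Set.mem_ofPred_eq, map_add, map_smul, smul_eq_mul] at hs ht
    exact mul_right_cancel₀ (hzj j) (by linarith)
  have hclosed : IsClosed {τ : ℝ | u (proj P (h₀ + τ • z)) = 0} :=
    isClosed_eq (hup.comp (by fun_prop)) continuous_const
  have hsub : (⋃ (j : {j // b.IsPos j ∧ j ≠ i}) (m : ℤ),
      {τ : ℝ | P.root' j (h₀ + τ • z) / 2 = m * Real.pi})ᶜ ⊆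
      {τ : ℝ | u (proj P (h₀ + τ • z)) = 0} := fun τ hτ => by
    refine hgen _ ?_ fun j hj hji hsin => hτ ?_
    · rw [map_add, map_smul, hzi, smul_zero, add_zero, h0]
    · obtain ⟨m, hm⟩ := Real.sin_eq_zero_iff.1 hsin
      simp only [Set.mem_iUnion]
      exact ⟨⟨j, hj, hji⟩, m, hm.symm⟩
  have := hclosed.closure_subset_iff.2 hsub ((hcount.dense_compl ℝ) 0)
  simpa using this

/-- The functions in the domain of the Hamiltonian vanish to second order on the walls with
`k ≠ 0`, as soon as they vanish there. -/
lemma exists_uniform_bound {u : Torus P → ℂ} (hu : u ∈ C2 P) (hW : u ∈ invariants P) {k : ι → ℝ}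
    (hkr : ∀ i j, k (P.reflectionPerm i j) = k j)
    (hz : ∀ i, b.IsPos i → k i ≠ 0 → ∀ h, Real.sin (P.root' i h / 2) = 0 → u (proj P h) = 0) :
    ∃ K : ℝ, (∀ t, ‖u t‖ ≤ K) ∧
      ∀ i, k i ≠ 0 → ∀ h, ‖u (proj P h)‖ ≤ K * Real.sin (P.root' i h / 2) ^ 2 := by
  have hex : ∀ i, ∃ K : ℝ, k i ≠ 0 → ∀ h, ‖u (proj P h)‖ ≤ K * Real.sin (P.root' i h / 2) ^ 2 := by
    intro i
    by_cases hki : k i = 0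
    · exact ⟨0, fun h => absurd hki h⟩
    · obtain ⟨K, hK⟩ := exists_bound_of_eq_zero_on_wall hu hW i fun h hh => by
        by_cases hi : b.IsPos i
        · exact hz i hi hki h hh
        · refine hz _ ((isPos_neg_iff b i).2 hi) (by rwa [hkr]) h ?_
          rw [root'_neg, neg_div, Real.sin_neg, hh, neg_zero]
      exact ⟨K, fun _ => hK⟩
  choose K hK using hex
  obtain ⟨C, hC0, hC⟩ := exists_bound_of_continuous P (continuous_of_mem_C2 hu)
  refine ⟨C + ∑ i, |K i|, fun t => (hC t).trans (le_add_of_nonneg_right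
    (Finset.sum_nonneg fun i _ => abs_nonneg _)), fun i hi h => (hK i hi h).trans
    (mul_le_mul_of_nonneg_right ?_ (sq_nonneg _))⟩
  have : |K i| ≤ ∑ i, |K i| :=
    Finset.single_le_sum (f := fun i => |K i|) (fun i _ => abs_nonneg _) (Finset.mem_univ i)
  have := le_abs_self (K i)
  linarith

end Walls

/-! ### Density of the exponential polynomials -/

section Density

open scoped ComplexConjugate

lemma expWeight_zero : expWeight P 0 = 1 := by
  funext t
  obtain ⟨h, rfl⟩ := proj_surjective P t
  rw [expWeight_proj P (fun i => ⟨0, by simp⟩)]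
  simp

lemma add_mem_weights {l m : M} (hl : l ∈ weights P) (hm : m ∈ weights P) : l + m ∈ weights P := by
  intro i
  obtain ⟨a, ha⟩ := hl i
  obtain ⟨c, hc⟩ := hm i
  exact ⟨a + c, by simp [ha, hc]⟩

lemma neg_mem_weights {l : M} (hl : l ∈ weights P) : -l ∈ weights P := by
  intro i
  obtain ⟨a, ha⟩ := hl i
  exact ⟨-a, by simp [ha]⟩

lemma expWeight_mul {l m : M} (hl : l ∈ weights P) (hm : m ∈ weights P) :
    expWeight P l * expWeight P m = expWeight P (l + m) := by
  funext t
  obtain ⟨h, rfl⟩ := proj_surjective P t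
  rw [Pi.mul_apply, expWeight_proj P hl, expWeight_proj P hm,
    expWeight_proj P (add_mem_weights P hl hm), ← Complex.exp_add]
  congr 1
  simp
  ring

lemma star_expWeight {l : M} (hl : l ∈ weights P) : star (expWeight P l) = expWeight P (-l) := by
  funext t
  obtain ⟨h, rfl⟩ := proj_surjective P t
  rw [Pi.star_apply, expWeight_proj P hl, expWeight_proj P (neg_mem_weights P hl), Complex.star_def,
    ← Complex.exp_conj]
  simp

lemma one_mem_expPoly : (1 : Torus P → ℂ) ∈ expPoly P :=
  Submodule.subset_span ⟨0, fun i => ⟨0, by simp⟩, expWeight_zero P⟩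

lemma mul_mem_expPoly {p q : Torus P → ℂ} (hp : p ∈ expPoly P) (hq : q ∈ expPoly P) :
    p * q ∈ expPoly P := by
  induction hp, hq using Submodule.span_induction₂ with
  | mem_mem x y hx hy =>
    obtain ⟨l, hl, rfl⟩ := hx
    obtain ⟨m, hm, rfl⟩ := hy
    rw [expWeight_mul P hl hm]
    exact Submodule.subset_span ⟨_, add_mem_weights P hl hm, rfl⟩
  | zero_left y _ => rw [zero_mul]; exact zero_mem _
  | zero_right x _ => rw [mul_zero]; exact zero_mem _
  | add_left x y z _ _ _ h1 h2 => rw [add_mul]; exact add_mem h1 h2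
  | add_right x y z _ _ _ h1 h2 => rw [mul_add]; exact add_mem h1 h2
  | smul_left c x y _ _ h => rw [smul_mul_assoc]; exact Submodule.smul_mem _ _ h
  | smul_right c x y _ _ h => rw [mul_smul_comm]; exact Submodule.smul_mem _ _ h

lemma star_mem_expPoly {p : Torus P → ℂ} (hp : p ∈ expPoly P) : star p ∈ expPoly P := by
  induction hp using Submodule.span_induction with
  | mem x hx =>
    obtain ⟨l, hl, rfl⟩ := hx
    rw [star_expWeight P hl]
    exact Submodule.subset_span ⟨_, neg_mem_weights P hl, rfl⟩
  | zero => rw [star_zero]; exact zero_mem _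
  | add x y _ _ hx hy => rw [star_add]; exact add_mem hx hy
  | smul c x _ hx => rw [star_smul]; exact Submodule.smul_mem _ _ hx

/-- The exponential polynomials, as an algebra of continuous functions. -/
def expPolyAlgebra : StarSubalgebra ℂ C(Torus P, ℂ) where
  carrier := {f | ⇑f ∈ expPoly P}
  mul_mem' hf hg := mul_mem_expPoly P hf hg
  add_mem' hf hg := (expPoly P).add_mem hf hg
  algebraMap_mem' c := by
    have := Submodule.smul_mem _ c (one_mem_expPoly P)
    simpa [Algebra.algebraMap_eq_smul_one] using this
  star_mem' hf := star_mem_expPoly P hf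

variable [P.IsRootSystem] [P.IsCrystallographic] [P.IsReduced] (b : P.Base)

include b in
/-- The characters of the torus that are given by weights separate points. -/
lemma eq_of_forall_expWeight_eq {s t : Torus P}
    (hst : ∀ l ∈ weights P, expWeight P l s = expWeight P l t) : s = t := by
  obtain ⟨x, rfl⟩ := proj_surjective P s
  obtain ⟨y, rfl⟩ := proj_surjective P t
  rw [proj_eq_iff]
  let B := b.toCoweightBasis
  -- The coordinates in the basis of simple coroots are the fundamental weights. They are integral
  -- on all coroots, so equality of characters puts the coordinates of y - x in 2πℤ, and hence y - x
  -- in the lattice.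
  have hint : ∀ i, ∃ n : ℤ, B.coord i (y - x) = n * (2 * Real.pi) := by
    intro i
    obtain ⟨l, hl⟩ := P.toLinearMap.toPerfPair.surjective (B.coord i)
    have hl' : ∀ z, P.toLinearMap l z = B.coord i z := fun z => LinearMap.congr_fun hl z
    have hw : l ∈ weights P := by
      intro j
      rw [hl']
      have hj := b.coroot_mem_span_int j
      generalize P.coroot j = z at hj
      induction hj using Submodule.span_induction with
      | mem z hz =>
        obtain ⟨m, hm, rfl⟩ := hz
        have := b.toCoweightBasis_repr_coroot ⟨m, hm⟩
        rw [Module.Basis.coord_apply, this]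
        classical
        rw [Finsupp.single_apply]
        split_ifs
        · exact ⟨1, by simp⟩
        · exact ⟨0, by simp⟩
      | zero => exact ⟨0, by simp⟩
      | add z z' _ _ h h' =>
        obtain ⟨m, hm⟩ := h
        obtain ⟨n, hn⟩ := h'
        exact ⟨m + n, by rw [map_add, hm, hn, Int.cast_add]⟩
      | smul c z _ h =>
        obtain ⟨m, hm⟩ := h
        exact ⟨c * m, by rw [map_zsmul, hm]; simp⟩
    have h1 := hst l hw
    rw [expWeight_proj P hw, expWeight_proj P hw, Complex.exp_eq_exp_iff_exists_int] at h1
    obtain ⟨n, hn⟩ := h1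
    refine ⟨-n, ?_⟩
    have h2 : ((P.toLinearMap l x : ℝ) : ℂ) = (P.toLinearMap l y + n * (2 * Real.pi) : ℝ) := by
      apply mul_left_cancel₀ Complex.I_ne_zero
      rw [hn]
      push_cast
      ring
    have h3 := Complex.ofReal_injective h2
    rw [map_sub, ← hl', ← hl', h3]
    push_cast
    ring
  choose n hn using hint
  rw [← B.sum_repr (y - x)]
  refine AddSubgroup.sum_mem _ fun i _ => ?_
  have : B.repr (y - x) i • B i = n i • ((2 * Real.pi) • P.coroot i) := by
    have := hn i
    rw [Module.Basis.coord_apply] at this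
    rw [this, b.toCoweightBasis_apply, ← Int.cast_smul_eq_zsmul ℝ, smul_smul]
  rw [this]
  exact AddSubgroup.zsmul_mem _ (AddSubgroup.subset_closure (Set.mem_range_self _)) _

include b in
lemma t2Space_torus : T2Space (Torus P) := by
  refine T2Space.of_injective_continuous (Y := weights P → ℂ) (f := fun t l => expWeight P l t)
    (fun s t h => eq_of_forall_expWeight_eq P b fun l hl => congrFun h ⟨l, hl⟩)
    (continuous_pi fun l => continuous_of_mem_C2 (expWeight_mem_C2 P l.2))

include b in
-- Stone–Weierstrass, with separation of points supplied by the weights.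
lemma expPolyAlgebra_topologicalClosure : (expPolyAlgebra P).topologicalClosure = ⊤ := by
  refine ContinuousMap.starSubalgebra_topologicalClosure_eq_top_of_separatesPoints _ ?_
  intro s t hst
  by_contra hcon
  push Not at hcon
  refine hst (eq_of_forall_expWeight_eq P b fun l hl => ?_)
  let f : C(Torus P, ℂ) := ⟨expWeight P l, continuous_of_mem_C2 (expWeight_mem_C2 P hl)⟩
  have hf : f ∈ expPolyAlgebra P :=
    show expWeight P l ∈ expPoly P from Submodule.subset_span ⟨l, hl, rfl⟩
  exact hcon f ⟨f, hf, rfl⟩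

include b in
/-- A square integrable function whose Fourier coefficients vanish is zero. -/
lemma ae_eq_zero_of_forall_integral_mul_eq_zero {G : Torus P → ℂ} (hG : MemLp G 2 (haarT P))
    (h : ∀ p ∈ expPoly P, ∫ t, G t * p t ∂haarT P = 0) : G =ᵐ[haarT P] 0 := by
  have := t2Space_torus P b
  let g : Lp ℂ 2 (haarT P) := hG.star.toLp
  have hg : g =ᵐ[haarT P] star G := hG.star.coeFn_toLp
  have hinner : ∀ f : C(Torus P, ℂ),
      inner ℂ g (ContinuousMap.toLp 2 (haarT P) ℂ f) = ∫ t, G t * f t ∂haarT P := by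
    intro f
    rw [L2.inner_def]
    refine integral_congr_ae ?_
    filter_upwards [hg, ContinuousMap.coeFn_toLp (p := 2) (𝕜 := ℂ) (haarT P) f] with t h1 h2
    rw [h1, h2, RCLike.inner_apply]
    simp [mul_comm]
  have hzero : ∀ f : C(Torus P, ℂ), inner ℂ g (ContinuousMap.toLp 2 (haarT P) ℂ f) = 0 := by
    have hclosed : IsClosed {f : C(Torus P, ℂ) |
        inner ℂ g (ContinuousMap.toLp 2 (haarT P) ℂ f) = 0} :=
      isClosed_eq (continuous_const.inner (ContinuousLinearMap.continuous _)) continuous_const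
    have hsub : (expPolyAlgebra P : Set C(Torus P, ℂ)) ⊆
        {f : C(Torus P, ℂ) | inner ℂ g (ContinuousMap.toLp 2 (haarT P) ℂ f) = 0} :=
      fun f (hf : ⇑f ∈ expPoly P) => (hinner f).trans (h f hf)
    have hcl := hclosed.closure_subset_iff.2 hsub
    rw [← StarSubalgebra.topologicalClosure_coe, expPolyAlgebra_topologicalClosure P b] at hcl
    exact fun f => hcl (Set.mem_univ f)
  have hdense : DenseRange (ContinuousMap.toLp 2 (haarT P) ℂ :
      C(Torus P, ℂ) →L[ℂ] Lp ℂ 2 (haarT P)) :=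
    ContinuousMap.toLp_denseRange ℂ (haarT P) ℂ (by norm_num)
  have hg0 : g = 0 := inner_self_eq_zero.1 <| hdense.induction_on
    (p := fun f => inner ℂ g f = 0) g
    (isClosed_eq (continuous_const.inner continuous_id) continuous_const) hzero
  filter_upwards [hg, Lp.coeFn_zero ℂ 2 (haarT P)] with t h1 h2
  rw [hg0, h2] at h1
  simpa using congrArg star h1.symm

/-- The Weyl group permutes the finitely many coroots, and these span V. -/
instance finite_weyl : Finite (weyl P) := by
  have hmem : ∀ w ∈ weyl P, ∀ i, w (P.coroot i) ∈ Set.range P.coroot ∧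
      w⁻¹ (P.coroot i) ∈ Set.range P.coroot := by
    intro w hw
    induction hw using Subgroup.closure_induction with
    | mem x hx =>
      obtain ⟨j, rfl⟩ := hx
      rw [P.coreflection_inv]
      exact fun i => ⟨⟨_, P.coroot_reflectionPerm j i⟩, ⟨_, P.coroot_reflectionPerm j i⟩⟩
    | one => exact fun i => ⟨⟨i, rfl⟩, ⟨i, by simp⟩⟩
    | mul x y _ _ hx hy =>
      intro i
      rw [mul_inv_rev]
      obtain ⟨j, hj⟩ := (hy i).1
      obtain ⟨l, hl⟩ := (hx i).2
      constructor
      · rw [LinearEquiv.mul_apply, ← hj]; exact (hx j).1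
      · rw [LinearEquiv.mul_apply, ← hl]; exact (hy l).2
    | inv x _ hx =>
      rw [inv_inv]
      exact fun i => (hx i).symm
  let F : weyl P → ι → Set.range P.coroot := fun w i => ⟨w.1 (P.coroot i), (hmem w.1 w.2 i).1⟩
  refine Finite.of_injective F fun v w h => ?_
  have hs : Submodule.span ℝ (Set.range P.coroot) = ⊤ :=
    RootPairing.IsRootSystem.span_coroot_eq_top
  apply Subtype.ext
  apply LinearEquiv.toLinearMap_injective
  refine LinearMap.ext_on hs ?_
  rintro _ ⟨i, rfl⟩
  exact congrArg Subtype.val (congrFun h i)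

lemma expWeight_weyl {w : V ≃ₗ[ℝ] V} (hw : w ∈ weyl P) : ∀ l ∈ weights P,
    (∃ m ∈ weights P, ∀ h, expWeight P l (proj P (w h)) = expWeight P m (proj P h)) ∧
      ∃ m ∈ weights P, ∀ h, expWeight P l (proj P (w⁻¹ h)) = expWeight P m (proj P h) := by
  induction hw using Subgroup.closure_induction with
  | mem x hx =>
    obtain ⟨i, rfl⟩ := hx
    rw [P.coreflection_inv]
    intro l hl
    have := expWeight_coreflection hl i
    exact ⟨⟨_, reflection_mem_weights hl i, this⟩, ⟨_, reflection_mem_weights hl i, this⟩⟩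
  | one => exact fun l hl => ⟨⟨l, hl, fun h => rfl⟩, ⟨l, hl, fun h => rfl⟩⟩
  | mul x y _ _ hx hy =>
    intro l hl
    rw [mul_inv_rev]
    obtain ⟨m, hm, hm'⟩ := (hx l hl).1
    obtain ⟨n, hn, hn'⟩ := (hy m hm).1
    obtain ⟨m', hm1, hm1'⟩ := (hy l hl).2
    obtain ⟨n', hn1, hn1'⟩ := (hx m' hm1).2
    exact ⟨⟨n, hn, fun h => (hm' (y h)).trans (hn' h)⟩,
      ⟨n', hn1, fun h => (hm1' (x⁻¹ h)).trans (hn1' h)⟩⟩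
  | inv x _ hx =>
    rw [inv_inv]
    exact fun l hl => (hx l hl).symm

lemma comp_weylT_mem_expPoly (w : weyl P) {p : Torus P → ℂ} (hp : p ∈ expPoly P) :
    (fun t => p (weylT P w t)) ∈ expPoly P := by
  induction hp using Submodule.span_induction with
  | mem x hx =>
    obtain ⟨l, hl, rfl⟩ := hx
    obtain ⟨m, hm, h⟩ := (expWeight_weyl P w.2 l hl).1
    refine Submodule.subset_span ⟨m, hm, funext fun t => ?_⟩
    obtain ⟨h', rfl⟩ := proj_surjective P t
    exact (h h').symm
  | zero => exact zero_mem _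
  | add x y _ _ hx hy => exact add_mem hx hy
  | smul c x _ hx => exact Submodule.smul_mem _ c hx

lemma exists_weyl_average {p : Torus P → ℂ} (hp : p ∈ expPoly P) :
    (fun t => ∑ᶠ w, p (weylT P w t)) ∈ expPolyW P := by
  have := Fintype.ofFinite (weyl P)
  simp only [finsum_eq_sum_of_fintype]
  refine ⟨?_, fun v t => ?_⟩
  · have := Submodule.sum_mem (expPoly P) (t := Finset.univ)
      (f := fun (w : weyl P) t => p (weylT P w t)) fun w _ => comp_weylT_mem_expPoly P w hp
    have h2 : (fun t => ∑ w, p (weylT P w t)) = ∑ w, fun t => p (weylT P w t) := by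
      funext t
      simp
    rw [h2]
    exact this
  · obtain ⟨h, rfl⟩ := proj_surjective P t
    refine Fintype.sum_equiv (Equiv.mulRight v) _ _ fun w => rfl

variable {P}

/-- The class of an invariant square integrable function. -/
def toL2W {u : Torus P → ℂ} (hu : MemLp u 2 (haarT P)) (hW : u ∈ invariants P) : L2W P :=
  ⟨hu.toLp, fun w => by
    filter_upwards [hu.coeFn_toLp, (weylT_measurePreserving P w).quasiMeasurePreserving.ae
      hu.coeFn_toLp] with t h1 h2
    rw [h1, h2, hW w t]⟩

lemma coeFn_toL2W {u : Torus P → ℂ} (hu : MemLp u 2 (haarT P)) (hW : u ∈ invariants P) :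
    (toL2W hu hW : Lp ℂ 2 (haarT P)) =ᵐ[haarT P] u := hu.coeFn_toLp

lemma inner_eq_integral {f g : L2W P} {u v : Torus P → ℂ}
    (hf : (f : Lp ℂ 2 (haarT P)) =ᵐ[haarT P] u) (hg : (g : Lp ℂ 2 (haarT P)) =ᵐ[haarT P] v) :
    inner ℂ f g = ∫ t, conj (u t) * v t ∂haarT P := by
  rw [Submodule.coe_inner, L2.inner_def]
  refine integral_congr_ae ?_
  filter_upwards [hf, hg] with t h1 h2
  rw [h1, h2, RCLike.inner_apply, mul_comm]

lemma eq_of_ae_eq {f g : L2W P} {u : Torus P → ℂ} (hf : (f : Lp ℂ 2 (haarT P)) =ᵐ[haarT P] u)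
    (hg : (g : Lp ℂ 2 (haarT P)) =ᵐ[haarT P] u) : f = g :=
  Subtype.ext (Lp.ext (hf.trans hg.symm))

variable {k : ι → ℝ} (hkr : ∀ i j, k (P.reflectionPerm i j) = k j) (hk : ∀ i, 0 ≤ k i)

include hk in
lemma continuous_mul_groundState {p : Torus P → ℂ} (hp : Continuous p) :
    Continuous fun t => p t * groundState P b k t :=
  hp.mul (Complex.continuous_ofReal.comp (continuous_groundState b hk))

include hkr in
lemma mul_groundState_mem_invariants {p : Torus P → ℂ} (hp : p ∈ invariants P) :
    (fun t => p t * groundState P b k t) ∈ invariants P := by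
  intro w t
  have := groundState_mem_invariants b hkr w t
  simp only at this ⊢
  rw [this, hp w t]

lemma ae_groundState_ne_zero : ∀ᵐ t ∂haarT P, groundState P b k t ≠ 0 := by
  filter_upwards [ae_absSin_ne_zero P] with t ht
  exact Finset.prod_ne_zero_iff.2 fun i _ =>
    (Real.rpow_pos_of_pos ((absSin_nonneg i t).lt_of_ne' (ht i)) _).ne'

include hkr hk in
-- If g is orthogonal to ℂ[P]^W Δ, averaging over W shows that ḡΔ integrates to 0 against all of
-- ℂ[P]. So ḡΔ = 0, and Δ is nonzero almost everywhere.
lemma dense_jacobiDomain : Dense (jacobiDomain P b k : Set (L2W P)) := by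
  rw [Submodule.dense_iff_topologicalClosure_eq_top, Submodule.topologicalClosure_eq_top_iff,
    Submodule.eq_bot_iff]
  intro g hg
  have hgLp := Lp.memLp (g : Lp ℂ 2 (haarT P))
  set G : Torus P → ℂ := ⇑(g : Lp ℂ 2 (haarT P)) with hG
  have hρc : Continuous fun t => (groundState P b k t : ℂ) :=
    Complex.continuous_ofReal.comp (continuous_groundState b hk)
  have hmem : MemLp (fun t => conj (G t) * groundState P b k t) 2 (haarT P) := by
    refine hgLp.star.of_le (hgLp.star.1.mul hρc.aestronglyMeasurable) (.of_forall fun t => ?_)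
    rw [norm_mul, Complex.norm_real, Real.norm_of_nonneg (groundState_nonneg b k t)]
    exact mul_le_of_le_one_right (norm_nonneg _) (groundState_le_one b hk t)
  have hint : ∀ p ∈ expPoly P, Integrable (fun t => conj (G t) * groundState P b k t * p t)
      (haarT P) := fun p hp =>
    hmem.integrable_mul (memLp_of_continuous P (continuous_of_mem_C2 (expPoly_le_C2 P hp)))
  have hzero : ∀ p ∈ expPoly P, ∫ t, conj (G t) * groundState P b k t * p t ∂haarT P = 0 := by
    intro p hp
    have hfin := Fintype.ofFinite (weyl P)
    have hav := exists_weyl_average P hp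
    simp only [finsum_eq_sum_of_fintype] at hav
    have hcav := continuous_of_mem_C2 (expPoly_le_C2 P hav.1)
    have h1 := (Submodule.mem_orthogonal' _ _).1 hg
      (toL2W (memLp_of_continuous P (continuous_mul_groundState b hk hcav))
        (mul_groundState_mem_invariants b hkr hav.2)) ⟨_, hav, coeFn_toL2W _ _⟩
    rw [inner_eq_integral (u := G) (Filter.EventuallyEq.refl _ _) (coeFn_toL2W _ _)] at h1
    have h2 : ∀ w, ∫ t, conj (G t) * groundState P b k t * p (weylT P w t) ∂haarT P =
        ∫ t, conj (G t) * groundState P b k t * p t ∂haarT P := by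
      intro w
      have h3 := integral_map (weylT_measurePreserving P w).measurable.aemeasurable
        (f := fun t => conj (G t) * groundState P b k t * p t)
        (by rw [(weylT_measurePreserving P w).map_eq]; exact (hint p hp).aestronglyMeasurable)
      rw [(weylT_measurePreserving P w).map_eq] at h3
      rw [h3]
      refine integral_congr_ae ?_
      filter_upwards [g.2 w] with t ht
      have h4 := groundState_mem_invariants b hkr w t
      simp only at h4
      rw [h4, hG, ht]
    have h5 : ∫ t, conj (G t) * ((∑ w, p (weylT P w t)) * groundState P b k t) ∂haarT P =
        ∑ w : weyl P, ∫ t, conj (G t) * groundState P b k t * p (weylT P w t) ∂haarT P := by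
      rw [← integral_finsetSum _ fun w _ => hint _ (comp_weylT_mem_expPoly P w hp)]
      congr 1
      funext t
      rw [← Finset.mul_sum]
      ring
    rw [h5, Finset.sum_congr rfl fun w _ => h2 w, Finset.sum_const, nsmul_eq_mul] at h1
    exact (mul_eq_zero.1 h1).resolve_left (by simp)
  have hG0 : G =ᵐ[haarT P] 0 := by
    filter_upwards [ae_eq_zero_of_forall_integral_mul_eq_zero P b hmem hzero,
      ae_groundState_ne_zero b (k := k)] with t h1 h2
    have := (mul_eq_zero.1 h1).resolve_right (by exact_mod_cast h2)
    simpa using this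
  exact eq_of_ae_eq hG0 (Lp.coeFn_zero ℂ 2 (haarT P))

end Density

/-! ### The Hamiltonian and its adjoint -/

section Hamiltonian

open scoped Classical ComplexConjugate

variable {P}

lemma star_mem_C2 {u : Torus P → ℂ} (hu : u ∈ C2 P) : star u ∈ C2 P :=
  Complex.conjCLE.contDiff.comp ((mem_C2 P).1 hu)

lemma dirDeriv_star (v : V) (u : Torus P → ℂ) : dirDeriv P v (star u) = star (dirDeriv P v u) := by
  funext t
  obtain ⟨h, rfl⟩ := proj_surjective P t
  rw [Pi.star_apply, dirDeriv_proj, dirDeriv_proj]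
  have := Complex.conjCLE.comp_fderiv (f := fun h => u (proj P h)) (x := h)
  exact DFunLike.congr_fun this v

lemma laplacianT_star {u : Torus P → ℂ} (hu : u ∈ C2 P) :
    laplacianT P (star u) = star (laplacianT P u) := by
  funext t
  rw [Pi.star_apply, laplacianT_eq_sum P hu, laplacianT_eq_sum P (star_mem_C2 hu), star_sum]
  simp only [dirDeriv_star, Pi.star_apply]

variable [P.IsCrystallographic] (b : P.Base) {k : ι → ℝ}

lemma jacobiOp_star {p : Torus P → ℂ} (hp : p ∈ C2 P) (h : V) :
    jacobiOp b k (star p) h = star (jacobiOp b k p h) := by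
  simp only [jacobiOp, laplacianT_star hp, dirDeriv_star, Pi.star_apply, star_sub, star_neg,
    star_sum, star_mul', Complex.star_def, Complex.conj_ofReal]

variable [P.IsRootSystem]

lemma memLp_potentialTerm_mul {u : Torus P → ℂ} (hu : Continuous u) {C : ℝ} (hC : 0 ≤ C) {i : ι}
    (hb : ∀ t, ‖u t‖ ≤ C * absSin P i t ^ 2) :
    MemLp (fun t => (potentialTerm P i t : ℂ) * u t) 2 (haarT P) := by
  refine MemLp.of_bound ((Complex.measurable_ofReal.comp
    (measurable_potentialTerm i)).mul hu.measurable).aestronglyMeasurable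
    (|rootNormSq P i| * C) (.of_forall fun t => ?_)
  have h0 := absSin_nonneg i t
  have h1 := absSin_le_one i t
  have hu := hb t
  rw [norm_mul, Complex.norm_real, potentialTerm, norm_mul, Real.norm_eq_abs, mul_assoc]
  refine mul_le_mul_of_nonneg_left ?_ (abs_nonneg _)
  rcases h0.eq_or_lt with hs | hs
  · have hu0 : ‖u t‖ = 0 := le_antisymm (by simpa [← hs] using hu) (norm_nonneg _)
    rw [hu0, mul_zero]
    exact hC
  · have hs2 : absSin P i t ^ 2 ≤ 1 := pow_le_one₀ h0 h1
    have hpos : 0 < absSin P i t ^ 2 := by positivity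
    have h2 : 1 / 12 ≤ 1 / (4 * absSin P i t ^ 2) :=
      one_div_le_one_div_of_le (by positivity) (by linarith)
    rw [Real.norm_of_nonneg (by linarith)]
    calc (1 / (4 * absSin P i t ^ 2) - 1 / 12) * ‖u t‖
        ≤ 1 / (4 * absSin P i t ^ 2) * (C * absSin P i t ^ 2) :=
          mul_le_mul (by linarith) hu (norm_nonneg _) (by positivity)
      _ = C / 4 := by field_simp
      _ ≤ C := by linarith

variable (k) in
lemma memLp_potential_mul {u : Torus P → ℂ}
    (hu : ∀ i, MemLp (fun t => (potentialTerm P i t : ℂ) * u t) 2 (haarT P)) :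
    MemLp (fun t => (potential P b k t : ℂ) * u t) 2 (haarT P) := by
  have := memLp_finsetSum (Finset.univ.filter b.IsPos)
    (f := fun i t => ((k i * (k i - 1) : ℝ) : ℂ) * ((potentialTerm P i t : ℂ) * u t))
    fun i _ => (hu i).const_mul _
  convert this using 2 with t
  rw [potential]
  push_cast
  rw [Finset.sum_mul]
  exact Finset.sum_congr rfl fun i _ => by ring

lemma memLp_hamiltonianFun {u : Torus P → ℂ} (hu : u ∈ C2 P)
    (hV : MemLp (fun t => (potential P b k t : ℂ) * u t) 2 (haarT P)) :
    MemLp (hamiltonianFun P b k u) 2 (haarT P) :=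
  (memLp_of_continuous P (continuous_laplacianT P hu)).neg.add hV

/-- With every exponent equal to 2 the ground state is ∏ sin²(α/2): smooth, and with zeros strong
enough to cancel the potential. -/
lemma mul_groundState_two_mem_C2 {p : Torus P → ℂ} (hp : p ∈ C2 P) :
    (fun t => p t * groundState P b (fun _ => 2) t) ∈ C2 P := by
  rw [mem_C2]
  have h : ∀ h, (groundState P b (fun _ => 2) (proj P h) : ℂ) =
      ((∏ i with b.IsPos i, Real.sin (P.root' i h / 2) ^ 2 : ℝ) : ℂ) := fun h => by
    simp only [groundState, absSin_proj, Real.rpow_two, sq_abs]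
  simp only [h]
  refine ((mem_C2 P).1 hp).mul (Complex.ofRealCLM.contDiff.comp (contDiff_prod fun i _ => ?_))
  have : ContDiff ℝ 2 fun h : V => P.root' i h :=
    (LinearMap.toContinuousLinearMap (P.root' i)).contDiff
  exact ((this.div_const 2).sin).pow 2

lemma groundState_two_le [P.IsReduced] (i : ι) (t : Torus P) :
    groundState P b (fun _ => 2) t ≤ absSin P i t ^ 2 := by
  have key : ∀ i, b.IsPos i → groundState P b (fun _ => 2) t ≤ absSin P i t ^ 2 := by
    intro i hi
    rw [groundState, ← Finset.mul_prod_erase _ _ (Finset.mem_filter.2 ⟨Finset.mem_univ i, hi⟩),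
      Real.rpow_two]
    exact mul_le_of_le_one_right (sq_nonneg _) (Finset.prod_le_one
      (fun j _ => Real.rpow_nonneg (absSin_nonneg j t) _)
      (fun j _ => Real.rpow_le_one (absSin_nonneg j t) (absSin_le_one j t) zero_le_two))
  by_cases hi : b.IsPos i
  · exact key i hi
  · rw [← absSin_neg]
    exact key _ ((isPos_neg_iff b i).2 hi)

variable [P.IsReduced]
  (hinv : ∀ i x y, inner ℝ (P.coreflection i x) (P.coreflection i y) = inner ℝ x y)
  (hkr : ∀ i j, k (P.reflectionPerm i j) = k j) (hk : ∀ i, 0 ≤ k i)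
  {D : Submodule ℂ (Torus P → ℂ)}

include hinv hkr in
/-- The Hamiltonian is densely defined if its domain contains the smooth invariant functions that
vanish to second order on the walls. -/
lemma dense_domain_hamiltonian
    (hD : ∀ u ∈ C2 P, (∀ i, MemLp (fun t => (potentialTerm P i t : ℂ) * u t) 2 (haarT P)) → u ∈ D) :
    Dense ((hamiltonian P b k D).domain : Set (L2W P)) := by
  -- Density is applied to the constant multiplicity 2, unrelated to the given k; the functions p ∏
  -- sin² lie in the domain.
  refine (dense_jacobiDomain b (k := fun _ => 2) (fun _ _ => rfl) fun _ => zero_le_two).mono ?_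
  rintro f ⟨p, hp, hf⟩
  have hpC2 := expPoly_le_C2 P hp.1
  have hC2 := mul_groundState_two_mem_C2 b hpC2
  have hW := mul_groundState_mem_invariants b (k := fun _ => 2) (fun _ _ => rfl) hp.2
  obtain ⟨C, hC0, hC⟩ := exists_bound_of_continuous P (continuous_of_mem_C2 hpC2)
  have hV : ∀ i, MemLp (fun t => (potentialTerm P i t : ℂ) *
      (p t * groundState P b (fun _ => 2) t)) 2 (haarT P) := fun i => by
    refine memLp_potentialTerm_mul (continuous_of_mem_C2 hC2) hC0 fun t => ?_
    rw [norm_mul, Complex.norm_real, Real.norm_of_nonneg (groundState_nonneg b _ t)]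
    exact mul_le_mul (hC t) (groundState_two_le b i t) (groundState_nonneg b _ t) hC0
  refine LinearPMap.mem_domain_iff.2 ⟨toL2W (memLp_hamiltonianFun b hC2
    (memLp_potential_mul b k hV)) (hamiltonianFun_mem_invariants hinv b hkr hC2 hW), ?_⟩
  rw [hamiltonian_graph]
  exact ⟨_, ⟨⟨hC2, hW⟩, hD _ hC2 hV⟩, hf, coeFn_toL2W _
    (hamiltonianFun_mem_invariants hinv b hkr hC2 hW)⟩

-- For the adjoint relation, this vanishing on the walls with k ≠ 0 is all that is needed from D.
variable (hDz : ∀ u ∈ C2 P ⊓ invariants P ⊓ D, ∀ i, b.IsPos i → k i ≠ 0 →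
  ∀ h, Real.sin (P.root' i h / 2) = 0 → u (proj P h) = 0)

include hinv hkr hk hDz in
-- The weak identity applied to the conjugate of p: the inner product conjugates its first argument,
-- and the Jacobi operator has real coefficients.
lemma inner_hamiltonian {p q : Torus P → ℂ} (hp : p ∈ C2 P) (hq : Continuous q)
    (hpq : ∀ h, (∀ i, Real.sin (P.root' i h / 2) ≠ 0) → q (proj P h) = jacobiOp b k p h)
    {f g : L2W P} (hf : (f : Lp ℂ 2 (haarT P)) =ᵐ[haarT P] fun t => p t * groundState P b k t)
    (hg : (g : Lp ℂ 2 (haarT P)) =ᵐ[haarT P] fun t => q t * groundState P b k t)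
    (x : (hamiltonian P b k D).domain) :
    inner ℂ g (x : L2W P) = inner ℂ f (hamiltonian P b k D x) := by
  have hx := (hamiltonian P b k D).mem_graph x
  rw [hamiltonian_graph] at hx
  obtain ⟨u, hu, hu1, hu2⟩ := hx
  obtain ⟨K, hK0, hK⟩ := exists_uniform_bound b hu.1.1 hu.1.2 hkr (hDz u hu)
  have key := integral_hamiltonianFun_mul b hinv hkr hk hu.1.1 (star_mem_C2 hp) hq.star
    (fun h hh => by rw [jacobiOp_star b hp, ← hpq h hh]) hK0 hK
  rw [inner_eq_integral hf hu2, inner_eq_integral hg hu1]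
  refine Eq.trans ?_ (key.symm.trans ?_)
  all_goals
    congr 1
    funext t
    simp only [Pi.star_apply, map_mul, Complex.conj_ofReal, Complex.star_def]
    ring

/-- The products of the invariant exponential polynomials of bounded degree and the ground state. -/
def mulGroundState (R : ℝ) : ↥(expPolyLe P R ⊓ invariants P) →ₗ[ℂ] L2W P where
  toFun p := toL2W (memLp_of_continuous P (continuous_mul_groundState b hk
    (continuous_of_mem_C2 (expPoly_le_C2 P (expPolyLe_le P R p.2.1)))))
    (mul_groundState_mem_invariants b hkr p.2.2)
  map_add' p q := by
    refine eq_of_ae_eq (coeFn_toL2W _ _) ((Lp.coeFn_add _ _).trans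
      (((coeFn_toL2W _ _).add (coeFn_toL2W _ _)).trans (.of_eq (funext fun t => ?_))))
    simp [add_mul]
  map_smul' c p := by
    refine eq_of_ae_eq (coeFn_toL2W _ _) ((Lp.coeFn_smul _ _).trans
      (((coeFn_toL2W _ _).const_smul c).trans (.of_eq (funext fun t => ?_))))
    simp [mul_assoc]

lemma coeFn_mulGroundState {R : ℝ} (p : ↥(expPolyLe P R ⊓ invariants P)) :
    (mulGroundState b hkr hk R p : Lp ℂ 2 (haarT P)) =ᵐ[haarT P]
      fun t => p.1 t * groundState P b k t :=
  coeFn_toL2W _ (mul_groundState_mem_invariants b hkr p.2.2)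

include hinv hkr hk hDz in
lemma adjoint_hamiltonian_jacobi
    (hdense : Dense ((hamiltonian P b k D).domain : Set (L2W P))) {R : ℝ} {p : Torus P → ℂ}
    (hp : p ∈ expPolyLe P R) (hpW : p ∈ invariants P) {f : L2W P}
    (hf : (f : Lp ℂ 2 (haarT P)) =ᵐ[haarT P] fun t => p t * groundState P b k t) :
    ∃ hfd : f ∈ (hamiltonian P b k D).adjoint.domain, ∃ q ∈ expPolyLe P R ⊓ invariants P,
      (∀ h, (∀ i, Real.sin (P.root' i h / 2) ≠ 0) → q (proj P h) = jacobiOp b k p h) ∧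
      ((hamiltonian P b k D).adjoint ⟨f, hfd⟩ : Lp ℂ 2 (haarT P)) =ᵐ[haarT P]
        fun t => q t * groundState P b k t := by
  have hC2 : expPolyLe P R ≤ C2 P := (expPolyLe_le P R).trans (expPoly_le_C2 P)
  obtain ⟨q, hq, hpq⟩ := exists_jacobiOp_eq b hinv hkr hp hpW
  have hg := coeFn_mulGroundState b hkr hk ⟨q, hq⟩
  have hin := inner_hamiltonian b hinv hkr hk hDz (hC2 hp) (continuous_of_mem_C2 (hC2 hq.1)) hpq
    hf hg
  have hfd := LinearPMap.mem_adjoint_domain_of_exists _ ⟨_, hin⟩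
  refine ⟨hfd, q, hq, hpq, ?_⟩
  rw [LinearPMap.adjoint_apply_eq hdense ⟨f, hfd⟩ hin]
  exact hg

include hinv hkr hk hDz in
/-- The adjoint of the Hamiltonian is essentially self-adjoint on the Jacobi polynomials. -/
theorem isEssentiallySelfAdjoint_adjoint_hamiltonian
    (hdense : Dense ((hamiltonian P b k D).domain : Set (L2W P))) :
    jacobiDomain P b k ≤ (hamiltonian P b k D).adjoint.domain ∧
      IsEssentiallySelfAdjoint ((hamiltonian P b k D).adjoint.domRestrict (jacobiDomain P b k)) := by
  have hle : jacobiDomain P b k ≤ (hamiltonian P b k D).adjoint.domain := by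
    rintro f ⟨p, hp, hf⟩
    obtain ⟨R, hR⟩ := exists_mem_expPolyLe P hp.1
    exact (adjoint_hamiltonian_jacobi b hinv hkr hk hDz hdense hR hp.2 hf).1
  have hdom : ((hamiltonian P b k D).adjoint.domRestrict (jacobiDomain P b k)).domain = jacobiDomain P b k :=
    inf_eq_left.2 hle
  refine ⟨hle, isEssentiallySelfAdjoint_of_invariant_finiteDimensional ?_ ?_ ?_⟩
  · rw [hdom]
    exact dense_jacobiDomain b hkr hk
  · rintro ⟨x, hx⟩ ⟨y, hy⟩
    obtain ⟨p, hp, hf⟩ := hx.1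
    obtain ⟨p', hp', hf'⟩ := hy.1
    obtain ⟨R, hR⟩ := exists_mem_expPolyLe P hp.1
    obtain ⟨R', hR'⟩ := exists_mem_expPolyLe P hp'.1
    obtain ⟨hfd, q, hq, hpq, hqe⟩ := adjoint_hamiltonian_jacobi b hinv hkr hk hDz hdense hR hp.2 hf
    obtain ⟨hfd', q', hq', hpq', hqe'⟩ :=
      adjoint_hamiltonian_jacobi b hinv hkr hk hDz hdense hR' hp'.2 hf'
    have h1 : (hamiltonian P b k D).adjoint.domRestrict (jacobiDomain P b k) ⟨x, hx⟩ =
      (hamiltonian P b k D).adjoint ⟨x, hfd⟩ := LinearPMap.domRestrict_apply rfl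
    have h2 : (hamiltonian P b k D).adjoint.domRestrict (jacobiDomain P b k) ⟨y, hy⟩ =
      (hamiltonian P b k D).adjoint ⟨y, hfd'⟩ := LinearPMap.domRestrict_apply rfl
    change inner ℂ ((hamiltonian P b k D).adjoint.domRestrict (jacobiDomain P b k) ⟨x, hx⟩) y =
      inner ℂ x ((hamiltonian P b k D).adjoint.domRestrict (jacobiDomain P b k) ⟨y, hy⟩)
    rw [h1, h2, inner_eq_integral hqe hf', inner_eq_integral hf hqe']
    have hC2 : ∀ R, expPolyLe P R ≤ C2 P := fun R => (expPolyLe_le P R).trans (expPoly_le_C2 P)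
    choose r hr hpr using fun i => exists_cot_mul_dirDeriv hinv hR hp.2 i
    choose r' hr' hpr' using fun i => exists_cot_mul_dirDeriv hinv hR' hp'.2 i
    have key := integral_jacobiOp_symm b hinv hkr hk (star_mem_C2 (hC2 _ hR)) (hC2 _ hR')
      (q := star q) (fun h hh => by rw [jacobiOp_star b (hC2 _ hR), ← hpq h hh, Pi.star_apply]) hpq'
      (r := fun i => star (r i))
      (fun i => (continuous_of_mem_C2 (hC2 _ (hr i))).star)
      (fun i => continuous_of_mem_C2 (hC2 _ (hr' i)))
      (fun i h => by
        have := congrArg star (hpr i h)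
        rw [dirDeriv_star, Pi.star_apply, Pi.star_apply]
        simpa only [star_mul', Complex.star_def, Complex.conj_ofReal] using this) hpr'
      (continuous_of_mem_C2 (hC2 _ hq.1)).star (continuous_of_mem_C2 (hC2 _ hq'.1))
    refine Eq.trans ?_ (key.trans ?_)
    all_goals
      congr 1
      funext t
      simp only [Pi.star_apply, map_mul, Complex.conj_ofReal, Complex.star_def]
  · rintro x ⟨⟨p, hp, hf⟩, -⟩
    obtain ⟨R, hR⟩ := exists_mem_expPolyLe P hp.1
    -- The invariant subspace containing pΔ consists of all products of Δ with invariant exponential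
    -- polynomials of the same degree bound R, which the Jacobi operator does not raise.
    have hE : LinearMap.range (mulGroundState b hkr hk R) ≤ jacobiDomain P b k := by
      rintro _ ⟨p, rfl⟩
      exact ⟨p.1, ⟨expPolyLe_le P R p.2.1, p.2.2⟩, coeFn_mulGroundState b hkr hk p⟩
    refine ⟨LinearMap.range (mulGroundState b hkr hk R), inferInstance,
      ⟨⟨p, hR, hp.2⟩, eq_of_ae_eq (coeFn_mulGroundState b hkr hk _) hf⟩,
      hE.trans hdom.ge, fun y hy => ?_⟩
    obtain ⟨p', hp', hy'⟩ : ∃ p' ∈ expPolyLe P R ⊓ invariants P,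
        (y : Lp ℂ 2 (haarT P)) =ᵐ[haarT P] fun t => p' t * groundState P b k t := by
      obtain ⟨p', rfl⟩ := hy
      exact ⟨p'.1, p'.2, coeFn_mulGroundState b hkr hk p'⟩
    obtain ⟨hfd, q, hq, -, hqe⟩ := adjoint_hamiltonian_jacobi b hinv hkr hk hDz hdense hp'.1 hp'.2 hy'
    have h1 : (hamiltonian P b k D).adjoint.domRestrict (jacobiDomain P b k)
        ⟨y, hE.trans hdom.ge hy⟩ = (hamiltonian P b k D).adjoint ⟨y, hfd⟩ :=
      LinearPMap.domRestrict_apply rfl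
    rw [h1]
    exact ⟨⟨q, hq⟩, eq_of_ae_eq (coeFn_mulGroundState b hkr hk _) hqe⟩

/-- Each singular term is controlled separately, so the coefficients are concentrated at i. Square
integrability implies integrability on a probability space. -/
lemma eq_zero_on_wall_of_mem_termsDomain {u : Torus P → ℂ} (hu : u ∈ C2 P)
    (hD : u ∈ termsDomain P b) {i : ι} (hi : b.IsPos i) {h : V}
    (h0 : Real.sin (P.root' i h / 2) = 0) : u (proj P h) = 0 := by
  refine eq_zero_on_wall_of_integrable b (continuous_of_mem_C2 hu) (c := Pi.single i 1) hi
    (by simp) ?_ h0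
  refine ((hD.2 i hi).integrable one_le_two).congr (.of_forall fun t => ?_)
  simp only
  rw [Finset.sum_eq_single_of_mem i (Finset.mem_filter.2 ⟨Finset.mem_univ i, hi⟩)
    fun j _ hj => by rw [Pi.single_eq_of_ne hj, zero_mul], Pi.single_eq_same, one_mul]

/-- When k_i is 0 or 1 the term of α_i is absent from the total potential. The case 0 is harmless,
because Δ then has no factor for α_i; the case 1 is the one that must be excluded. -/
lemma eq_zero_on_wall_of_mem_potentialDomain {u : Torus P → ℂ} (hu : u ∈ C2 P)
    (hD : u ∈ potentialDomain P b k) {i : ι} (hi : b.IsPos i) (hki : k i * (k i - 1) ≠ 0) {h : V}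
    (h0 : Real.sin (P.root' i h / 2) = 0) : u (proj P h) = 0 :=
  eq_zero_on_wall_of_integrable b (continuous_of_mem_C2 hu) (c := fun j => k j * (k j - 1)) hi
    hki (hD.2.integrable one_le_two) h0

end Hamiltonian

end

end TrigCMS

/-! ### The theorem, for both choices of the domain. -/

theorem mainTheorem4 {ι M V : Type*} [Fintype ι] [AddCommGroup M] [Module ℝ M]
    [NormedAddCommGroup V] [InnerProductSpace ℝ V] [FiniteDimensional ℝ V]
    (P : RootPairing ι ℝ M V) [P.IsRootSystem] [P.IsCrystallographic] [P.IsReduced]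
    (hinv : ∀ i x y, inner ℝ (P.coreflection i x) (P.coreflection i y) = inner ℝ x y)
    (b : P.Base) (k : ι → ℝ)
    (hkW : ∀ (w : P.weylGroup) (i : ι), k (P.weylGroupToPerm w i) = k i)
    (hk : ∀ i, 0 ≤ k i) :
    (Dense ((TrigCMS.hamiltonian P b k (TrigCMS.termsDomain P b)).domain : Set (TrigCMS.L2W P)) ∧
      TrigCMS.jacobiDomain P b k ≤ (TrigCMS.hamiltonian P b k (TrigCMS.termsDomain P b)).adjoint.domain ∧
      TrigCMS.IsEssentiallySelfAdjoint
        ((TrigCMS.hamiltonian P b k (TrigCMS.termsDomain P b)).adjoint.domRestrict (TrigCMS.jacobiDomain P b k))) ∧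
    ((∀ i, k i ≠ 1) →
      Dense ((TrigCMS.hamiltonian P b k (TrigCMS.potentialDomain P b k)).domain : Set (TrigCMS.L2W P)) ∧
      TrigCMS.jacobiDomain P b k ≤ (TrigCMS.hamiltonian P b k (TrigCMS.potentialDomain P b k)).adjoint.domain ∧
      TrigCMS.IsEssentiallySelfAdjoint
        ((TrigCMS.hamiltonian P b k (TrigCMS.potentialDomain P b k)).adjoint.domRestrict
          (TrigCMS.jacobiDomain P b k))) := by
  have hkr : ∀ i j, k (P.reflectionPerm i j) = k j := fun i j => by
    have := hkW (RootPairing.weylGroup.ofIdx P i) j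
    exact this
  have h1 := TrigCMS.dense_domain_hamiltonian b hinv hkr (D := TrigCMS.termsDomain P b)
    fun u hu hV => ⟨TrigCMS.memLp_of_continuous P (TrigCMS.continuous_of_mem_C2 hu), fun i _ => hV i⟩
  refine ⟨⟨h1, TrigCMS.isEssentiallySelfAdjoint_adjoint_hamiltonian b hinv hkr hk
    (fun u hu i hi _ h h0 => TrigCMS.eq_zero_on_wall_of_mem_termsDomain b hu.1.1 hu.2 hi h0) h1⟩,
    fun hk1 => ?_⟩
  have h2 := TrigCMS.dense_domain_hamiltonian b hinv hkr (D := TrigCMS.potentialDomain P b k)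
    fun u hu hV => ⟨TrigCMS.memLp_of_continuous P (TrigCMS.continuous_of_mem_C2 hu),
      TrigCMS.memLp_potential_mul b k hV⟩
  exact ⟨h2, TrigCMS.isEssentiallySelfAdjoint_adjoint_hamiltonian b hinv hkr hk
    (fun u hu i hi hki h h0 => TrigCMS.eq_zero_on_wall_of_mem_potentialDomain b hu.1.1 hu.2 hi
      (mul_ne_zero hki (sub_ne_zero.2 (hk1 i))) h0) h2⟩
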